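/- Consider first-order formulae (with equality) over the signature $0,\ 1,\ +,\ x\mapsto t\cdot x,\ \leq$ of one-parametric Presburger arithmetic, extended with one unary function symbol $x\mapsto\left\lfloor\frac{x}{|f(t)|}\right\rfloor$ for every polynomial $f\in\mathbb{Z}[t]$. For each integer value of the parameter $t$, such formulae are interpreted over $\mathbb{Z}$ in the obvious way, where $\left\lfloor\frac{x}{|f(t)|}\right\rfloor$ is read as $0$ when $f(t)=0$. Theorem. One-parametric Presburger arithmetic admits effective quantifier elimination in the extended structure $\left\langle\mathbb{Z};\,0,\,1,\,+,\,x\mapsto t\cdot x,\,\left\{x\mapsto\left\lfloor\tfrac{x}{|f(t)|}\right\rfloor\right\}_{f\in\mathbb{Z}[t]},\,\leq\right\rangle$. That is, there is an algorithm that, given a formula $\varphi$ of the extended language (in particular, any formula of one-parametric Presburger arithmetic), computes a quantifier-free formula $\psi$ of the extended language whose free variables are among those of $\varphi$, such that for every integer value of $t$ and every integer assignment of the free variables, $\varphi$ holds if and only if $\psi$ holds. Moreover, $\psi$ uses the integer divisions only under the proviso that $f(t)\neq 0$: its truth value does not depend on how $\left\lfloor\frac{x}{|f(t)|}\right\rfloor$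 is interpreted when $f(t)=0$. -/

import Mathlib

open FirstOrder Polynomial

namespace ParametricPresburger

/-- Function symbols of the extended language: `0`, `1`, `+`, multiplication `x ↦ t · x` by the
parameter, and one unary integer division `x ↦ ⌊x / |f(t)|⌋` for each polynomial `f ∈ ℤ[t]`. -/
inductive Func : ℕ → Type
  | zero : Func 0
  | one : Func 0
  | add : Func 2
  | tmul : Func 1
  | div (f : ℤ[X]) : Func 1

/-- The only relation symbol is the binary `≤` (equality is a logical symbol). -/
inductive Rel : ℕ → Type
  | le : Rel 2

/-- The language of one-parametric Presburger arithmetic extended by integer divisions. -/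
abbrev L : Language where
  Functions := Func
  Relations := Rel

/-- The interpretation of the language on `ℤ` where the parameter `t` takes the value `k`.
The division symbol of `f` is `⌊x / |f(k)|⌋` when `f(k) ≠ 0` (`Int` division rounds down for
positive divisors). Division by zero has no canonical meaning: when `f(k) = 0`, the symbol is
interpreted by the arbitrary function `d f`. -/
abbrev str (d : ℤ[X] → ℤ → ℤ) (k : ℤ) : L.Structure ℤ where
  funMap := fun {_} s xs =>
    match s, xs with
    | .zero, _ => 0
    | .one, _ => 1
    | .add, xs => xs 0 + xs 1
    | .tmul, xs => k * xs 0
    | .div f, xs => if f.eval k = 0 then d f (xs 0) else xs 0 / |f.eval k|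
  RelMap := fun {_} r xs =>
    match r, xs with
    | .le, xs => xs 0 ≤ xs 1

/-- Truth of `φ` under the assignment `v` of its free variables, where `t = k` and division by
zero is read according to `d`. -/
def SatWith (d : ℤ[X] → ℤ → ℤ) (k : ℤ) (φ : L.Formula ℕ) (v : ℕ → ℤ) : Prop :=
  @Language.Formula.Realize L ℤ (str d k) ℕ φ v

/-- Truth of `φ` for `t = k` under the assignment `v`, where `⌊x / 0⌋` is read as `0`. -/
def Sat (k : ℤ) (φ : L.Formula ℕ) (v : ℕ → ℤ) : Prop :=
  SatWith (fun _ _ => 0) k φ v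

/-- `φ` uses the divisions `⌊x / |f(t)|⌋` only under the proviso `f(t) ≠ 0`: whatever values the
division functions take for `f(t) = 0`, the truth value of `φ` is the same. -/
def DivGuarded (φ : L.Formula ℕ) : Prop :=
  ∀ (d : ℤ[X] → ℤ → ℤ) (k : ℤ) (v : ℕ → ℤ), SatWith d k φ v ↔ Sat k φ v

/-- Gödel number of a polynomial: that of its list of coefficients `a₀, …, a_deg`. -/
noncomputable def codePoly (f : ℤ[X]) : ℕ :=
  Encodable.encode ((List.range (f.natDegree + 1)).map f.coeff)

/-- Gödel numbers of terms. Variables are free (`Sum.inl`) or bound (`Sum.inr`). -/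
noncomputable def codeTerm {n : ℕ} : L.Term (ℕ ⊕ Fin n) → ℕ
  | .var (.inl i) => Nat.pair 0 i
  | .var (.inr i) => Nat.pair 1 i
  | .func .zero _ => Nat.pair 2 0
  | .func .one _ => Nat.pair 3 0
  | .func .add ts => Nat.pair 4 (Nat.pair (codeTerm (ts 0)) (codeTerm (ts 1)))
  | .func .tmul ts => Nat.pair 5 (codeTerm (ts 0))
  | .func (.div f) ts => Nat.pair 6 (Nat.pair (codePoly f) (codeTerm (ts 0)))

/-- Gödel numbers of formulas with `n` variables bound outside. -/
noncomputable def codeBounded : {n : ℕ} → L.BoundedFormula ℕ n → ℕ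
  | _, .falsum => Nat.pair 0 0
  | _, .equal s u => Nat.pair 1 (Nat.pair (codeTerm s) (codeTerm u))
  | _, .rel .le ts => Nat.pair 2 (Nat.pair (codeTerm (ts 0)) (codeTerm (ts 1)))
  | _, .imp φ ψ => Nat.pair 3 (Nat.pair (codeBounded φ) (codeBounded ψ))
  | _, .all φ => Nat.pair 4 (codeBounded φ)

/-- Gödel numbers of formulas. -/
noncomputable def code (φ : L.Formula ℕ) : ℕ := codeBounded (n := 0) φ

/-- A transformation of formulas is effective if it is computable on Gödel numbers. -/
def Effective (F : L.Formula ℕ → L.Formula ℕ) : Prop :=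
  ∃ g : ℕ → ℕ, Computable g ∧ ∀ φ, g (code φ) = code (F φ)

end ParametricPresburger

namespace ParametricPresburger

/-! Everything rests on a uniform supply of witnesses. For quantifier-free `φ` there is a finite
list of terms, computed from `φ` alone and independent of the value `k` of the parameter and of the
assignment, such that `∃ x, φ` holds only if `φ` holds for some `x = p - q` with `p`, `q` in the
list (`Fm.exists_witness`). An existential quantifier is then a finite disjunction of substitution
instances (`Fm.elimEx`), and a universal one is `¬∃¬`. Differences appear because the language has
no subtraction.

To find the witness, fix `k` and a satisfying `x`, and treat `x` and all quotients occurring in `φ`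
as unknown integers. The truth values of the atoms and the inequalities that define the quotients
form a linear system. Its coefficients are values of polynomials at `k`, and its right-hand sides
are differences of terms in the other variables (`Fm.enforceable_holds`). It remains to show that a
solvable system of this kind has a solution built from the data in boundedly many steps
(`Levels.exists_solution`).

This takes two passes. `Levels.exists_near_solution` eliminates the unknowns one by one: an unknown
is moved until some row is nearly tight, and that row is solved for it. The result is a solution
whose distance from values of bounded complexity is at most a fixed power of `max 2 |k|`. For `|k| ≥
2` these distances have boundedly many digits in base `|k|`. Comparing both sides digit by digit
with carries (`Levels.exists_bounded_rows`) turns the system into one for the digits, whose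
coefficients are bounded independently of `k`. A second application of `Levels.exists_near_solution`
then leaves only distances bounded by a constant, and these are absorbed as integer constants.

Substituting a difference of terms requires `⌊(a - b) / |f|⌋` in terms of `⌊a / |f|⌋` and `⌊b /
|f|⌋`. This is a case distinction on the remainders (`divAlts`), and the cases include the test
`f(t) = 0`. Hence a final dummy substitution makes the formula independent of division by zero. For
effectiveness, formulas are mirrored by syntax trees `Tm`, `Fm` with the same Gödel numbers, on
which all the functions used are primitive recursive. -/

/-- Filtrations of the integers by complexity: `P c` collects the values at `k` of the polynomials
of complexity at most `c`, and `R c` the values of the differences of terms of complexity at most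
`c`. -/
structure Levels (k : ℤ) (P R : ℕ → Set ℤ) : Prop where
  P_mono : Monotone P
  R_mono : Monotone R
  P_int : ∀ m : ℤ, m ∈ P m.natAbs
  P_param : k ∈ P 1
  P_add : ∀ {c a b}, a ∈ P c → b ∈ P c → a + b ∈ P (c + 1)
  P_mul : ∀ {c d a b}, a ∈ P c → b ∈ P d → a * b ∈ P (c + d)
  P_le : ∀ {c a}, a ∈ P c → |a| ≤ max 2 |k| ^ c
  P_expand : ∀ {c a}, a ∈ P c →
    ∃ α : ℕ → ℤ, (∀ i, |α i| ≤ 2 ^ c) ∧ a = ∑ i ∈ Finset.range (c + 1), α i * |k| ^ i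
  R_one : 1 ∈ R 0
  R_add : ∀ {c x y}, x ∈ R c → y ∈ R c → x + y ∈ R (c + 1)
  R_smul : ∀ {c d a x}, a ∈ P c → x ∈ R d → a * x ∈ R (c + d)
  R_div : ∀ {c d a x}, a ∈ P c → x ∈ R d → x / |a| ∈ R (c + d + 2)

/-! ### Approximate solutions of linear systems over the integers -/

/-- A solution of linear constraints in one integer variable can be pushed until some constraint
becomes nearly tight. -/
theorem exists_nearly_tight {κ : Type*} (c g : κ → ℤ) (x : ℤ) (hx : ∀ r, c r * x ≤ g r)
    (hc : ∃ r, c r ≠ 0) :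
    ∃ (y σ : ℤ) (r : κ), |σ| = 1 ∧ (∀ r, c r * y ≤ g r) ∧ 0 < σ * c r ∧ g r - c r * y < σ * c r := by
  obtain ⟨r₀, h₀⟩ := hc
  obtain ⟨σ, hσ, hpos⟩ : ∃ σ : ℤ, |σ| = 1 ∧ 0 < σ * c r₀ := by
    rcases lt_or_gt_of_ne h₀ with h | h
    · exact ⟨-1, by simp, by linarith⟩
    · exact ⟨1, by simp, by linarith⟩
  -- Moving `x` in direction `σ` eventually violates row `r₀`. The first step that violates any row
  -- is taken, so infinitely many rows do no harm: one step earlier all rows hold, and the violated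
  -- row has slack less than `σ * c r`.
  have hex : ∃ m : ℕ, ∃ r, g r < c r * (x + σ * m) := by
    refine ⟨(g r₀ - c r₀ * x).toNat + 1, r₀, ?_⟩
    have h1 := Int.self_le_toNat (g r₀ - c r₀ * x)
    push_cast
    nlinarith
  classical
  obtain ⟨r, hr⟩ := Nat.find_spec hex
  have hmin := fun {m} => @Nat.find_min _ _ hex m
  generalize Nat.find hex = m at hr hmin
  rcases Nat.eq_zero_or_pos m with h0 | h0
  · rw [h0] at hr
    have := hx r
    simp at hr
    omega
  · obtain ⟨l, rfl⟩ : ∃ l, m = l + 1 := ⟨m - 1, by omega⟩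
    have hl : ∀ r, c r * (x + σ * l) ≤ g r := by
      have := @hmin l (by omega)
      push Not at this
      exact this
    refine ⟨x + σ * l, σ, r, hσ, hl, ?_, ?_⟩
    · have := hl r
      push_cast at hr
      nlinarith
    · push_cast at hr
      linarith

/-- Exponent of the distance in `Levels.exists_near_solution`. -/
def nearExp (n : ℕ) : ℕ := n.rec 0 fun _ e => 5 * e + 4

/-- Complexity of the approximate solutions in `Levels.exists_near_solution`. -/
def nearLevel (n c : ℕ) : ℕ := 8 ^ (n + 1) * (c + n + 1)

theorem nearExp_succ (n : ℕ) : nearExp (n + 1) = 5 * nearExp n + 4 := rfl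

theorem nearExp_mono : Monotone nearExp :=
  monotone_nat_of_le_succ fun n => by rw [nearExp_succ]; omega

theorem nearLevel_mono {n m c d : ℕ} (h : n ≤ m) (h' : c ≤ d) : nearLevel n c ≤ nearLevel m d :=
  Nat.mul_le_mul (Nat.pow_le_pow_right (by norm_num) (by omega)) (by omega)

/-- Eliminating one unknown turns coefficients of complexity `c` into ones of complexity at most `3
* c + 5`. The surplus on the left pays for converting approximations of the remaining unknowns into
approximations of the original ones. -/
theorem nearLevel_succ_ge (n c : ℕ) :
    nearLevel n (3 * c + 5) + 4 * c + n + 20 ≤ nearLevel (n + 1) c := by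
  have h : 8 ≤ 8 ^ (n + 1) := by
    calc 8 = 8 ^ 1 := rfl
      _ ≤ 8 ^ (n + 1) := Nat.pow_le_pow_right (by norm_num) (by omega)
  unfold nearLevel
  rw [pow_succ 8 (n + 1)]
  nlinarith

namespace Levels

variable {k : ℤ} {P R : ℕ → Set ℤ}

theorem R_neg (h : Levels k P R) {c x} (hx : x ∈ R c) : -x ∈ R (c + 1) := by
  have := h.R_smul (h.P_int (-1)) hx
  simp only [neg_mul, one_mul] at this
  exact h.R_mono (by simp; omega) this

theorem R_of_P (h : Levels k P R) {c a} (ha : a ∈ P c) : a ∈ R c := by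
  simpa using h.R_smul ha h.R_one

theorem R_int (h : Levels k P R) (m : ℤ) : m ∈ R m.natAbs := h.R_of_P (h.P_int m)

theorem R_sub (h : Levels k P R) {c x y} (hx : x ∈ R c) (hy : y ∈ R c) : x - y ∈ R (c + 2) :=
  sub_eq_add_neg x y ▸ h.R_add (h.R_mono (by omega) hx) (h.R_neg hy)

theorem P_neg (h : Levels k P R) {c x} (hx : x ∈ P c) : -x ∈ P (c + 1) := by
  have := h.P_mul (h.P_int (-1)) hx
  simp only [neg_mul, one_mul] at this
  exact h.P_mono (by simp; omega) this

theorem P_sub (h : Levels k P R) {c x y} (hx : x ∈ P c) (hy : y ∈ P c) : x - y ∈ P (c + 2) :=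
  sub_eq_add_neg x y ▸ h.P_add (h.P_mono (by omega) hx) (h.P_neg hy)

theorem P_abs_param (h : Levels k P R) : |k| ∈ P 2 := by
  rcases abs_choice k with h' | h' <;> rw [h']
  · exact h.P_mono (by norm_num) h.P_param
  · exact h.P_neg h.P_param

theorem P_sign (h : Levels k P R) {σ : ℤ} (hσ : |σ| = 1) : σ ∈ P 1 := by
  have := h.P_int σ
  rwa [Int.natAbs_eq_iff.2 (by simpa using (abs_eq (by norm_num)).1 hσ : σ = (1 : ℕ) ∨ σ = -(1 : ℕ))]
    at this

theorem P_abs_param_pow (h : Levels k P R) (i : ℕ) : |k| ^ i ∈ P (2 * i + 1) := by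
  induction i with
  | zero => simpa using h.P_int 1
  | succ i ih => rw [pow_succ]; exact h.P_mono (by omega) (h.P_mul ih h.P_abs_param)

theorem R_sum (h : Levels k P R) {ι : Type*} (S : Finset ι) (f : ι → ℤ) {c : ℕ}
    (hf : ∀ j ∈ S, f j ∈ R c) : ∑ j ∈ S, f j ∈ R (c + S.card) := by
  classical
  induction S using Finset.induction_on with
  | empty => simpa using h.R_mono (Nat.zero_le c) (h.R_int 0)
  | insert i S hi ih =>
    rw [Finset.sum_insert hi, Finset.card_insert_of_notMem hi, ← add_assoc]
    refine h.R_add (h.R_mono (by omega) (hf i (by simp))) (ih fun j hj => hf j ?_)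
    exact Finset.mem_insert_of_mem hj

end Levels

theorem abs_sum_mul_le {ι : Type*} (S : Finset ι) (u w : ι → ℤ) {U W : ℤ}
    (hu : ∀ j ∈ S, |u j| ≤ U) (hw : ∀ j ∈ S, |w j| ≤ W) :
    |∑ j ∈ S, u j * w j| ≤ S.card * (U * W) := by
  refine (Finset.abs_sum_le_sum_abs _ _).trans ?_
  rw [← nsmul_eq_mul]
  refine Finset.sum_le_card_nsmul _ _ _ fun j hj => ?_
  rw [abs_mul]
  exact mul_le_mul (hu j hj) (hw j hj) (abs_nonneg _) ((abs_nonneg _).trans (hu j hj))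

/-- Division by `A ≥ 1` does not enlarge the error, and the floor adds at most one. -/
theorem abs_sub_ediv_le {A x N M : ℤ} (hA : 0 < A) (h : |A * x - N| ≤ M) :
    |x - N / A| ≤ M + 1 := by
  have h1 := Int.mul_ediv_add_emod N A
  have h2 := Int.emod_nonneg N hA.ne'
  have h3 := Int.emod_lt_of_pos N hA
  have h4 := abs_le.1 h
  rw [abs_le]
  constructor <;> nlinarith

namespace Levels

variable {k : ℤ} {P R : ℕ → Set ℤ}

set_option maxHeartbeats 1000000 in
/-- A solvable system of linear inequalities with coefficients in `P c` has a solution within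
bounded distance of elements of `R`. -/
theorem exists_near_solution (h : Levels k P R) {ι κ : Type*} [DecidableEq ι] (S : Finset ι) :
    ∀ (c : ℕ) (B : ℤ) (a : κ → ι → ℤ) (β δ : κ → ℤ) (X : ι → ℤ),
      S.card + 2 ≤ B → (∀ r, ∀ j ∈ S, a r j ∈ P c ∧ |a r j| ≤ B) →
      (∀ r, β r ∈ R c ∧ |δ r| ≤ B) → (∀ r, ∑ j ∈ S, a r j * X j ≤ β r + δ r) →
      ∃ X' : ι → ℤ, (∀ r, ∑ j ∈ S, a r j * X' j ≤ β r + δ r) ∧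
        ∀ j ∈ S, ∃ q ∈ R (nearLevel S.card c), |X' j - q| ≤ B ^ nearExp S.card := by
  induction S using Finset.induction_on with
  | empty =>
    intro c B a β δ X _ _ _ hX
    exact ⟨X, hX, by simp⟩
  | insert i S hi ih =>
    intro c B a β δ X hB ha hβ hX
    rw [Finset.card_insert_of_notMem hi] at hB ⊢
    set n := S.card with hn
    simp only [Finset.sum_insert hi] at hX ⊢
    have hS : ∀ {j}, j ∈ S → j ∈ insert i S := fun hj => Finset.mem_insert_of_mem hj
    have hi' : i ∈ insert i S := Finset.mem_insert_self i S
    have hne : ∀ {j}, j ∈ S → j ≠ i := fun hj e => hi (e ▸ hj)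
    push_cast at hB
    have hn0 : (0 : ℤ) ≤ n := Nat.cast_nonneg n
    have hB1 : 1 ≤ B := by omega
    have hsucc := nearLevel_succ_ge n c
    -- A value for the unknown `i` and values for the others may be found separately and glued.
    have key : ∀ (x : ℤ) (Y : ι → ℤ), (∃ q ∈ R (nearLevel (n + 1) c), |x - q| ≤ B ^ nearExp (n + 1)) →
        (∀ j ∈ S, ∃ q ∈ R (nearLevel (n + 1) c), |Y j - q| ≤ B ^ nearExp (n + 1)) →
        (∀ r, a r i * x + ∑ j ∈ S, a r j * Y j ≤ β r + δ r) →
        ∃ X' : ι → ℤ, (∀ r, a r i * X' i + ∑ j ∈ S, a r j * X' j ≤ β r + δ r) ∧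
          ∀ j ∈ insert i S, ∃ q ∈ R (nearLevel (n + 1) c), |X' j - q| ≤ B ^ nearExp (n + 1) := by
      intro x Y hx hY hr
      refine ⟨Function.update Y i x, fun r => ?_, fun j hj => ?_⟩
      · rw [Function.update_self]
        convert hr r using 2
        exact Finset.sum_congr rfl fun j hj => by rw [Function.update_of_ne (hne hj)]
      · rcases Finset.mem_insert.1 hj with rfl | hj
        · rwa [Function.update_self]
        · rw [Function.update_of_ne (hne hj)]
          exact hY j hj
    by_cases hc : ∃ r, a r i ≠ 0
    swap
    · push Not at hc
      simp only [hc, zero_mul, zero_add] at hX key ⊢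
      obtain ⟨Y, hY, hq⟩ := ih c B a β δ X (by omega) (fun r j hj => ha r j (hS hj)) hβ hX
      refine key 0 Y ⟨0, h.R_mono (Nat.zero_le _) (h.R_int 0), by simpa using by positivity⟩
        (fun j hj => ?_) hY
      obtain ⟨q, hq, hle⟩ := hq j hj
      exact ⟨q, h.R_mono (nearLevel_mono (by omega) le_rfl) hq,
        hle.trans (pow_le_pow_right₀ hB1 (nearExp_mono (by omega)))⟩
    -- With the other unknowns fixed, the unknown `i` moves until row `r₁` has slack `ε` with `0 ≤ ε
    -- < A`, where `A` is the absolute value of its coefficient there. That row now expresses `A *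
    -- x` through the other unknowns.
    · obtain ⟨x, σ, r₁, hσ, hx, hA0, hε⟩ := exists_nearly_tight (fun r => a r i)
        (fun r => β r + δ r - ∑ j ∈ S, a r j * X j) (X i) (fun r => by have := hX r; linarith) hc
      obtain ⟨A, hA⟩ : ∃ A, A = σ * a r₁ i := ⟨_, rfl⟩
      obtain ⟨ε, hεd⟩ : ∃ ε, ε = β r₁ + δ r₁ - ∑ j ∈ S, a r₁ j * X j - a r₁ i * x := ⟨_, rfl⟩
      have hε0 : 0 ≤ ε := by have := hx r₁; linarith
      rw [← hA] at hA0 hε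
      rw [← hεd] at hε
      have hσσ : σ * σ = 1 := by rw [← abs_mul_abs_self, hσ]; rfl
      have hAB : A ≤ B := by
        rw [← abs_of_pos hA0, hA, abs_mul, hσ, one_mul]; exact (ha r₁ i hi').2
      have hAx : A * x = σ * (β r₁ + δ r₁ - ε - ∑ j ∈ S, a r₁ j * X j) := by
        rw [hεd, hA]; ring
      -- Solving row `r₁` for an integer requires divisibility by `A`. Writing `X j = A * Y j + ρ j`
      -- and changing only the quotients `Y` while keeping the remainders `ρ` preserves it
      -- automatically.
      obtain ⟨Y, hY⟩ : ∃ Y : ι → ℤ, Y = fun j => X j / A := ⟨_, rfl⟩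
      obtain ⟨ρ, hρ⟩ : ∃ ρ : ι → ℤ, ρ = fun j => X j % A := ⟨_, rfl⟩
      have hXY : ∀ j, X j = A * Y j + ρ j := fun j => by
        rw [hY, hρ]; exact (Int.mul_ediv_add_emod _ _).symm
      have hρ0 : ∀ j, 0 ≤ ρ j := fun j => by rw [hρ]; exact Int.emod_nonneg _ hA0.ne'
      have hρA : ∀ j, ρ j < A := fun j => by rw [hρ]; exact Int.emod_lt_of_pos _ hA0
      -- The coefficients left in row `r` after multiplying it by `A > 0` and cancelling the unknown
      -- `i` against row `r₁`.
      obtain ⟨d, hd⟩ : ∃ d : κ → ι → ℤ, d = fun r j => A * a r j - σ * a r i * a r₁ j := ⟨_, rfl⟩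
      have hdsum : ∀ (Z : ι → ℤ) r, ∑ j ∈ S, d r j * Z j =
          A * ∑ j ∈ S, a r j * Z j - σ * a r i * ∑ j ∈ S, a r₁ j * Z j := fun Z r => by
        rw [Finset.mul_sum, Finset.mul_sum, ← Finset.sum_sub_distrib]
        exact Finset.sum_congr rfl fun j _ => by rw [hd]; ring
      have hsplit : ∀ (Z : ι → ℤ) r, ∑ j ∈ S, A * d r j * Z j + ∑ j ∈ S, d r j * ρ j =
          ∑ j ∈ S, d r j * (A * Z j + ρ j) := fun Z r => by
        rw [← Finset.sum_add_distrib]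
        exact Finset.sum_congr rfl fun j _ => by ring
      have hσP : σ ∈ P 1 := h.P_sign hσ
      have hAP : A ∈ P (c + 1) := by
        rw [hA, add_comm]; exact h.P_mul hσP (ha r₁ i hi').1
      have hdP : ∀ r, ∀ j ∈ S, d r j ∈ P (2 * c + 3) := fun r j hj => by
        rw [hd]
        refine h.P_sub ?_ ?_
        · exact h.P_mono (by omega) (h.P_mul hAP (ha r j (hS hj)).1)
        · exact h.P_mono (by omega) (h.P_mul (h.P_mul hσP (ha r i hi').1) (ha r₁ j (hS hj)).1)
      have hdB : ∀ r, ∀ j ∈ S, |d r j| ≤ 2 * B ^ 2 := fun r j hj => by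
        rw [hd]
        refine (abs_sub _ _).trans ?_
        rw [abs_mul, abs_mul, abs_mul, hσ, abs_of_pos hA0]
        have h1 := (ha r j (hS hj)).2
        have h2 := (ha r i hi').2
        have h3 := (ha r₁ j (hS hj)).2
        have h4 := mul_le_mul hAB h1 (abs_nonneg _) (by omega)
        have h5 := mul_le_mul h2 h3 (abs_nonneg _) (by omega)
        linarith
      have hB2 : (3 : ℤ) + n ≤ B := by linarith
      have hB3 : B ^ 2 * 2 + n * (2 * B ^ 2 * B) + B ^ 2 ≤ B ^ 5 := by
        have h1 : B ^ 2 * 2 + n * (2 * B ^ 2 * B) + B ^ 2 ≤ B ^ 3 * (2 * (n + 1)) := by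
          nlinarith [pow_pos (by omega : 0 < B) 2]
        have h2 : 2 * ((n : ℤ) + 1) ≤ B ^ 2 := by nlinarith
        calc _ ≤ B ^ 3 * (2 * (n + 1)) := h1
          _ ≤ B ^ 3 * B ^ 2 := by gcongr
          _ = B ^ 5 := by ring
      have hB5 : B ≤ B ^ 5 := le_self_pow₀ hB1 (by norm_num)
      -- The eliminated system in the quotients `Y`. The slack and the remainders are bounded by
      -- powers of `B` but need not have small complexity, so they go into the error term `δ`; this
      -- is why the statement carries one.
      obtain ⟨Y', hY', hq⟩ := ih (3 * c + 5) (B ^ 5) (fun r j => A * d r j)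
        (fun r => A * β r - σ * a r i * β r₁)
        (fun r => A * δ r - σ * a r i * (δ r₁ - ε) - ∑ j ∈ S, d r j * ρ j) Y (by omega)
        (fun r j hj => by
          refine ⟨h.P_mono (by omega) (h.P_mul hAP (hdP r j hj)), ?_⟩
          rw [abs_mul, abs_of_pos hA0]
          have := mul_le_mul hAB (hdB r j hj) (abs_nonneg _) (by omega)
          have : B ^ 3 * 2 ≤ B ^ 3 * B ^ 2 := by gcongr; nlinarith
          linarith [show B * (2 * B ^ 2) = B ^ 3 * 2 by ring, show B ^ 3 * B ^ 2 = B ^ 5 by ring])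
        (fun r => by
          constructor
          · refine h.R_mono (by omega) (h.R_sub (c := 2 * c + 1) ?_ ?_)
            · exact h.R_mono (by omega) (h.R_smul hAP (hβ r).1)
            · exact h.R_mono (by omega) (h.R_smul (h.P_mul hσP (ha r i hi').1) (hβ r₁).1)
          · refine ((abs_sub _ _).trans (add_le_add (abs_sub _ _)
              (abs_sum_mul_le S _ _ (hdB r) (W := B) ?_))).trans ?_
            · intro j _
              rw [abs_of_nonneg (hρ0 j)]
              have := hρA j
              omega
            · rw [abs_mul, abs_mul, abs_mul, hσ, abs_of_pos hA0]
              have h1 := mul_le_mul hAB (hβ r).2 (abs_nonneg _) (by omega)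
              have h2 : |δ r₁ - ε| ≤ 2 * B := by
                have := abs_le.1 (hβ r₁).2
                rw [abs_le]
                constructor <;> linarith
              have h3 := mul_le_mul (ha r i hi').2 h2 (abs_nonneg _) (by omega)
              nlinarith)
        (fun r => by
          have h1 := hsplit Y r
          have h2 := hdsum X r
          simp only [← hXY] at h1
          have h3 := mul_le_mul_of_nonneg_left (hx r) hA0.le
          have h4 : A * (a r i * x) = σ * a r i * (β r₁ + δ r₁ - ε - ∑ j ∈ S, a r₁ j * X j) := by
            linear_combination a r i * hAx
          rw [mul_sub, h4] at h3
          linarith)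
      -- The unknown `i` is shifted so that row `r₁` keeps exactly the slack `ε`; the shift is an
      -- integer because only quotients changed.
      have hx' : A * (x + σ * ∑ j ∈ S, a r₁ j * (Y j - Y' j)) =
          σ * (β r₁ + δ r₁ - ε - ∑ j ∈ S, a r₁ j * (A * Y' j + ρ j)) := by
        have : ∑ j ∈ S, a r₁ j * X j - ∑ j ∈ S, a r₁ j * (A * Y' j + ρ j) =
            A * ∑ j ∈ S, a r₁ j * (Y j - Y' j) := by
          rw [← Finset.sum_sub_distrib, Finset.mul_sum]
          exact Finset.sum_congr rfl fun j _ => by rw [hXY]; ring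
        linear_combination hAx - σ * this
      have hpow : (B ^ 5) ^ nearExp n * B ^ 4 = B ^ nearExp (n + 1) := by
        rw [nearExp_succ, pow_add, pow_mul]
      have hD : 1 ≤ (B ^ 5) ^ nearExp n := one_le_pow₀ (one_le_pow₀ hB1)
      generalize (B ^ 5) ^ nearExp n = D at hpow hD hq
      choose! q hqR hqD using hq
      have hnear : ∀ j ∈ S, |(A * Y' j + ρ j) - A * q j| ≤ B ^ 2 * D := fun j hj => by
        have h1 := abs_le.1 (hqD j hj)
        have h2 := hρ0 j
        have h3 := hρA j
        have h4 : A * D ≤ B * D := by gcongr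
        have h5 : B * 2 * D ≤ B * B * D := by gcongr; omega
        rw [abs_le]
        constructor <;> nlinarith
      have hAqR : ∀ j ∈ S, A * q j ∈ R (nearLevel n (3 * c + 5) + c + 1) := fun j hj =>
        h.R_mono (by omega) (h.R_smul hAP (hqR j hj))
      -- The approximation of the unknown `i` comes from row `r₁` with `δ` and `ε` dropped and the
      -- other unknowns replaced by their approximations `A * q j`.
      refine key (x + σ * ∑ j ∈ S, a r₁ j * (Y j - Y' j)) (fun j => A * Y' j + ρ j)
        ⟨σ * (β r₁ - ∑ j ∈ S, a r₁ j * (A * q j)) / A, ?_, ?_⟩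
        (fun j hj => ⟨A * q j, h.R_mono (by omega) (hAqR j hj), ?_⟩) (fun r => ?_)
      · have hdiv := h.R_div hAP (h.R_smul hσP (h.R_sub (c := nearLevel n (3 * c + 5) + 2 * c + 1 + n)
          (h.R_mono (by omega) (hβ r₁).1)
          (h.R_mono (by omega) (h.R_sum S _ (c := c + (nearLevel n (3 * c + 5) + c + 1))
            fun j hj => h.R_smul (ha r₁ j (hS hj)).1 (hAqR j hj)))))
        rw [abs_of_pos hA0] at hdiv
        exact h.R_mono (by omega) hdiv
      · have hsum := abs_sum_mul_le S (a r₁) (fun j => (A * Y' j + ρ j) - A * q j)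
          (fun j hj => (ha r₁ j (hS hj)).2) hnear
        have heq : A * (x + σ * ∑ j ∈ S, a r₁ j * (Y j - Y' j)) -
            σ * (β r₁ - ∑ j ∈ S, a r₁ j * (A * q j)) =
            σ * (δ r₁ - ε - ∑ j ∈ S, a r₁ j * ((A * Y' j + ρ j) - A * q j)) := by
          simp only [mul_sub (a r₁ _) (_ + _), Finset.sum_sub_distrib]
          rw [hx']
          ring
        refine (abs_sub_ediv_le hA0 (M := 2 * B + n * (B * (B ^ 2 * D))) ?_).trans ?_
        · rw [heq, abs_mul, hσ, one_mul]
          refine (abs_sub _ _).trans (add_le_add ?_ hsum)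
          have := abs_le.1 (hβ r₁).2
          rw [abs_le]
          constructor <;> linarith
        · rw [← hpow]
          have h1 : (3 + n) * (B ^ 3 * D) ≤ B * (B ^ 3 * D) := by gcongr
          have h2 : B ^ 1 * 1 ≤ B ^ 3 * D := by gcongr; norm_num
          nlinarith
      · refine (hnear j hj).trans ?_
        rw [← hpow]
        have : B ^ 2 * D ≤ B ^ 4 * D := by gcongr; norm_num
        linarith
      · have h1 := hsplit Y' r
        have h2 := hdsum (fun j => A * Y' j + ρ j) r
        have h3 := hY' r
        refine le_of_mul_le_mul_left ?_ hA0
        have h4 : A * (a r i * (x + σ * ∑ j ∈ S, a r₁ j * (Y j - Y' j))) =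
            σ * a r i * (β r₁ + δ r₁ - ε - ∑ j ∈ S, a r₁ j * (A * Y' j + ρ j)) := by
          linear_combination a r i * hx'
        rw [mul_add, h4]
        linarith

end Levels

/-! ### Exact solutions of bounded complexity through digits in base `|k|` -/

/-- The distance in `Levels.exists_near_solution` is at most `max 2 |k| ^ distExp c`. -/
def distExp (c : ℕ) : ℕ := (2 * c + 2) * nearExp c

/-- The number of base `|k|` digits of the unknowns in `Levels.exists_solution`. -/
def digitCount (c : ℕ) : ℕ := c * (distExp c + 2)

/-- Complexity of the linear system satisfied by the digits in `Levels.exists_solution`. -/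
def digitLevel (c : ℕ) : ℕ :=
  nearLevel c c + 2 * distExp c + 2 * c + 5 + (c + distExp c + 2) * (digitCount c * 2 ^ c + 11) +
    2 ^ c

/-- Complexity of the solutions in `Levels.exists_solution`. -/
def solLevel (c : ℕ) : ℕ :=
  nearLevel (digitCount c) (digitLevel c) +
    (2 ^ c + digitCount c + 2) ^ nearExp (digitCount c) + 2 ^ distExp c +
    nearLevel c c + 5 * distExp c + 20

/-- The last summand collects all higher digits and vanishes when `0 ≤ u < T ^ m`. -/
theorem sum_digits {T : ℤ} (hT : 0 ≤ T) (u : ℤ) (m : ℕ) :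
    ∑ i ∈ Finset.range m, T ^ i * (u / T ^ i % T) + T ^ m * (u / T ^ m) = u := by
  induction m with
  | zero => simp
  | succ m ih =>
    rw [Finset.sum_range_succ, pow_succ, ← Int.ediv_ediv_of_nonneg (by positivity)]
    have := Int.mul_ediv_add_emod (u / T ^ m) T
    linear_combination ih + T ^ m * this

namespace Levels

variable {k : ℤ} {P R : ℕ → Set ℤ}

/-- Over unknowns in `[0, |k|)`, an inequality with coefficients given by base `|k|` expansions
follows from inequalities with bounded coefficients. -/
theorem exists_bounded_rows (h : Levels k P R) (hk : 0 < |k|) {ι : Type*} (S : Finset ι) (H : ℕ) :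
    ∀ (d c : ℕ) (α : ι → ℕ → ℤ) (β : ℤ) (z : ι → ℤ), (∀ j i, |α j i| ≤ H) → β ∈ R c →
      (∀ j ∈ S, 0 ≤ z j ∧ z j < |k|) →
      ∑ j ∈ S, (∑ i ∈ Finset.range d, α j i * |k| ^ i) * z j ≤ β →
      ∃ W : Set ((ι → ℤ) × ℤ),
        (∀ w ∈ W, (∀ j, |w.1 j| ≤ H) ∧ w.2 ∈ R (c + d * (S.card * H + 11)) ∧
          ∑ j ∈ S, w.1 j * z j ≤ w.2) ∧
        ∀ z' : ι → ℤ, (∀ w ∈ W, ∑ j ∈ S, w.1 j * z' j ≤ w.2) →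
          ∑ j ∈ S, (∑ i ∈ Finset.range d, α j i * |k| ^ i) * z' j ≤ β := by
  intro d
  induction d with
  | zero =>
    intro c α β z _ _ _ hβ
    exact ⟨∅, by simp, fun z' _ => by simpa using hβ⟩
  | succ d ih =>
    intro c α β z hα hβ hz hle
    have hT := h.P_abs_param
    have hdiv : β / |k| ∈ R (1 + c + 2) := h.R_div h.P_param hβ
    generalize |k| = T at *
    have hsplit : ∀ y : ι → ℤ, ∑ j ∈ S, (∑ i ∈ Finset.range (d + 1), α j i * T ^ i) * y j =
        ∑ j ∈ S, α j 0 * y j + T * ∑ j ∈ S, (∑ i ∈ Finset.range d, α j (i + 1) * T ^ i) * y j := by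
      intro y
      rw [Finset.mul_sum, ← Finset.sum_add_distrib]
      refine Finset.sum_congr rfl fun j _ => ?_
      rw [Finset.sum_range_succ', ← mul_assoc, Finset.mul_sum]
      simp only [pow_succ, pow_zero, mul_one]
      rw [add_comm, add_mul]
      congr 2
      exact Finset.sum_congr rfl fun i _ => by ring
    have hu := abs_le.1 (abs_sum_mul_le S (fun j => α j 0) z (U := H) (W := T)
      (fun j _ => hα j 0) fun j hj => by rw [abs_of_nonneg (hz j hj).1]; exact (hz j hj).2.le)
    have hβe := Int.mul_ediv_add_emod β T
    have hβ0 := Int.emod_nonneg β hk.ne'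
    have hβT := Int.emod_lt_of_pos β hk
    rw [hsplit] at hle
    simp only [hsplit]
    generalize hud : ∑ j ∈ S, α j 0 * z j = u at hu hle
    -- The carry: after the lowest coefficients have contributed `u`, the higher part is at most `β
    -- / T + w`. As `|u| ≤ S.card * H * T`, the carry is bounded independently of `T`, so it is a
    -- constant of bounded complexity.
    obtain ⟨w, hw⟩ : ∃ w, w = (β % T - u) / T := ⟨_, rfl⟩
    have hwe := Int.mul_ediv_add_emod (β % T - u) T
    have hw0 := Int.emod_nonneg (β % T - u) hk.ne'
    have hwT := Int.emod_lt_of_pos (β % T - u) hk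
    rw [← hw] at hwe
    have hwabs : w.natAbs ≤ S.card * H := by
      zify
      rw [abs_le]
      constructor
      · have : T * (-(S.card * H) - 1) < T * w := by nlinarith
        have := lt_of_mul_lt_mul_left this hk.le
        omega
      · have : T * w < T * (S.card * H + 1) := by nlinarith
        have := lt_of_mul_lt_mul_left this hk.le
        omega
    have hwR : w ∈ R (S.card * H) := h.R_mono hwabs (h.R_int w)
    generalize hK : S.card * H = K at *
    have hstep : (d + 1) * (K + 11) = d * (K + 11) + (K + 11) := by ring
    obtain ⟨W, hW, hW'⟩ := ih (c + K + 11) (fun j i => α j (i + 1)) (β / T + w) z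
      (fun j i => hα j _)
      (h.R_mono (by omega) (h.R_add (c := c + K + 3) (h.R_mono (by omega) hdiv)
        (h.R_mono (by omega) hwR))) hz (by
        have : T * ∑ j ∈ S, (∑ i ∈ Finset.range d, α j (i + 1) * T ^ i) * z j <
          T * (β / T + w + 1) := by nlinarith
        have := lt_of_mul_lt_mul_left this hk.le
        omega)
    have hγ : β % T - T * w ∈ R (c + K + 9) := by
      have : β % T = β - T * (β / T) := by linarith
      rw [this]
      refine h.R_mono (by omega) (h.R_sub (c := c + K + 7) (h.R_mono (by omega) (h.R_sub (c := c + 5)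
        (h.R_mono (by omega) hβ) (h.R_mono (by omega) (h.R_smul hT hdiv)))) ?_)
      exact h.R_mono (by omega) (h.R_smul hT hwR)
    -- With the carry fixed, the bound `β % T - T * w` on the lowest part and `T` times the bound `β
    -- / T + w` on the higher part add up to the original row. This needs no bounds on the new
    -- unknowns, so they may stop being digits.
    refine ⟨W ∪ {(fun j => α j 0, β % T - T * w), (fun j => -α j 0, T - 1 - (β % T - T * w))},
      ?_, ?_⟩
    · rintro v (hv | rfl | rfl)
      · obtain ⟨h1, h2, h3⟩ := hW v hv
        exact ⟨h1, h.R_mono (by omega) h2, h3⟩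
      · exact ⟨fun j => hα j 0, h.R_mono (by omega) hγ, by simp only [hud]; linarith⟩
      · refine ⟨fun j => by simpa using hα j 0, ?_, ?_⟩
        · refine h.R_mono (by omega : c + K + 11 ≤ _) ?_
          have hT1 : T - 1 ∈ R 4 := h.R_sub (h.R_of_P hT) (h.R_mono (Nat.zero_le 2) h.R_one)
          exact h.R_sub (h.R_mono (by omega) hT1) hγ
        · simp only [neg_mul, Finset.sum_neg_distrib, hud]
          linarith
    · intro z' hz'
      have h1 := hz' (fun j => α j 0, β % T - T * w) (by simp)
      have h2 := hz' (fun j => -α j 0, T - 1 - (β % T - T * w)) (by simp)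
      have h3 := hW' z' fun w hw => hz' w (by simp [hw])
      simp only [neg_mul, Finset.sum_neg_distrib] at h1 h2
      nlinarith

/-- A solvable system of linear inequalities with coefficients of complexity `c` and at most `c`
unknowns has a solution whose entries have complexity `solLevel c`. -/
theorem exists_solution (h : Levels k P R) {ι κ : Type*} [DecidableEq ι] (S : Finset ι) {c : ℕ}
    (hS : S.card ≤ c) (a : κ → ι → ℤ) (b : κ → ℤ) (X : ι → ℤ) (ha : ∀ r, ∀ j ∈ S, a r j ∈ P c)
    (hb : ∀ r, b r ∈ R c) (hX : ∀ r, ∑ j ∈ S, a r j * X j ≤ b r) :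
    ∃ X' : ι → ℤ, (∀ r, ∑ j ∈ S, a r j * X' j ≤ b r) ∧ ∀ j ∈ S, X' j ∈ R (solLevel c) := by
  obtain ⟨M, hM⟩ : ∃ M, M = max 2 |k| := ⟨_, rfl⟩
  have hM2 : 2 ≤ M := hM ▸ le_max_left _ _
  -- First pass: all coefficients are at most `M ^ c`, so a power of `M = max 2 |k|` serves as `B`.
  -- The exponent `2 * c + 2` makes it exceed the number of unknowns as well.
  obtain ⟨X', hX', hq⟩ := h.exists_near_solution S c (M ^ (2 * c + 2)) a b 0 X
    (by
      have h1 : 2 * c + 2 < 2 ^ (2 * c + 2) := Nat.lt_two_pow_self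
      have h2 : (2 : ℤ) ^ (2 * c + 2) ≤ M ^ (2 * c + 2) := by gcongr
      zify at h1 hS
      linarith)
    (fun r j hj => ⟨ha r j hj, (h.P_le (ha r j hj)).trans
      (hM ▸ pow_le_pow_right₀ (by omega) (by omega))⟩)
    (fun r => ⟨hb r, by simpa using by positivity⟩) (by simpa using hX)
  simp only [Pi.zero_apply, add_zero] at hX'
  choose! q hqR hqM using hq
  replace hqR : ∀ j ∈ S, q j ∈ R (nearLevel c c) := fun j hj =>
    h.R_mono (nearLevel_mono hS le_rfl) (hqR j hj)
  replace hqM : ∀ j ∈ S, |X' j - q j| ≤ M ^ distExp c := fun j hj => by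
    refine (hqM j hj).trans ?_
    rw [← pow_mul, distExp]
    exact pow_le_pow_right₀ (by omega) (Nat.mul_le_mul_left _ (nearExp_mono hS))
  obtain ⟨e, he⟩ : ∃ e, e = distExp c := ⟨_, rfl⟩
  obtain ⟨N, hN⟩ : ∃ N, N = digitCount c := ⟨_, rfl⟩
  have hNe : N = c * (e + 2) := by rw [hN, he, digitCount]
  have hsol : solLevel c = nearLevel N (digitLevel c) + (2 ^ c + N + 2) ^ nearExp N + 2 ^ e +
    nearLevel c c + 5 * e + 20 := by rw [hN, he, solLevel]
  have hdl : digitLevel c = nearLevel c c + 2 * e + 2 * c + 5 + (c + e + 2) * (N * 2 ^ c + 11) +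
    2 ^ c := by rw [hN, he, digitLevel]
  rw [← he] at hqM
  have h2e : 0 < 2 ^ e := by positivity
  have h2c : 0 < 2 ^ c := by positivity
  rw [hsol]
  rcases le_or_gt |k| 1 with hk | hk
  -- For `|k| ≤ 1` the distances are at most `2 ^ e`, hence already constants of bounded complexity.
  · refine ⟨X', hX', fun j hj => ?_⟩
    rw [max_eq_left (by omega)] at hM
    subst hM
    have h1 : X' j - q j ∈ R (2 ^ e) := h.R_mono (by zify; exact hqM j hj) (h.R_int _)
    have := h.R_add (c := nearLevel c c + 2 ^ e) (h.R_mono (by omega) (hqR j hj))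
      (h.R_mono (by omega) h1)
    rw [add_sub_cancel] at this
    exact h.R_mono (by omega) this
  rw [max_eq_right (by omega)] at hM
  subst hM
  have hk0 : (0 : ℤ) < |k| := by omega
  -- the digits of the distances
  obtain ⟨z, hz⟩ : ∃ z : ι × ℕ → ℤ, z = fun p => (X' p.1 - q p.1 + |k| ^ e) / |k| ^ p.2 % |k| :=
    ⟨_, rfl⟩
  have hz0 : ∀ p, 0 ≤ z p ∧ z p < |k| := fun p => by
    rw [hz]; exact ⟨Int.emod_nonneg _ hk0.ne', Int.emod_lt_of_pos _ hk0⟩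
  -- Adding `|k| ^ e` makes the distance nonnegative. It is then at most `2 * |k| ^ e < |k| ^ (e +
  -- 2)`, so `e + 2` digits suffice.
  have hzX : ∀ j ∈ S, q j - |k| ^ e + ∑ i ∈ Finset.range (e + 2), |k| ^ i * z (j, i) = X' j := by
    intro j hj
    have h1 := sum_digits hk0.le (X' j - q j + |k| ^ e) (e + 2)
    have h2 := abs_le.1 (hqM j hj)
    rw [Int.ediv_eq_zero_of_lt (by linarith) (by
      have : |k| ^ e * (2 * 2) ≤ |k| ^ e * (|k| * |k|) := by gcongr
      have := pow_pos hk0 e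
      rw [pow_add, pow_two]
      linarith)] at h1
    rw [hz]
    simp only
    linarith
  obtain ⟨D, hD⟩ : ∃ D, D = S ×ˢ Finset.range (e + 2) := ⟨_, rfl⟩
  have hDN : D.card ≤ N := by
    rw [hD, Finset.card_product, Finset.card_range, hNe]
    exact Nat.mul_le_mul_right _ hS
  have hrow : ∀ r (y : ι × ℕ → ℤ),
      ∑ j ∈ S, a r j * (q j - |k| ^ e + ∑ i ∈ Finset.range (e + 2), |k| ^ i * y (j, i)) =
        ∑ j ∈ S, a r j * (q j - |k| ^ e) + ∑ p ∈ D, a r p.1 * |k| ^ p.2 * y p := by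
    intro r y
    rw [hD, Finset.sum_product, ← Finset.sum_add_distrib]
    refine Finset.sum_congr rfl fun j _ => ?_
    rw [mul_add, Finset.mul_sum]
    simp only [mul_assoc]
  have hqe : ∀ j ∈ S, q j - |k| ^ e ∈ R (nearLevel c c + 2 * e + 3) := fun j hj =>
    h.R_sub (h.R_mono (by omega) (hqR j hj))
      (h.R_of_P (h.P_mono (by omega) (h.P_abs_param_pow e)))
  -- The digit at place `p.2` enters row `r` with coefficient `a r p.1 * |k| ^ p.2`, whose expansion
  -- is that of `a r p.1` shifted by `p.2` places.
  have hexp : ∀ r, ∀ p : ι × ℕ, ∃ α : ℕ → ℤ, (∀ l, |α l| ≤ (2 ^ c : ℕ)) ∧ (p ∈ D →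
      ∑ l ∈ Finset.range (c + e + 2), α l * |k| ^ l = a r p.1 * |k| ^ p.2) := by
    intro r p
    by_cases hp : p ∈ D
    swap
    · exact ⟨0, by simp, by simp [hp]⟩
    obtain ⟨hp1, hp2⟩ := Finset.mem_product.1 (hD ▸ hp)
    obtain ⟨α, hα, hae⟩ := h.P_expand (ha r p.1 hp1)
    have hp2' := Finset.mem_range.1 hp2
    refine ⟨fun l => if p.2 ≤ l ∧ l < p.2 + (c + 1) then α (l - p.2) else 0, fun l => ?_, fun _ => ?_⟩
    · dsimp only
      split_ifs
      · simpa using hα _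
      · simp
    · rw [hae, Finset.sum_mul, show c + e + 2 = p.2 + (c + 1) + (e + 1 - p.2) by omega,
        Finset.sum_range_add, Finset.sum_range_add]
      rw [Finset.sum_eq_zero, Finset.sum_eq_zero (s := Finset.range (e + 1 - p.2)), zero_add,
        add_zero]
      · refine Finset.sum_congr rfl fun l hl => ?_
        have := Finset.mem_range.1 hl
        dsimp only
        rw [if_pos ⟨by omega, by omega⟩, Nat.add_sub_cancel_left]
        ring
      · intro l _
        dsimp only
        rw [if_neg (by omega), zero_mul]
      · intro l hl
        have := Finset.mem_range.1 hl
        dsimp only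
        rw [if_neg (by omega), zero_mul]
  choose α hα hαa using hexp
  have hW := fun r => h.exists_bounded_rows hk0 D (2 ^ c) (c + e + 2)
    (nearLevel c c + 2 * e + 2 * c + 5) (α r) (b r - ∑ j ∈ S, a r j * (q j - |k| ^ e)) z (hα r)
    (h.R_sub (c := nearLevel c c + 2 * e + 2 * c + 3) (h.R_mono (by omega) (hb r))
      (h.R_mono (by omega) (h.R_sum S _ (fun j hj => h.R_smul (ha r j hj) (hqe j hj)))))
    (fun p _ => hz0 p) (by
      rw [Finset.sum_congr rfl fun p hp => by rw [hαa r p hp] ]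
      have h1 := hX' r
      rw [Finset.sum_congr rfl fun j hj => by rw [← hzX j hj], hrow] at h1
      linarith)
  choose W hW hW' using hW
  -- Second pass: the coefficients are now bounded by `2 ^ c`, so `B` and the resulting distances do
  -- not depend on `k`.
  obtain ⟨z', hz', hq'⟩ := h.exists_near_solution (κ := Σ r, W r) D (digitLevel c)
    ((2 ^ c + N + 2 : ℕ) : ℤ) (fun w => w.2.1.1) (fun w => w.2.1.2) 0 z
    (by push_cast; zify at hDN; linarith [pow_pos (two_pos : (0 : ℤ) < 2) c])
    (fun w j _ => by
      have h1 := (hW w.1 w.2.1 w.2.2).1 j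
      constructor
      · have h2 : (w.2.1.1 j).natAbs ≤ 2 ^ c := by zify; exact_mod_cast h1
        exact h.P_mono (h2.trans (hdl ▸ Nat.le_add_left _ _)) (h.P_int _)
      · push_cast at *
        linarith)
    (fun w => by
      constructor
      · refine h.R_mono ?_ (hW w.1 w.2.1 w.2.2).2.1
        rw [hdl]
        have : (c + e + 2) * (D.card * 2 ^ c + 11) ≤ (c + e + 2) * (N * 2 ^ c + 11) := by gcongr
        omega
      · simpa using by positivity)
    (fun w => by simpa using (hW w.1 w.2.1 w.2.2).2.2)
  simp only [Pi.zero_apply, add_zero] at hz'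
  have hz'R : ∀ p ∈ D, z' p ∈ R (nearLevel N (digitLevel c) + (2 ^ c + N + 2) ^ nearExp N + 1) := by
    intro p hp
    obtain ⟨q', hq'R, hle⟩ := hq' p hp
    have h1 : z' p - q' ∈ R ((2 ^ c + N + 2) ^ nearExp N) := by
      refine h.R_mono ?_ (h.R_int _)
      zify
      refine hle.trans ?_
      push_cast
      exact pow_le_pow_right₀ (by linarith [pow_pos (two_pos : (0 : ℤ) < 2) c]) (nearExp_mono hDN)
    have h2 := h.R_add (c := nearLevel N (digitLevel c) + (2 ^ c + N + 2) ^ nearExp N)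
      (h.R_mono (by have := nearLevel_mono hDN (le_refl (digitLevel c)); omega) hq'R)
      (h.R_mono (by omega) h1)
    rwa [add_sub_cancel] at h2
  refine ⟨fun j => q j - |k| ^ e + ∑ i ∈ Finset.range (e + 2), |k| ^ i * z' (j, i),
    fun r => ?_, fun j hj => ?_⟩
  · have h1 := hW' r z' fun w hw => hz' ⟨r, w, hw⟩
    rw [Finset.sum_congr rfl fun p hp => by rw [hαa r p hp] ] at h1
    rw [hrow]
    linarith
  · have hsum := h.R_sum (Finset.range (e + 2)) (fun i => |k| ^ i * z' (j, i)) fun i hi =>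
      h.R_mono (by have := Finset.mem_range.1 hi; omega :
          2 * i + 1 + _ ≤ 2 * e + 3 + (nearLevel N (digitLevel c) +
            (2 ^ c + N + 2) ^ nearExp N + 1))
        (h.R_smul (h.P_abs_param_pow i) (hz'R (j, i) (by rw [hD]; exact Finset.mk_mem_product hj hi)))
    rw [Finset.card_range] at hsum
    exact h.R_mono (by omega) (h.R_add (c := nearLevel c c + 2 * e + 3 + (2 * e + 3 +
      (nearLevel N (digitLevel c) + (2 ^ c + N + 2) ^ nearExp N + 1) + (e + 2)))
      (h.R_mono (by omega) (hqe j hj)) (h.R_mono (by omega) hsum))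

end Levels

/-! ### Gödel numbering of polynomials, terms and formulas -/

/-- A type that injects with a primitive recursive range is primitively codable. -/
@[reducible] noncomputable def primcodableOfInjective {α β : Type} [Primcodable β] (e : α → β)
    (he : Function.Injective e) (hp : PrimrecPred fun b => b ∈ Set.range e) : Primcodable α :=
  letI : DecidablePred fun b => b ∈ Set.range e := Classical.decPred _
  letI : Primcodable (Set.range e) := Primcodable.subtype hp
  Primcodable.ofEquiv (Set.range e) (Equiv.ofInjective e he)

/-- The coefficients of a polynomial, from the constant to the leading one. -/
noncomputable def coeffList (f : ℤ[X]) : List ℤ :=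
  (List.range (f.natDegree + 1)).map f.coeff

theorem coeffList_length (f : ℤ[X]) : (coeffList f).length = f.natDegree + 1 := by
  simp [coeffList]

theorem coeffList_getD (f : ℤ[X]) (i : ℕ) : (coeffList f).getD i 0 = f.coeff i := by
  by_cases h : i < f.natDegree + 1
  · simp [coeffList, h]
  · rw [coeff_eq_zero_of_natDegree_lt (by omega), List.getD_eq_default]
    rw [coeffList_length]
    omega

theorem coeffList_injective : Function.Injective coeffList := fun f g h => by
  ext i
  rw [← coeffList_getD, h, coeffList_getD]

/-- Leading coefficients are nonzero, except that the zero polynomial has degree `0` and list `[0]`.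
The empty list is excluded because its `headI` is the default value `0`. -/
theorem mem_range_coeffList {l : List ℤ} :
    l ∈ Set.range coeffList ↔ l.length = 1 ∨ l.reverse.headI ≠ 0 := by
  constructor
  · rintro ⟨f, rfl⟩
    rw [or_iff_not_imp_left, coeffList_length, coeffList, List.range_succ, List.map_append,
      List.reverse_append]
    intro h
    simp only [List.map_cons, List.map_nil, List.reverse_cons, List.reverse_nil, List.nil_append,
      List.cons_append, List.headI_cons, coeff_natDegree, ne_eq, leadingCoeff_eq_zero]
    rintro rfl
    simp at h
  · intro h
    have hl : l ≠ [] := by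
      rintro rfl
      simp [default] at h
    have hpos : 0 < l.length := List.length_pos_iff.2 hl
    let f : ℤ[X] := ∑ i ∈ Finset.range l.length, monomial i (l.getD i 0)
    have hf : ∀ i, f.coeff i = l.getD i 0 := fun i => by
      simp only [f, finsetSum_coeff, coeff_monomial, Finset.sum_ite_eq', Finset.mem_range]
      split_ifs with hi
      · rfl
      · rw [List.getD_eq_default]
        omega
    have hle : f.natDegree ≤ l.length - 1 := natDegree_le_iff_coeff_eq_zero.2 fun i hi => by
      rw [hf, List.getD_eq_default]
      omega
    have hdeg : f.natDegree + 1 = l.length := by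
      rcases h with h | h
      · omega
      · have : l.length - 1 ≤ f.natDegree := by
          refine le_natDegree_of_ne_zero ?_
          rw [hf]
          obtain ⟨l, a, rfl⟩ := (List.eq_nil_or_concat' l).resolve_left hl
          simpa using h
        omega
    refine ⟨f, List.ext_getElem ?_ fun i h1 h2 => ?_⟩
    · rw [coeffList_length, hdeg]
    · rw [← List.getD_eq_getElem _ 0 h1, ← List.getD_eq_getElem _ 0 h2, coeffList_getD, hf]

theorem primrecPred_range_coeffList : PrimrecPred fun l => l ∈ Set.range coeffList :=
  PrimrecPred.of_eq ((Primrec.eq.comp Primrec.list_length (Primrec.const 1)).or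
    (Primrec.eq.comp (Primrec.list_headI.comp Primrec.list_reverse) (Primrec.const 0)).not)
    fun _ => mem_range_coeffList.symm

noncomputable instance : Primcodable ℤ[X] :=
  primcodableOfInjective coeffList coeffList_injective primrecPred_range_coeffList

/-- The encoding is chosen to agree definitionally with the Gödel numbers of the statement, so
primitive recursion on encodings is primitive recursion on Gödel numbers. -/
theorem encode_polynomial (f : ℤ[X]) : Encodable.encode f = codePoly f := rfl

theorem primrec_coeffList : Primrec coeffList :=
  Primrec.encode_iff.1 (Primrec.encode (α := ℤ[X]))

/-- Terms of the language, with free (`Sum.inl`) and bound (`Sum.inr`) variables. -/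
inductive Tm : Type
  | var (x : ℕ ⊕ ℕ) : Tm
  | zero : Tm
  | one : Tm
  | add (s u : Tm) : Tm
  | tmul (s : Tm) : Tm
  | div (f : ℤ[X]) (s : Tm) : Tm

/-- Formulas of the language. The quantifier under `n` quantifiers binds the variable
`Sum.inr n`. -/
inductive Fm : Type
  | falsum : Fm
  | eq (s u : Tm) : Fm
  | le (s u : Tm) : Fm
  | imp (φ ψ : Fm) : Fm
  | all (φ : Fm) : Fm

/-- Gödel numbers of terms. -/
noncomputable def Tm.code : Tm → ℕ
  | .var (.inl i) => Nat.pair 0 i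
  | .var (.inr i) => Nat.pair 1 i
  | .zero => Nat.pair 2 0
  | .one => Nat.pair 3 0
  | .add s u => Nat.pair 4 (Nat.pair s.code u.code)
  | .tmul s => Nat.pair 5 s.code
  | .div f s => Nat.pair 6 (Nat.pair (codePoly f) s.code)

theorem Tm.code_injective : Function.Injective Tm.code := by
  intro s
  induction s with
  | var x => intro u h; cases x <;> rcases u with (_ | _) | _ | _ | _ | _ | _ <;> simp_all [code]
  | zero => intro u h; rcases u with (_ | _) | _ | _ | _ | _ | _ <;> simp_all [code]
  | one => intro u h; rcases u with (_ | _) | _ | _ | _ | _ | _ <;> simp_all [code]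
  | add s₁ s₂ ih₁ ih₂ =>
    intro u h
    rcases u with (_ | _) | _ | _ | _ | _ | _ <;> simp [code] at h
    rw [ih₁ h.1, ih₂ h.2]
  | tmul s ih =>
    intro u h
    rcases u with (_ | _) | _ | _ | _ | _ | _ <;> simp [code] at h
    rw [ih h]
  | div f s ih =>
    intro u h
    rcases u with (_ | _) | _ | _ | _ | _ | _ <;> simp [code] at h
    rw [ih h.2, Encodable.encode_injective (show Encodable.encode f = _ from h.1)]

/-- Codes of the immediate subterms. -/
def childCodes (n : ℕ) : List ℕ :=
  if n.unpair.1 = 4 then [n.unpair.2.unpair.1, n.unpair.2.unpair.2]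
  else if n.unpair.1 = 5 then [n.unpair.2]
  else if n.unpair.1 = 6 then [n.unpair.2.unpair.2]
  else []

theorem primrec_unpair_fst : Primrec fun n : ℕ => n.unpair.1 := Primrec.fst.comp Primrec.unpair

theorem primrec_unpair_snd : Primrec fun n : ℕ => n.unpair.2 := Primrec.snd.comp Primrec.unpair

theorem primrecPred_eq_const {α β : Type} [Primcodable α] [Primcodable β] {f : α → β}
    (hf : Primrec f) (b : β) : PrimrecPred fun a => f a = b :=
  Primrec.eq.comp hf (Primrec.const b)

theorem primrec_list_pair {α β : Type} [Primcodable α] [Primcodable β] {f g : α → β}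
    (hf : Primrec f) (hg : Primrec g) : Primrec fun a => [f a, g a] :=
  Primrec.list_cons.comp hf (Primrec.list_cons.comp hg (Primrec.const []))

theorem primrec_list_singleton {α β : Type} [Primcodable α] [Primcodable β] {f : α → β}
    (hf : Primrec f) : Primrec fun a => [f a] :=
  Primrec.list_cons.comp hf (Primrec.const [])

theorem primrec_childCodes : Primrec childCodes :=
  have h := primrec_unpair_fst
  have h' := primrec_unpair_snd
  Primrec.ite (primrecPred_eq_const h 4) (primrec_list_pair (h.comp h') (h'.comp h'))
    (Primrec.ite (primrecPred_eq_const h 5) (primrec_list_singleton h')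
      (Primrec.ite (primrecPred_eq_const h 6) (primrec_list_singleton (h'.comp h'))
        (Primrec.const [])))

theorem unpair_lt {n : ℕ} (h : 0 < n.unpair.1) : n.unpair.2 < n := by
  have := Nat.add_le_pair n.unpair.1 n.unpair.2
  rw [Nat.pair_unpair] at this
  omega

theorem lt_of_mem_childCodes {n m : ℕ} (h : m ∈ childCodes n) : m < n := by
  unfold childCodes at h
  have h1 := Nat.unpair_left_le n.unpair.2
  have h2 := Nat.unpair_right_le n.unpair.2
  split_ifs at h with h4 h5 h6
  · have := unpair_lt (n := n) (by omega)
    simp only [List.mem_cons, List.not_mem_nil, or_false] at h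
    omega
  · have := unpair_lt (n := n) (by omega)
    simp only [List.mem_cons, List.not_mem_nil, or_false] at h
    omega
  · have := unpair_lt (n := n) (by omega)
    simp only [List.mem_cons, List.not_mem_nil, or_false] at h
    omega
  · simp at h

theorem mem_range_tmCode (n : ℕ) : n ∈ Set.range Tm.code ↔
    n.unpair.1 = 0 ∨ n.unpair.1 = 1 ∨ (n.unpair.1 = 2 ∧ n.unpair.2 = 0) ∨
    (n.unpair.1 = 3 ∧ n.unpair.2 = 0) ∨
    (n.unpair.1 = 4 ∧ n.unpair.2.unpair.1 ∈ Set.range Tm.code ∧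
      n.unpair.2.unpair.2 ∈ Set.range Tm.code) ∨
    (n.unpair.1 = 5 ∧ n.unpair.2 ∈ Set.range Tm.code) ∨
    (n.unpair.1 = 6 ∧ n.unpair.2.unpair.1 ∈ Set.range (Encodable.encode : ℤ[X] → ℕ) ∧
      n.unpair.2.unpair.2 ∈ Set.range Tm.code) := by
  constructor
  · rintro ⟨t, rfl⟩
    rcases t with (_ | _) | _ | _ | _ | _ | _ <;> simp [Tm.code, encode_polynomial]
  · obtain ⟨a, b, rfl⟩ : ∃ a b, n = Nat.pair a b := ⟨_, _, (Nat.pair_unpair n).symm⟩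
    simp only [Nat.unpair_pair]
    rintro (rfl | rfl | ⟨rfl, rfl⟩ | ⟨rfl, rfl⟩ | ⟨rfl, ⟨s, hs⟩, u, hu⟩ | ⟨rfl, s, hs⟩ |
      ⟨rfl, ⟨f, hf⟩, s, hs⟩)
    · exact ⟨.var (.inl b), rfl⟩
    · exact ⟨.var (.inr b), rfl⟩
    · exact ⟨.zero, rfl⟩
    · exact ⟨.one, rfl⟩
    · exact ⟨.add s u, by rw [Tm.code, hs, hu, Nat.pair_unpair]⟩
    · exact ⟨.tmul s, by rw [Tm.code, hs]⟩
    · exact ⟨.div f s, by rw [Tm.code, hs, ← encode_polynomial, hf, Nat.pair_unpair]⟩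

/-- Course-of-values recursion: the codes of subterms are smaller than the number itself, and the
list `rs` holds the answers already found for them. -/
theorem primrecPred_range_tmCode : PrimrecPred fun n => n ∈ Set.range Tm.code := by
  classical
  have h := primrec_unpair_fst
  have h' := primrec_unpair_snd
  refine Primrec.primrecPred (Primrec.nat_omega_rec' (m := id) (l := childCodes)
    (g := fun n rs => some (decide (n.unpair.1 = 0 ∨ n.unpair.1 = 1 ∨
      (n.unpair.1 = 2 ∧ n.unpair.2 = 0) ∨ (n.unpair.1 = 3 ∧ n.unpair.2 = 0) ∨
      (n.unpair.1 = 4 ∧ rs = [true, true]) ∨ (n.unpair.1 = 5 ∧ rs = [true]) ∨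
      (n.unpair.1 = 6 ∧ n.unpair.2.unpair.1 ∈ Set.range (Encodable.encode : ℤ[X] → ℕ) ∧
        rs = [true])))) _ Primrec.id primrec_childCodes ?_
    (fun _ _ => lt_of_mem_childCodes) ?_)
  · have p1 : Primrec fun x : ℕ × List Bool => x.1.unpair.1 := h.comp Primrec.fst
    have p2 : Primrec fun x : ℕ × List Bool => x.1.unpair.2 := h'.comp Primrec.fst
    refine Primrec.option_some.comp (PrimrecPred.decide ?_)
    exact (primrecPred_eq_const p1 0).or <| (primrecPred_eq_const p1 1).or <|
      ((primrecPred_eq_const p1 2).and (primrecPred_eq_const p2 0)).or <|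
      ((primrecPred_eq_const p1 3).and (primrecPred_eq_const p2 0)).or <|
      ((primrecPred_eq_const p1 4).and (primrecPred_eq_const Primrec.snd _)).or <|
      ((primrecPred_eq_const p1 5).and (primrecPred_eq_const Primrec.snd _)).or <|
      (primrecPred_eq_const p1 6).and
        ((PrimrecPred.comp Primcodable.mem_range_encode (h.comp p2)).and (primrecPred_eq_const Primrec.snd _))
  · intro n
    simp only [Option.some.injEq, decide_eq_decide]
    rw [mem_range_tmCode]
    have key : ∀ i, n.unpair.1 = i → (i = 4 → childCodes n =
        [n.unpair.2.unpair.1, n.unpair.2.unpair.2]) ∧ (i = 5 → childCodes n = [n.unpair.2]) ∧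
        (i = 6 → childCodes n = [n.unpair.2.unpair.2]) := by
      rintro i hi
      refine ⟨?_, ?_, ?_⟩ <;> rintro rfl <;> simp [childCodes, hi]
    refine or_congr_right (or_congr_right (or_congr_right (or_congr_right (or_congr
      (and_congr_right fun e => ?_) (or_congr (and_congr_right fun e => ?_)
      (and_congr_right fun e => and_congr_right fun _ => ?_))))))
    · rw [(key _ e).1 rfl]; simp
    · rw [(key _ e).2.1 rfl]; simp
    · rw [(key _ e).2.2 rfl]; simp

noncomputable instance : Primcodable Tm :=
  primcodableOfInjective Tm.code Tm.code_injective primrecPred_range_tmCode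

theorem encode_tm (s : Tm) : Encodable.encode s = s.code := rfl

/-- Gödel numbers of formulas. -/
noncomputable def Fm.code : Fm → ℕ
  | .falsum => Nat.pair 0 0
  | .eq s u => Nat.pair 1 (Nat.pair s.code u.code)
  | .le s u => Nat.pair 2 (Nat.pair s.code u.code)
  | .imp φ ψ => Nat.pair 3 (Nat.pair φ.code ψ.code)
  | .all φ => Nat.pair 4 φ.code

theorem Fm.code_injective : Function.Injective Fm.code := by
  intro φ
  induction φ with
  | falsum => intro u h; rcases u with _ | _ | _ | _ | _ <;> simp_all [code]
  | eq s₁ s₂ =>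
    intro u h
    rcases u with _ | _ | _ | _ | _ <;> simp [code] at h
    rw [Tm.code_injective h.1, Tm.code_injective h.2]
  | le s₁ s₂ =>
    intro u h
    rcases u with _ | _ | _ | _ | _ <;> simp [code] at h
    rw [Tm.code_injective h.1, Tm.code_injective h.2]
  | imp s₁ s₂ ih₁ ih₂ =>
    intro u h
    rcases u with _ | _ | _ | _ | _ <;> simp [code] at h
    rw [ih₁ h.1, ih₂ h.2]
  | all s ih =>
    intro u h
    rcases u with _ | _ | _ | _ | _ <;> simp [code] at h
    rw [ih h]

/-- Codes of the immediate subformulas. -/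
def childCodesFm (n : ℕ) : List ℕ :=
  if n.unpair.1 = 3 then [n.unpair.2.unpair.1, n.unpair.2.unpair.2]
  else if n.unpair.1 = 4 then [n.unpair.2]
  else []

theorem primrec_childCodesFm : Primrec childCodesFm :=
  have h := primrec_unpair_fst
  have h' := primrec_unpair_snd
  Primrec.ite (primrecPred_eq_const h 3) (primrec_list_pair (h.comp h') (h'.comp h'))
    (Primrec.ite (primrecPred_eq_const h 4) (primrec_list_singleton h') (Primrec.const []))

theorem lt_of_mem_childCodesFm {n m : ℕ} (h : m ∈ childCodesFm n) : m < n := by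
  unfold childCodesFm at h
  have h1 := Nat.unpair_left_le n.unpair.2
  have h2 := Nat.unpair_right_le n.unpair.2
  split_ifs at h with h4 h5
  · have := unpair_lt (n := n) (by omega)
    simp only [List.mem_cons, List.not_mem_nil, or_false] at h
    omega
  · have := unpair_lt (n := n) (by omega)
    simp only [List.mem_cons, List.not_mem_nil, or_false] at h
    omega
  · simp at h

theorem mem_range_fmCode (n : ℕ) : n ∈ Set.range Fm.code ↔
    (n.unpair.1 = 0 ∧ n.unpair.2 = 0) ∨
    (n.unpair.1 = 1 ∧ n.unpair.2.unpair.1 ∈ Set.range (Encodable.encode : Tm → ℕ) ∧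
      n.unpair.2.unpair.2 ∈ Set.range (Encodable.encode : Tm → ℕ)) ∨
    (n.unpair.1 = 2 ∧ n.unpair.2.unpair.1 ∈ Set.range (Encodable.encode : Tm → ℕ) ∧
      n.unpair.2.unpair.2 ∈ Set.range (Encodable.encode : Tm → ℕ)) ∨
    (n.unpair.1 = 3 ∧ n.unpair.2.unpair.1 ∈ Set.range Fm.code ∧
      n.unpair.2.unpair.2 ∈ Set.range Fm.code) ∨
    (n.unpair.1 = 4 ∧ n.unpair.2 ∈ Set.range Fm.code) := by
  constructor
  · rintro ⟨t, rfl⟩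
    rcases t with _ | _ | _ | _ | _ <;> simp [Fm.code, encode_tm]
  · obtain ⟨a, b, rfl⟩ : ∃ a b, n = Nat.pair a b := ⟨_, _, (Nat.pair_unpair n).symm⟩
    simp only [Nat.unpair_pair]
    rintro (⟨rfl, rfl⟩ | ⟨rfl, ⟨s, hs⟩, u, hu⟩ | ⟨rfl, ⟨s, hs⟩, u, hu⟩ | ⟨rfl, ⟨s, hs⟩, u, hu⟩ |
      ⟨rfl, s, hs⟩)
    · exact ⟨.falsum, rfl⟩
    · exact ⟨.eq s u, by rw [Fm.code, ← encode_tm, ← encode_tm, hs, hu, Nat.pair_unpair]⟩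
    · exact ⟨.le s u, by rw [Fm.code, ← encode_tm, ← encode_tm, hs, hu, Nat.pair_unpair]⟩
    · exact ⟨.imp s u, by rw [Fm.code, hs, hu, Nat.pair_unpair]⟩
    · exact ⟨.all s, by rw [Fm.code, hs]⟩

theorem primrecPred_range_fmCode : PrimrecPred fun n => n ∈ Set.range Fm.code := by
  classical
  have h := primrec_unpair_fst
  have h' := primrec_unpair_snd
  refine Primrec.primrecPred (Primrec.nat_omega_rec' (m := id) (l := childCodesFm)
    (g := fun n rs => some (decide ((n.unpair.1 = 0 ∧ n.unpair.2 = 0) ∨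
    (n.unpair.1 = 1 ∧ n.unpair.2.unpair.1 ∈ Set.range (Encodable.encode : Tm → ℕ) ∧
      n.unpair.2.unpair.2 ∈ Set.range (Encodable.encode : Tm → ℕ)) ∨
    (n.unpair.1 = 2 ∧ n.unpair.2.unpair.1 ∈ Set.range (Encodable.encode : Tm → ℕ) ∧
      n.unpair.2.unpair.2 ∈ Set.range (Encodable.encode : Tm → ℕ)) ∨
      (n.unpair.1 = 3 ∧ rs = [true, true]) ∨ (n.unpair.1 = 4 ∧ rs = [true])))) _ Primrec.id
        primrec_childCodesFm ?_ (fun _ _ => lt_of_mem_childCodesFm) ?_)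
  · have p1 : Primrec fun x : ℕ × List Bool => x.1.unpair.1 := h.comp Primrec.fst
    have p2 : Primrec fun x : ℕ × List Bool => x.1.unpair.2 := h'.comp Primrec.fst
    have p3 := PrimrecPred.comp (Primcodable.mem_range_encode (α := Tm)) (h.comp p2)
    have p4 := PrimrecPred.comp (Primcodable.mem_range_encode (α := Tm)) (h'.comp p2)
    refine Primrec.option_some.comp (PrimrecPred.decide ?_)
    exact ((primrecPred_eq_const p1 0).and (primrecPred_eq_const p2 0)).or <|
      ((primrecPred_eq_const p1 1).and (p3.and p4)).or <|
      ((primrecPred_eq_const p1 2).and (p3.and p4)).or <|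
      ((primrecPred_eq_const p1 3).and (primrecPred_eq_const Primrec.snd _)).or <|
      (primrecPred_eq_const p1 4).and (primrecPred_eq_const Primrec.snd _)
  · intro n
    simp only [Option.some.injEq, decide_eq_decide]
    rw [mem_range_fmCode]
    have key : ∀ i, n.unpair.1 = i → (i = 3 → childCodesFm n =
        [n.unpair.2.unpair.1, n.unpair.2.unpair.2]) ∧ (i = 4 → childCodesFm n = [n.unpair.2]) := by
      rintro i hi
      refine ⟨?_, ?_⟩ <;> rintro rfl <;> simp [childCodesFm, hi]
    refine or_congr_right (or_congr_right (or_congr_right (or_congr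
      (and_congr_right fun e => ?_) (and_congr_right fun e => ?_))))
    · rw [(key _ e).1 rfl]; simp
    · rw [(key _ e).2 rfl]; simp

noncomputable instance : Primcodable Fm :=
  primcodableOfInjective Fm.code Fm.code_injective primrecPred_range_fmCode

theorem encode_fm (φ : Fm) : Encodable.encode φ = φ.code := rfl

/-! ### Primitive recursion on syntax trees -/

section Constructors

variable {α : Type} [Primcodable α]

theorem primrec_of_code_tm {f : α → Tm} (h : Primrec fun a => (f a).code) : Primrec f :=
  Primrec.encode_iff.1 h

theorem primrec_of_code_fm {f : α → Fm} (h : Primrec fun a => (f a).code) : Primrec f :=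
  Primrec.encode_iff.1 h

theorem primrec_code_tm {f : α → Tm} (h : Primrec f) : Primrec fun a => (f a).code :=
  Primrec.encode_iff.2 h

theorem primrec_code_fm {f : α → Fm} (h : Primrec f) : Primrec fun a => (f a).code :=
  Primrec.encode_iff.2 h

theorem primrec_natPair {f g : α → ℕ} (hf : Primrec f) (hg : Primrec g) :
    Primrec fun a => Nat.pair (f a) (g a) := Primrec₂.natPair.comp hf hg

theorem Tm.primrec_var : Primrec Tm.var := by
  refine primrec_of_code_tm (Primrec.of_eq (Primrec.sumCasesOn
    (g := fun _ i => Nat.pair 0 i) (h := fun _ i => Nat.pair 1 i) Primrec.id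
    (primrec_natPair (Primrec.const 0) Primrec.snd)
    (primrec_natPair (Primrec.const 1) Primrec.snd)) fun x => ?_)
  cases x <;> rfl

theorem Tm.primrec_add {f g : α → Tm} (hf : Primrec f) (hg : Primrec g) :
    Primrec fun a => Tm.add (f a) (g a) :=
  primrec_of_code_tm (primrec_natPair (Primrec.const 4)
    (primrec_natPair (primrec_code_tm hf) (primrec_code_tm hg)))

theorem Tm.primrec_tmul {f : α → Tm} (hf : Primrec f) : Primrec fun a => Tm.tmul (f a) :=
  primrec_of_code_tm (primrec_natPair (Primrec.const 5) (primrec_code_tm hf))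

theorem Tm.primrec_div {f : α → ℤ[X]} {g : α → Tm} (hf : Primrec f) (hg : Primrec g) :
    Primrec fun a => Tm.div (f a) (g a) :=
  primrec_of_code_tm (primrec_natPair (Primrec.const 6)
    (primrec_natPair (show Primrec fun a => codePoly (f a) from
      (Primrec.encode_iff (f := f)).2 hf) (primrec_code_tm hg)))

theorem Fm.primrec_eq {f g : α → Tm} (hf : Primrec f) (hg : Primrec g) :
    Primrec fun a => Fm.eq (f a) (g a) :=
  primrec_of_code_fm (primrec_natPair (Primrec.const 1)
    (primrec_natPair (primrec_code_tm hf) (primrec_code_tm hg)))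

theorem Fm.primrec_le {f g : α → Tm} (hf : Primrec f) (hg : Primrec g) :
    Primrec fun a => Fm.le (f a) (g a) :=
  primrec_of_code_fm (primrec_natPair (Primrec.const 2)
    (primrec_natPair (primrec_code_tm hf) (primrec_code_tm hg)))

theorem Fm.primrec_imp {f g : α → Fm} (hf : Primrec f) (hg : Primrec g) :
    Primrec fun a => Fm.imp (f a) (g a) :=
  primrec_of_code_fm (primrec_natPair (Primrec.const 3)
    (primrec_natPair (primrec_code_fm hf) (primrec_code_fm hg)))

end Constructors

theorem primrec_bind_map {α β γ σ : Type} [Primcodable α] [Primcodable β] [Primcodable γ]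
    [Primcodable σ] {o₁ : α → Option β} {o₂ : α → Option γ} {g : α → β × γ → σ} (h₁ : Primrec o₁)
    (h₂ : Primrec o₂) (hg : Primrec₂ g) :
    Primrec fun a => (o₁ a).bind fun x => (o₂ a).map fun y => g a (x, y) := by
  have h : Primrec₂ fun (p : α × β) (y : γ) => g p.1 (p.2, y) :=
    hg.comp (Primrec.fst.comp Primrec.fst) ((Primrec.snd.comp Primrec.fst).pair Primrec.snd)
  exact Primrec.option_bind h₁ (Primrec.option_map (h₂.comp Primrec.fst) h)

theorem primrec_map {α β σ : Type} [Primcodable α] [Primcodable β] [Primcodable σ]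
    {o : α → Option β} {g : α → β → σ} (h : Primrec o) (hg : Primrec₂ g) :
    Primrec fun a => (o a).map fun y => g a y := Primrec.option_map h hg

section Recursion

variable {α σ : Type} [Primcodable α] [Primcodable σ]

/-- The immediate subterms. -/
def Tm.children : Tm → List Tm
  | .add s u => [s, u]
  | .tmul s => [s]
  | .div _ s => [s]
  | _ => []

theorem Tm.filterMap_childCodes (t : Tm) :
    (childCodes t.code).filterMap (Encodable.decode : ℕ → Option Tm) = t.children := by
  have h : ∀ s : Tm, (Encodable.decode s.code : Option Tm) = some s := fun s => Encodable.encodek s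
  rcases t with (_ | _) | _ | _ | _ | _ | _ <;> simp [Tm.code, childCodes, children, h]

theorem Tm.code_lt_of_mem_children {s t : Tm} (h : s ∈ t.children) : s.code < t.code := by
  rcases t with (_ | _) | _ | _ | ⟨a, b⟩ | a | ⟨f, a⟩ <;>
    simp only [children, List.mem_cons, List.not_mem_nil, or_false] at h
  · have h1 := Nat.add_le_pair 4 (Nat.pair a.code b.code)
    have h2 := Nat.add_le_pair a.code b.code
    rw [code]
    rcases h with rfl | rfl <;> omega
  · have h1 := Nat.add_le_pair 5 a.code
    rw [code]
    subst h
    omega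
  · have h1 := Nat.add_le_pair 6 (Nat.pair (codePoly f) a.code)
    have h2 := Nat.add_le_pair (codePoly f) a.code
    rw [code]
    subst h
    omega

theorem primrec_unpair_comp {f : α → ℕ} (hf : Primrec f) :
    (Primrec fun a => (f a).unpair.1) ∧ Primrec fun a => (f a).unpair.2 :=
  ⟨primrec_unpair_fst.comp hf, primrec_unpair_snd.comp hf⟩

/-- Functions defined by recursion on terms are primitive recursive. -/
theorem Tm.primrec_rec {f : α → Tm → σ} {fv : α → ℕ ⊕ ℕ → σ} {f0 f1 : α → σ}
    {fa : α → σ × σ → σ} {ft : α → σ → σ} {fd : α → ℤ[X] × σ → σ}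
    (hv : Primrec₂ fv) (h0 : Primrec f0) (h1 : Primrec f1) (ha : Primrec₂ fa) (ht : Primrec₂ ft)
    (hd : Primrec₂ fd) (ev : ∀ a x, f a (.var x) = fv a x) (e0 : ∀ a, f a .zero = f0 a)
    (e1 : ∀ a, f a .one = f1 a) (ea : ∀ a s u, f a (.add s u) = fa a (f a s, f a u))
    (et : ∀ a s, f a (.tmul s) = ft a (f a s))
    (ed : ∀ a p s, f a (.div p s) = fd a (p, f a s)) : Primrec₂ f := by
  -- Strong recursion on the Gödel number. The first component of the code is the tag of the
  -- constructor, and `rs` lists the values at the immediate subterms.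
  refine Primrec₂.uncurry.1 (Primrec.nat_omega_rec' (Function.uncurry f) (β := α × Tm) (m := fun b => b.2.code)
    (l := fun b => ((childCodes b.2.code).filterMap (Encodable.decode : ℕ → Option Tm)).map
      fun s => (b.1, s))
    (g := fun b rs =>
      if b.2.code.unpair.1 = 0 then some (fv b.1 (.inl b.2.code.unpair.2))
      else if b.2.code.unpair.1 = 1 then some (fv b.1 (.inr b.2.code.unpair.2))
      else if b.2.code.unpair.1 = 2 then some (f0 b.1)
      else if b.2.code.unpair.1 = 3 then some (f1 b.1)
      else if b.2.code.unpair.1 = 4 then rs[0]?.bind fun x => rs[1]?.map fun y => fa b.1 (x, y)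
      else if b.2.code.unpair.1 = 5 then rs[0]?.map fun x => ft b.1 x
      else rs[0]?.bind fun x => (Encodable.decode b.2.code.unpair.2.unpair.1 : Option ℤ[X]).map
        fun p => fd b.1 (p, x))
    (primrec_code_tm Primrec.snd) ?_ ?_ ?_ ?_)
  · exact Primrec.list_map (Primrec.listFilterMap (primrec_childCodes.comp
      (primrec_code_tm Primrec.snd)) (Primrec.decode.comp Primrec.snd).to₂)
      ((Primrec.fst.comp Primrec.fst).pair Primrec.snd).to₂
  · have hb : Primrec fun x : (α × Tm) × List σ => x.1.1 := Primrec.fst.comp Primrec.fst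
    obtain ⟨p1, p2⟩ := primrec_unpair_comp (α := (α × Tm) × List σ) (f := fun x => x.1.2.code)
      (primrec_code_tm (Primrec.snd.comp Primrec.fst))
    have hg : ∀ i, Primrec fun x : (α × Tm) × List σ => x.2[i]? := fun i =>
      Primrec.list_getElem?.comp Primrec.snd (Primrec.const i)
    refine Primrec.ite (primrecPred_eq_const p1 0)
      (Primrec.option_some.comp (hv.comp hb (Primrec.sumInl.comp p2))) <|
      Primrec.ite (primrecPred_eq_const p1 1)
      (Primrec.option_some.comp (hv.comp hb (Primrec.sumInr.comp p2))) <|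
      Primrec.ite (primrecPred_eq_const p1 2) (Primrec.option_some.comp (h0.comp hb)) <|
      Primrec.ite (primrecPred_eq_const p1 3) (Primrec.option_some.comp (h1.comp hb)) <|
      Primrec.ite (primrecPred_eq_const p1 4) ?_ <|
      Primrec.ite (primrecPred_eq_const p1 5) ?_ ?_
    · exact primrec_bind_map (hg 0) (hg 1) (g := fun x => fa x.1.1)
        (ha.comp (hb.comp Primrec.fst) Primrec.snd)
    · exact primrec_map (hg 0) (g := fun x => ft x.1.1) (ht.comp (hb.comp Primrec.fst) Primrec.snd)
    · exact primrec_bind_map (hg 0) (Primrec.decode.comp (primrec_unpair_fst.comp p2))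
        (g := fun x y => fd x.1.1 (y.2, y.1))
        (hd.comp (hb.comp Primrec.fst) ((Primrec.snd.comp Primrec.snd).pair
          (Primrec.fst.comp Primrec.snd)))
  · rintro ⟨a, t⟩ b' hb
    rw [List.mem_map] at hb
    obtain ⟨s, hs, rfl⟩ := hb
    rw [Tm.filterMap_childCodes] at hs
    exact Tm.code_lt_of_mem_children hs
  · rintro ⟨a, t⟩
    simp only [Tm.filterMap_childCodes]
    have hp : ∀ p : ℤ[X], (Encodable.decode (codePoly p) : Option ℤ[X]) = some p :=
      fun p => Encodable.encodek p
    rcases t with (_ | _) | _ | _ | _ | _ | _ <;>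
      simp [Tm.code, children, Function.uncurry, ev, e0, e1, ea, et, ed, hp]

/-- The immediate subformulas. -/
def Fm.children : Fm → List Fm
  | .imp φ ψ => [φ, ψ]
  | .all φ => [φ]
  | _ => []

theorem Fm.filterMap_childCodes (t : Fm) :
    (childCodesFm t.code).filterMap (Encodable.decode : ℕ → Option Fm) = t.children := by
  have h : ∀ s : Fm, (Encodable.decode s.code : Option Fm) = some s := fun s => Encodable.encodek s
  rcases t with _ | _ | _ | _ | _ <;> simp [Fm.code, childCodesFm, children, h]

theorem Fm.code_lt_of_mem_children {s t : Fm} (h : s ∈ t.children) : s.code < t.code := by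
  rcases t with _ | _ | _ | ⟨a, b⟩ | a <;>
    simp only [children, List.mem_cons, List.not_mem_nil, or_false] at h
  · have h1 := Nat.add_le_pair 3 (Nat.pair a.code b.code)
    have h2 := Nat.add_le_pair a.code b.code
    rw [code]
    rcases h with rfl | rfl <;> omega
  · have h1 := Nat.add_le_pair 4 a.code
    rw [code]
    subst h
    omega

/-- Functions defined by recursion on formulas, with a parameter updated at quantifiers, are
primitive recursive. -/
theorem Fm.primrec_rec {f : α → Fm → σ} {f0 : α → σ} {fe fl : α → Tm × Tm → σ}
    {fi : α → σ × σ → σ} {u : α → α} {fall : α → σ → σ}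
    (h0 : Primrec f0) (he : Primrec₂ fe) (hl : Primrec₂ fl) (hi : Primrec₂ fi) (hu : Primrec u)
    (hall : Primrec₂ fall) (e0 : ∀ a, f a .falsum = f0 a)
    (ee : ∀ a s t, f a (.eq s t) = fe a (s, t)) (el : ∀ a s t, f a (.le s t) = fl a (s, t))
    (ei : ∀ a φ ψ, f a (.imp φ ψ) = fi a (f a φ, f a ψ))
    (eall : ∀ a φ, f a (.all φ) = fall a (f (u a) φ)) : Primrec₂ f := by
  -- The tag `4` marks a quantifier, where the parameter passed to the subformula changes; `Fm.qe`
  -- uses it to count the enclosing quantifiers.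
  refine Primrec₂.uncurry.1 (Primrec.nat_omega_rec' (Function.uncurry f) (β := α × Fm) (m := fun b => b.2.code)
    (l := fun b => ((childCodesFm b.2.code).filterMap (Encodable.decode : ℕ → Option Fm)).map
      fun s => (if b.2.code.unpair.1 = 4 then u b.1 else b.1, s))
    (g := fun b rs =>
      if b.2.code.unpair.1 = 0 then some (f0 b.1)
      else if b.2.code.unpair.1 = 1 then
        (Encodable.decode b.2.code.unpair.2.unpair.1 : Option Tm).bind fun s =>
          (Encodable.decode b.2.code.unpair.2.unpair.2 : Option Tm).map fun t => fe b.1 (s, t)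
      else if b.2.code.unpair.1 = 2 then
        (Encodable.decode b.2.code.unpair.2.unpair.1 : Option Tm).bind fun s =>
          (Encodable.decode b.2.code.unpair.2.unpair.2 : Option Tm).map fun t => fl b.1 (s, t)
      else if b.2.code.unpair.1 = 3 then rs[0]?.bind fun x => rs[1]?.map fun y => fi b.1 (x, y)
      else rs[0]?.map fun x => fall b.1 x)
    (primrec_code_fm Primrec.snd) ?_ ?_ ?_ ?_)
  · have hb : Primrec fun x : (α × Fm) × Fm => x.1.1 := Primrec.fst.comp Primrec.fst
    have hc : Primrec fun x : (α × Fm) × Fm => if x.1.2.code.unpair.1 = 4 then u x.1.1 else x.1.1 :=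
      Primrec.ite (primrecPred_eq_const (primrec_unpair_fst.comp
        (primrec_code_fm (Primrec.snd.comp Primrec.fst))) 4) (hu.comp hb) hb
    have hc' : Primrec₂ fun (x : α × Fm) (s : Fm) =>
        (if x.2.code.unpair.1 = 4 then u x.1 else x.1, s) := hc.pair Primrec.snd
    exact Primrec.list_map (Primrec.listFilterMap (primrec_childCodesFm.comp
      (primrec_code_fm Primrec.snd)) (Primrec.decode.comp Primrec.snd).to₂) hc'
  · have hb : Primrec fun x : (α × Fm) × List σ => x.1.1 := Primrec.fst.comp Primrec.fst
    obtain ⟨p1, p2⟩ := primrec_unpair_comp (α := (α × Fm) × List σ) (f := fun x => x.1.2.code)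
      (primrec_code_fm (Primrec.snd.comp Primrec.fst))
    have hg : ∀ i, Primrec fun x : (α × Fm) × List σ => x.2[i]? := fun i =>
      Primrec.list_getElem?.comp Primrec.snd (Primrec.const i)
    have hat : ∀ {g : α → Tm × Tm → σ}, Primrec₂ g → Primrec fun x : (α × Fm) × List σ =>
        (Encodable.decode x.1.2.code.unpair.2.unpair.1 : Option Tm).bind fun s =>
          (Encodable.decode x.1.2.code.unpair.2.unpair.2 : Option Tm).map
            fun t => g x.1.1 (s, t) := by
      intro g hg
      exact primrec_bind_map (Primrec.decode.comp (primrec_unpair_fst.comp p2))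
        (Primrec.decode.comp (primrec_unpair_snd.comp p2)) (g := fun x => g x.1.1)
        (hg.comp (hb.comp Primrec.fst) Primrec.snd)
    refine Primrec.ite (primrecPred_eq_const p1 0) (Primrec.option_some.comp (h0.comp hb)) <|
      Primrec.ite (primrecPred_eq_const p1 1) (hat he) <|
      Primrec.ite (primrecPred_eq_const p1 2) (hat hl) <|
      Primrec.ite (primrecPred_eq_const p1 3) ?_ ?_
    · exact primrec_bind_map (hg 0) (hg 1) (g := fun x => fi x.1.1)
        (hi.comp (hb.comp Primrec.fst) Primrec.snd)
    · exact primrec_map (hg 0) (g := fun x => fall x.1.1)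
        (hall.comp (hb.comp Primrec.fst) Primrec.snd)
  · rintro ⟨a, t⟩ b' hb
    rw [List.mem_map] at hb
    obtain ⟨s, hs, rfl⟩ := hb
    rw [Fm.filterMap_childCodes] at hs
    exact Fm.code_lt_of_mem_children hs
  · rintro ⟨a, t⟩
    simp only [Fm.filterMap_childCodes]
    have hp : ∀ s : Tm, (Encodable.decode s.code : Option Tm) = some s :=
      fun p => Encodable.encodek p
    rcases t with _ | _ | _ | _ | _ <;>
      simp [Fm.code, children, Function.uncurry, e0, ee, el, ei, eall, hp]

end Recursion

/-! ### The elimination procedure -/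

namespace Fm

/-- Negation. -/
def not (φ : Fm) : Fm := imp φ falsum

/-- Conjunction. -/
def and (φ ψ : Fm) : Fm := not (imp φ (not ψ))

/-- Disjunction. -/
def or (φ ψ : Fm) : Fm := imp (not φ) ψ

/-- Strict inequality. -/
def lt (s u : Tm) : Fm := not (le u s)

/-- Disjunction of a list. -/
def disj (l : List Fm) : Fm := l.foldr or falsum

end Fm

/-- The variables of a term. -/
def Tm.vars : Tm → List (ℕ ⊕ ℕ)
  | .var x => [x]
  | .zero => []
  | .one => []
  | .add s u => s.vars ++ u.vars
  | .tmul s => s.vars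
  | .div _ s => s.vars

/-- The variables of a formula. -/
def Fm.vars : Fm → List (ℕ ⊕ ℕ)
  | .falsum => []
  | .eq s u => s.vars ++ u.vars
  | .le s u => s.vars ++ u.vars
  | .imp φ ψ => φ.vars ++ ψ.vars
  | .all φ => φ.vars

/-- The multiple of a term by a natural number. -/
def Tm.smul (m : ℕ) (s : Tm) : Tm := m.rec .zero fun _ u => .add s u

/-- The multiple of a term by the polynomial whose coefficients are the images of those in `l`. -/
def Tm.horner (g : ℤ → ℕ) (l : List ℤ) (s : Tm) : Tm :=
  l.foldr (fun a u => .add (Tm.smul (g a) s) (.tmul u)) .zero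

/-- The multiple of a term by the part of `f` with positive coefficients. -/
noncomputable def Tm.posMul (f : ℤ[X]) (s : Tm) : Tm := .horner (fun a => a.toNat) (coeffList f) s

/-- The multiple of a term by the negated part of `f` with negative coefficients. -/
noncomputable def Tm.negMul (f : ℤ[X]) (s : Tm) : Tm :=
  .horner (fun a => (-a).toNat) (coeffList f) s

/-- The formula `a mod |f| ≥ b mod |f|` if `f ≠ 0`. -/
noncomputable def modGe (f : ℤ[X]) (a b : Tm) : Fm :=
  let P := Tm.div f a
  let Q := Tm.div f b
  .and
    (.imp (.lt (.negMul f .one) (.posMul f .one))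
      (.le (.add b (.add (.posMul f P) (.negMul f Q))) (.add a (.add (.posMul f Q) (.negMul f P)))))
    (.imp (.lt (.posMul f .one) (.negMul f .one))
      (.le (.add b (.add (.posMul f Q) (.negMul f P))) (.add a (.add (.posMul f P) (.negMul f Q)))))

/-- The quotient `⌊(a - b) / |f|⌋` as a difference of terms, by cases. -/
noncomputable def divAlts (f : ℤ[X]) (x : Fm × Tm × Tm) : List (Fm × Tm × Tm) :=
  let z := Fm.eq (.posMul f .one) (.negMul f .one)
  let P := Tm.div f x.2.1
  let Q := Tm.div f x.2.2
  [(.and x.1 z, .zero, .zero),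
   (.and x.1 (.and (.not z) (modGe f x.2.1 x.2.2)), P, Q),
   (.and x.1 (.and (.not z) (.not (modGe f x.2.1 x.2.2))), P, .add Q .one)]

/-- All combinations of the alternatives of two terms. -/
def combine {σ : Type} (g : (Fm × Tm × Tm) × (Fm × Tm × Tm) → σ) (l m : List (Fm × Tm × Tm)) :
    List σ :=
  l.flatMap fun a => m.map fun b => g (a, b)

/-- A term in which the variable `Sum.inr r.2.2` is replaced by the difference of `r.1` and `r.2.1`,
as a difference of terms by cases. -/
noncomputable def Tm.alts (r : Tm × Tm × ℕ) : Tm → List (Fm × Tm × Tm)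
  | .var x => if x = .inr r.2.2 then [(.not .falsum, r.1, r.2.1)]
      else [(.not .falsum, .var x, .zero)]
  | .zero => [(.not .falsum, .zero, .zero)]
  | .one => [(.not .falsum, .one, .zero)]
  | .add s u => combine (fun x => (.and x.1.1 x.2.1, .add x.1.2.1 x.2.2.1, .add x.1.2.2 x.2.2.2))
      (s.alts r) (u.alts r)
  | .tmul s => (s.alts r).map fun x => (x.1, .tmul x.2.1, .tmul x.2.2)
  | .div f s => (s.alts r).flatMap fun x => divAlts f x

/-- The quantifier-free formula in which the variable `Sum.inr r.2.2` is replaced by the difference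
of `r.1` and `r.2.1`. -/
noncomputable def Fm.subst (r : Tm × Tm × ℕ) : Fm → Fm
  | .falsum => .falsum
  | .eq s u => .disj (combine (fun x => .and (.and x.1.1 x.2.1)
      (.eq (.add x.1.2.1 x.2.2.2) (.add x.2.2.1 x.1.2.2))) (s.alts r) (u.alts r))
  | .le s u => .disj (combine (fun x => .and (.and x.1.1 x.2.1)
      (.le (.add x.1.2.1 x.2.2.2) (.add x.2.2.1 x.1.2.2))) (s.alts r) (u.alts r))
  | .imp φ ψ => .imp (φ.subst r) (ψ.subst r)
  | .all _ => .falsum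

/-- A list containing all polynomials of complexity `c`. -/
noncomputable def polyList (c : ℕ) : List ℤ[X] :=
  (List.range ((c + 1).rec 0 (fun _ w => Nat.succ (Nat.pair (2 * 2 ^ c + 1) w)) + 1)).filterMap
    Encodable.decode

/-- The terms of complexity `c` over the variables in `l`. -/
noncomputable def testTerms (l : List Tm) (c : ℕ) : List Tm :=
  c.rec (l ++ [.zero, .one]) fun c T => T ++ (T.flatMap fun s => T.map fun u => .add s u) ++
    T.map .tmul ++ (polyList c).flatMap fun f => T.map fun s => .div f s

/-- The variables of `φ` other than `Sum.inr n`. -/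
def Fm.varTerms (n : ℕ) (φ : Fm) : List Tm :=
  φ.vars.flatMap fun x => if x = .inr n then [] else [.var x]

/-- The terms whose differences suffice as witnesses for the variable `Sum.inr n` in `φ`. -/
noncomputable def Fm.witnessTerms (n : ℕ) (φ : Fm) : List Tm :=
  -- The Gödel number bounds both the complexity of the linear system for `φ` and the number of its
  -- unknowns: `φ.size ≤ 2 * φ.code + 1`, the system has complexity `φ.size + 7`, and it has at most
  -- `φ.size + 1` unknowns.
  testTerms (φ.varTerms n) (solLevel (2 * φ.code + 11))

/-- Elimination of an existential quantifier. -/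
noncomputable def Fm.elimEx (n : ℕ) (φ : Fm) : Fm :=
  .disj ((φ.witnessTerms n).flatMap fun p => (φ.witnessTerms n).map fun q => φ.subst (p, q, n))

/-- Elimination of all quantifiers. -/
noncomputable def Fm.qe : ℕ → Fm → Fm
  | _, .falsum => .falsum
  | _, .eq s u => .eq s u
  | _, .le s u => .le s u
  | n, .imp φ ψ => .imp (φ.qe n) (ψ.qe n)
  | n, .all φ => .not ((Fm.not (φ.qe (n + 1))).elimEx n)

/-! ### Primitive recursiveness of the elimination procedure -/

section Primrec

variable {α : Type} [Primcodable α]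

theorem Fm.primrec_not {f : α → Fm} (hf : Primrec f) : Primrec fun a => Fm.not (f a) :=
  Fm.primrec_imp hf (Primrec.const _)

theorem Fm.primrec_and {f g : α → Fm} (hf : Primrec f) (hg : Primrec g) :
    Primrec fun a => Fm.and (f a) (g a) :=
  Fm.primrec_not (Fm.primrec_imp hf (Fm.primrec_not hg))

theorem Fm.primrec_or {f g : α → Fm} (hf : Primrec f) (hg : Primrec g) :
    Primrec fun a => Fm.or (f a) (g a) :=
  Fm.primrec_imp (Fm.primrec_not hf) hg

theorem Fm.primrec_lt {f g : α → Tm} (hf : Primrec f) (hg : Primrec g) :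
    Primrec fun a => Fm.lt (f a) (g a) :=
  Fm.primrec_not (Fm.primrec_le hg hf)

theorem Fm.primrec_disj : Primrec Fm.disj :=
  Primrec.list_foldr Primrec.id (Primrec.const _)
    (Fm.primrec_or (Primrec.fst.comp Primrec.snd) (Primrec.snd.comp Primrec.snd)).to₂

theorem Tm.primrec_vars : Primrec Tm.vars := by
  have h : Primrec₂ fun (_ : Unit) s => Tm.vars s :=
    Tm.primrec_rec (fv := fun _ x => [x]) (f0 := fun _ => []) (f1 := fun _ => [])
      (fa := fun _ x => x.1 ++ x.2) (ft := fun _ x => x) (fd := fun _ x => x.2)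
      (primrec_list_singleton Primrec.snd) (Primrec.const _) (Primrec.const _)
      (Primrec.list_append.comp (Primrec.fst.comp Primrec.snd) (Primrec.snd.comp Primrec.snd))
      Primrec.snd (Primrec.snd.comp Primrec.snd) (fun _ _ => rfl) (fun _ => rfl) (fun _ => rfl)
      (fun _ _ _ => rfl) (fun _ _ => rfl) (fun _ _ _ => rfl)
  exact h.comp (Primrec.const ()) Primrec.id

theorem Fm.primrec_vars : Primrec Fm.vars := by
  have ht : Primrec₂ fun (_ : Unit) (x : Tm × Tm) => x.1.vars ++ x.2.vars :=
    Primrec.list_append.comp (Tm.primrec_vars.comp (Primrec.fst.comp Primrec.snd))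
      (Tm.primrec_vars.comp (Primrec.snd.comp Primrec.snd))
  have h : Primrec₂ fun (_ : Unit) s => Fm.vars s :=
    Fm.primrec_rec (f0 := fun _ => []) (fi := fun _ x => x.1 ++ x.2) (u := fun x => x)
      (fall := fun _ x => x) (Primrec.const _) ht ht
      (Primrec.list_append.comp (Primrec.fst.comp Primrec.snd) (Primrec.snd.comp Primrec.snd))
      Primrec.id Primrec.snd (fun _ => rfl) (fun _ _ _ => rfl) (fun _ _ _ => rfl)
      (fun _ _ _ => rfl) (fun _ _ => rfl)
  exact h.comp (Primrec.const ()) Primrec.id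

/-- Even codes belong to the nonnegative integers and odd codes to the negative ones, so sign and
absolute value can be read off. -/
theorem encode_int (z : ℤ) :
    Encodable.encode z = if 0 ≤ z then 2 * z.toNat else 2 * (-z).toNat - 1 := by
  rcases z with n | n
  · rw [show Encodable.encode (Int.ofNat n) = 2 * n from rfl]
    simp
  · simp [show Encodable.encode (Int.negSucc n) = 2 * n + 1 from rfl]
    omega

theorem primrec_toNat : Primrec fun z : ℤ => z.toNat := by
  refine Primrec.of_eq (f := fun z : ℤ => if Encodable.encode z % 2 = 0 then
    Encodable.encode z / 2 else 0) (Primrec.ite (primrecPred_eq_const (Primrec.nat_mod.comp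
    Primrec.encode (Primrec.const 2)) 0) (Primrec.nat_div.comp Primrec.encode (Primrec.const 2))
    (Primrec.const 0)) fun z => ?_
  rw [encode_int]
  split_ifs <;> omega

theorem primrec_neg_toNat : Primrec fun z : ℤ => (-z).toNat := by
  refine Primrec.of_eq (f := fun z : ℤ => if Encodable.encode z % 2 = 0 then
    0 else Encodable.encode z / 2 + 1) (Primrec.ite (primrecPred_eq_const (Primrec.nat_mod.comp
    Primrec.encode (Primrec.const 2)) 0) (Primrec.const 0) (Primrec.succ.comp
    (Primrec.nat_div.comp Primrec.encode (Primrec.const 2)))) fun z => ?_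
  rw [encode_int]
  split_ifs <;> omega

theorem Tm.primrec_smul : Primrec₂ Tm.smul :=
  Primrec.nat_rec' Primrec.fst (Primrec.const _)
    (Tm.primrec_add (Primrec.snd.comp Primrec.fst) (Primrec.snd.comp Primrec.snd)).to₂

theorem Tm.primrec_horner {g : ℤ → ℕ} (hg : Primrec g) : Primrec₂ (Tm.horner g) :=
  Primrec.list_foldr Primrec.fst (Primrec.const _)
    (Tm.primrec_add (Tm.primrec_smul.comp (hg.comp (Primrec.fst.comp Primrec.snd))
      (Primrec.snd.comp Primrec.fst)) (Tm.primrec_tmul (Primrec.snd.comp Primrec.snd))).to₂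

theorem Tm.primrec_posMul {f : α → ℤ[X]} {g : α → Tm} (hf : Primrec f) (hg : Primrec g) :
    Primrec fun a => Tm.posMul (f a) (g a) :=
  (Tm.primrec_horner primrec_toNat).comp (primrec_coeffList.comp hf) hg

theorem Tm.primrec_negMul {f : α → ℤ[X]} {g : α → Tm} (hf : Primrec f) (hg : Primrec g) :
    Primrec fun a => Tm.negMul (f a) (g a) :=
  (Tm.primrec_horner primrec_neg_toNat).comp (primrec_coeffList.comp hf) hg

theorem primrec_modGe {f : α → ℤ[X]} {g h : α → Tm} (hf : Primrec f) (hg : Primrec g)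
    (hh : Primrec h) : Primrec fun a => modGe (f a) (g a) (h a) := by
  have hP := Tm.primrec_div hf hg
  have hQ := Tm.primrec_div hf hh
  have hp := Tm.primrec_posMul hf (Primrec.const Tm.one)
  have hn := Tm.primrec_negMul hf (Primrec.const Tm.one)
  have h1 := Tm.primrec_add (Tm.primrec_posMul hf hP) (Tm.primrec_negMul hf hQ)
  have h2 := Tm.primrec_add (Tm.primrec_posMul hf hQ) (Tm.primrec_negMul hf hP)
  exact Fm.primrec_and
    (Fm.primrec_imp (Fm.primrec_lt hn hp)
      (Fm.primrec_le (Tm.primrec_add hh h1) (Tm.primrec_add hg h2)))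
    (Fm.primrec_imp (Fm.primrec_lt hp hn)
      (Fm.primrec_le (Tm.primrec_add hh h2) (Tm.primrec_add hg h1)))

theorem primrec_divAlts : Primrec₂ divAlts := by
  have hf : Primrec fun a : ℤ[X] × Fm × Tm × Tm => a.1 := Primrec.fst
  have h0 : Primrec fun a : ℤ[X] × Fm × Tm × Tm => a.2.1 := Primrec.fst.comp Primrec.snd
  have h1 : Primrec fun a : ℤ[X] × Fm × Tm × Tm => a.2.2.1 :=
    Primrec.fst.comp (Primrec.snd.comp Primrec.snd)
  have h2 : Primrec fun a : ℤ[X] × Fm × Tm × Tm => a.2.2.2 :=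
    Primrec.snd.comp (Primrec.snd.comp Primrec.snd)
  have hz := Fm.primrec_eq (Tm.primrec_posMul hf (Primrec.const Tm.one))
    (Tm.primrec_negMul hf (Primrec.const Tm.one))
  have hm := primrec_modGe hf h1 h2
  have hP := Tm.primrec_div hf h1
  have hQ := Tm.primrec_div hf h2
  exact Primrec.list_cons.comp ((Fm.primrec_and h0 hz).pair (Primrec.const _))
    (primrec_list_pair ((Fm.primrec_and h0 (Fm.primrec_and (Fm.primrec_not hz) hm)).pair
      (hP.pair hQ))
      ((Fm.primrec_and h0 (Fm.primrec_and (Fm.primrec_not hz) (Fm.primrec_not hm))).pair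
      (hP.pair (Tm.primrec_add hQ (Primrec.const _)))))

theorem primrec_combine {σ : Type} [Primcodable σ] {g : (Fm × Tm × Tm) × (Fm × Tm × Tm) → σ}
    (hg : Primrec g) : Primrec₂ (combine g) := by
  have h : Primrec₂ fun (x : (List (Fm × Tm × Tm) × List (Fm × Tm × Tm)) × (Fm × Tm × Tm))
      (b : Fm × Tm × Tm) => g (x.2, b) :=
    hg.comp ((Primrec.snd.comp Primrec.fst).pair Primrec.snd)
  have h' : Primrec₂ fun (x : List (Fm × Tm × Tm) × List (Fm × Tm × Tm)) (a : Fm × Tm × Tm) =>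
      x.2.map fun b => g (a, b) := Primrec.list_map (Primrec.snd.comp Primrec.fst) h
  exact Primrec.list_flatMap Primrec.fst h'

end Primrec

theorem Tm.primrec_alts : Primrec₂ Tm.alts := by
  have hT : Primrec fun _ : (Tm × Tm × ℕ) × (ℕ ⊕ ℕ) => Fm.not .falsum := Primrec.const _
  have hv : Primrec₂ fun (r : Tm × Tm × ℕ) (x : ℕ ⊕ ℕ) =>
      if x = .inr r.2.2 then [(Fm.not .falsum, r.1, r.2.1)]
      else [(Fm.not .falsum, Tm.var x, Tm.zero)] :=
    Primrec.ite (Primrec.eq.comp Primrec.snd (Primrec.sumInr.comp (Primrec.snd.comp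
      (Primrec.snd.comp Primrec.fst))))
      (primrec_list_singleton (hT.pair ((Primrec.fst.comp Primrec.fst).pair
        (Primrec.fst.comp (Primrec.snd.comp Primrec.fst)))))
      (primrec_list_singleton (hT.pair ((Tm.primrec_var.comp Primrec.snd).pair
        (Primrec.const Tm.zero))))
  have ha : Primrec fun x : (Fm × Tm × Tm) × (Fm × Tm × Tm) =>
      (Fm.and x.1.1 x.2.1, Tm.add x.1.2.1 x.2.2.1, Tm.add x.1.2.2 x.2.2.2) := by
    have h1 : Primrec fun x : (Fm × Tm × Tm) × (Fm × Tm × Tm) => x.1.2 :=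
      Primrec.snd.comp Primrec.fst
    have h2 : Primrec fun x : (Fm × Tm × Tm) × (Fm × Tm × Tm) => x.2.2 :=
      Primrec.snd.comp Primrec.snd
    exact (Fm.primrec_and (Primrec.fst.comp Primrec.fst) (Primrec.fst.comp Primrec.snd)).pair
      ((Tm.primrec_add (Primrec.fst.comp h1) (Primrec.fst.comp h2)).pair
        (Tm.primrec_add (Primrec.snd.comp h1) (Primrec.snd.comp h2)))
  have ht : Primrec₂ fun (_ : (Tm × Tm × ℕ) × List (Fm × Tm × Tm)) (x : Fm × Tm × Tm) =>
      (x.1, Tm.tmul x.2.1, Tm.tmul x.2.2) :=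
    (Primrec.fst.comp Primrec.snd).pair
      ((Tm.primrec_tmul (Primrec.fst.comp (Primrec.snd.comp Primrec.snd))).pair
        (Tm.primrec_tmul (Primrec.snd.comp (Primrec.snd.comp Primrec.snd))))
  have hd : Primrec₂ fun (y : (Tm × Tm × ℕ) × ℤ[X] × List (Fm × Tm × Tm)) (x : Fm × Tm × Tm) =>
      divAlts y.2.1 x :=
    primrec_divAlts.comp (Primrec.fst.comp (Primrec.snd.comp Primrec.fst)) Primrec.snd
  exact Tm.primrec_rec (f := Tm.alts) hv
    (primrec_list_singleton (Primrec.const (Fm.not .falsum, Tm.zero, Tm.zero)))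
    (primrec_list_singleton (Primrec.const (Fm.not .falsum, Tm.one, Tm.zero)))
    (fa := fun _ x => combine _ x.1 x.2)
    ((primrec_combine ha).comp (Primrec.fst.comp Primrec.snd) (Primrec.snd.comp Primrec.snd))
    (ft := fun _ l => l.map _) (Primrec.list_map Primrec.snd ht)
    (fd := fun _ x => x.2.flatMap fun y => divAlts x.1 y)
    (Primrec.list_flatMap (Primrec.snd.comp Primrec.snd) hd)
    (fun _ _ => rfl) (fun _ => rfl) (fun _ => rfl) (fun _ _ _ => rfl) (fun _ _ => rfl)
    (fun _ _ _ => rfl)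

theorem Fm.primrec_subst : Primrec₂ Fm.subst := by
  have hat : ∀ {c : Tm → Tm → Fm}, Primrec₂ c → Primrec₂ fun (r : Tm × Tm × ℕ) (x : Tm × Tm) =>
      Fm.disj (combine (fun x => .and (.and x.1.1 x.2.1)
        (c (.add x.1.2.1 x.2.2.2) (.add x.2.2.1 x.1.2.2))) (x.1.alts r) (x.2.alts r)) := by
    intro c hc
    have h1 : Primrec fun x : (Fm × Tm × Tm) × (Fm × Tm × Tm) => x.1.2 :=
      Primrec.snd.comp Primrec.fst
    have h2 : Primrec fun x : (Fm × Tm × Tm) × (Fm × Tm × Tm) => x.2.2 :=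
      Primrec.snd.comp Primrec.snd
    have h : Primrec fun x : (Fm × Tm × Tm) × (Fm × Tm × Tm) => Fm.and (.and x.1.1 x.2.1)
        (c (.add x.1.2.1 x.2.2.2) (.add x.2.2.1 x.1.2.2)) :=
      Fm.primrec_and
        (Fm.primrec_and (Primrec.fst.comp Primrec.fst) (Primrec.fst.comp Primrec.snd))
        (hc.comp (Tm.primrec_add (Primrec.fst.comp h1) (Primrec.snd.comp h2))
          (Tm.primrec_add (Primrec.fst.comp h2) (Primrec.snd.comp h1)))
    exact Fm.primrec_disj.comp ((primrec_combine h).comp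
      (Tm.primrec_alts.comp Primrec.fst (Primrec.fst.comp Primrec.snd))
      (Tm.primrec_alts.comp Primrec.fst (Primrec.snd.comp Primrec.snd)))
  exact Fm.primrec_rec (f := Fm.subst) (f0 := fun _ => .falsum) (fi := fun _ x => .imp x.1 x.2)
    (u := id) (fall := fun _ _ => .falsum) (Primrec.const _)
    (hat (c := Fm.eq) (Fm.primrec_eq Primrec.fst Primrec.snd))
    (hat (c := Fm.le) (Fm.primrec_le Primrec.fst Primrec.snd))
    (Fm.primrec_imp (Primrec.fst.comp Primrec.snd) (Primrec.snd.comp Primrec.snd))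
    Primrec.id (Primrec.const _) (fun _ => rfl) (fun _ _ _ => rfl) (fun _ _ _ => rfl)
    (fun _ _ _ => rfl) (fun _ _ => rfl)

section Numeric

variable {α : Type} [Primcodable α] {f g : α → ℕ}

theorem primrec_add (hf : Primrec f) (hg : Primrec g) : Primrec fun a => f a + g a :=
  Primrec.nat_add.comp hf hg

theorem primrec_mul (hf : Primrec f) (hg : Primrec g) : Primrec fun a => f a * g a :=
  Primrec.nat_mul.comp hf hg

theorem primrec_pow (hf : Primrec f) (hg : Primrec g) : Primrec fun a => f a ^ g a :=
  (Primrec₂.unpaired'.1 Nat.Primrec.pow).comp hf hg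

theorem primrec_const_mul (m : ℕ) (hg : Primrec g) : Primrec fun a => m * g a :=
  primrec_mul (Primrec.const m) hg

theorem primrec_add_const (hf : Primrec f) (m : ℕ) : Primrec fun a => f a + m :=
  primrec_add hf (Primrec.const m)

theorem primrec_const_pow (m : ℕ) (hg : Primrec g) : Primrec fun a => m ^ g a :=
  primrec_pow (Primrec.const m) hg

end Numeric

theorem primrec_nearExp : Primrec nearExp :=
  Primrec.nat_rec₁ 0 (primrec_add_const (primrec_const_mul 5 Primrec.snd) 4)

theorem primrec_nearLevel : Primrec₂ nearLevel :=
  primrec_mul (primrec_const_pow 8 (primrec_add_const Primrec.fst 1))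
    (primrec_add_const (primrec_add Primrec.snd Primrec.fst) 1)

theorem primrec_distExp : Primrec distExp :=
  primrec_mul (primrec_add_const (primrec_const_mul 2 Primrec.id) 2) primrec_nearExp

theorem primrec_digitCount : Primrec digitCount :=
  primrec_mul Primrec.id (primrec_add_const primrec_distExp 2)

theorem primrec_digitLevel : Primrec digitLevel :=
  have hp := primrec_const_pow 2 Primrec.id
  primrec_add (primrec_add (primrec_add_const (primrec_add (primrec_add
    (primrec_nearLevel.comp Primrec.id Primrec.id) (primrec_const_mul 2 primrec_distExp))
    (primrec_const_mul 2 Primrec.id)) 5)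
    (primrec_mul (primrec_add_const (primrec_add Primrec.id primrec_distExp) 2)
      (primrec_add_const (primrec_mul primrec_digitCount hp) 11))) hp

theorem primrec_solLevel : Primrec solLevel :=
  have hp := primrec_const_pow 2 Primrec.id
  primrec_add_const (primrec_add (primrec_add (primrec_add (primrec_add
    (primrec_nearLevel.comp primrec_digitCount primrec_digitLevel)
    (primrec_pow (primrec_add_const (primrec_add hp primrec_digitCount) 2)
      (primrec_nearExp.comp primrec_digitCount)))
    (primrec_const_pow 2 primrec_distExp)) (primrec_nearLevel.comp Primrec.id Primrec.id))
    (primrec_const_mul 5 primrec_distExp)) 20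

theorem primrec_polyList : Primrec polyList := by
  have h : Primrec₂ fun (c : ℕ) (x : ℕ × ℕ) => Nat.succ (Nat.pair (2 * 2 ^ c + 1) x.2) :=
    Primrec.succ.comp (primrec_natPair (primrec_add_const (primrec_const_mul 2
      (primrec_const_pow 2 Primrec.fst)) 1) (Primrec.snd.comp Primrec.snd))
  exact Primrec.listFilterMap (Primrec.list_range.comp (primrec_add_const (Primrec.nat_rec'
    (primrec_add_const Primrec.id 1) (Primrec.const 0) h) 1)) (Primrec.decode.comp Primrec.snd).to₂

theorem primrec_testTerms : Primrec₂ testTerms := by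
  have hT : Primrec fun x : (List Tm × ℕ) × ℕ × List Tm => x.2.2 := Primrec.snd.comp Primrec.snd
  have ha' : Primrec₂ fun (y : ((List Tm × ℕ) × ℕ × List Tm) × Tm) (u : Tm) => Tm.add y.2 u :=
    Tm.primrec_add (Primrec.snd.comp Primrec.fst) Primrec.snd
  have ha : Primrec₂ fun (x : (List Tm × ℕ) × ℕ × List Tm) (s : Tm) =>
      x.2.2.map fun u => Tm.add s u := Primrec.list_map (hT.comp Primrec.fst) ha'
  have ht : Primrec₂ fun (_ : (List Tm × ℕ) × ℕ × List Tm) (s : Tm) => Tm.tmul s :=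
    Tm.primrec_tmul Primrec.snd
  have hd' : Primrec₂ fun (y : ((List Tm × ℕ) × ℕ × List Tm) × ℤ[X]) (u : Tm) => Tm.div y.2 u :=
    Tm.primrec_div (Primrec.snd.comp Primrec.fst) Primrec.snd
  have hd : Primrec₂ fun (x : (List Tm × ℕ) × ℕ × List Tm) (p : ℤ[X]) =>
      x.2.2.map fun u => Tm.div p u := Primrec.list_map (hT.comp Primrec.fst) hd'
  exact Primrec.nat_rec' Primrec.snd (Primrec.list_append.comp Primrec.fst (Primrec.const _))
    (Primrec.list_append.comp (Primrec.list_append.comp (Primrec.list_append.comp hT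
      (Primrec.list_flatMap hT ha)) (Primrec.list_map hT ht))
      (Primrec.list_flatMap (primrec_polyList.comp (Primrec.fst.comp Primrec.snd)) hd)).to₂

theorem Fm.primrec_varTerms : Primrec₂ Fm.varTerms := by
  have h : Primrec₂ fun (x : ℕ × Fm) (y : ℕ ⊕ ℕ) =>
      if y = .inr x.1 then [] else [Tm.var y] :=
    Primrec.ite (Primrec.eq.comp Primrec.snd (Primrec.sumInr.comp (Primrec.fst.comp Primrec.fst)))
      (Primrec.const []) (primrec_list_singleton (Tm.primrec_var.comp Primrec.snd))
  exact Primrec.list_flatMap (Fm.primrec_vars.comp Primrec.snd) h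

theorem Fm.primrec_witnessTerms : Primrec₂ Fm.witnessTerms :=
  primrec_testTerms.comp Fm.primrec_varTerms (primrec_solLevel.comp
    (primrec_add_const (primrec_const_mul 2 (primrec_code_fm Primrec.snd)) 11))

theorem Fm.primrec_elimEx : Primrec₂ Fm.elimEx := by
  have hs : Primrec₂ fun (y : (ℕ × Fm) × Tm) (q : Tm) => y.1.2.subst (y.2, q, y.1.1) :=
    Fm.primrec_subst.comp ((Primrec.snd.comp Primrec.fst).pair (Primrec.snd.pair
      (Primrec.fst.comp (Primrec.fst.comp Primrec.fst))))
      (Primrec.snd.comp (Primrec.fst.comp Primrec.fst))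
  have hw : Primrec fun x : ℕ × Fm => x.2.witnessTerms x.1 := Fm.primrec_witnessTerms
  have hm : Primrec₂ fun (x : ℕ × Fm) (p : Tm) =>
      (x.2.witnessTerms x.1).map fun q => x.2.subst (p, q, x.1) :=
    Primrec.list_map (hw.comp Primrec.fst) hs
  exact Fm.primrec_disj.comp (Primrec.list_flatMap hw hm)

theorem Fm.primrec_qe : Primrec₂ Fm.qe :=
  Fm.primrec_rec (f := Fm.qe) (f0 := fun _ => .falsum) (fe := fun _ x => .eq x.1 x.2)
    (fl := fun _ x => .le x.1 x.2) (fi := fun _ x => .imp x.1 x.2) (u := Nat.succ)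
    (fall := fun n φ => .not ((Fm.not φ).elimEx n)) (Primrec.const _)
    (Fm.primrec_eq (Primrec.fst.comp Primrec.snd) (Primrec.snd.comp Primrec.snd))
    (Fm.primrec_le (Primrec.fst.comp Primrec.snd) (Primrec.snd.comp Primrec.snd))
    (Fm.primrec_imp (Primrec.fst.comp Primrec.snd) (Primrec.snd.comp Primrec.snd)) Primrec.succ
    (Fm.primrec_not (Fm.primrec_elimEx.comp Primrec.fst (Fm.primrec_not Primrec.snd)))
    (fun _ => rfl) (fun _ _ _ => rfl) (fun _ _ _ => rfl) (fun _ _ _ => rfl) (fun _ _ => rfl)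

/-! ### Semantics of syntax trees and correctness of substitution -/

/-- The value of a term for `t = k`, with division by zero read according to `d`. -/
noncomputable def Tm.eval (d : ℤ[X] → ℤ → ℤ) (k : ℤ) (ρ : ℕ ⊕ ℕ → ℤ) : Tm → ℤ
  | .var x => ρ x
  | .zero => 0
  | .one => 1
  | .add s u => s.eval d k ρ + u.eval d k ρ
  | .tmul s => k * s.eval d k ρ
  | .div f s => if f.eval k = 0 then d f (s.eval d k ρ) else s.eval d k ρ / |f.eval k|

/-- The truth of a formula with `n` variables bound outside. -/
def Fm.Holds (d : ℤ[X] → ℤ → ℤ) (k : ℤ) : ℕ → (ℕ ⊕ ℕ → ℤ) → Fm → Prop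
  | _, _, .falsum => False
  | _, ρ, .eq s u => s.eval d k ρ = u.eval d k ρ
  | _, ρ, .le s u => s.eval d k ρ ≤ u.eval d k ρ
  | n, ρ, .imp φ ψ => φ.Holds d k n ρ → ψ.Holds d k n ρ
  | n, ρ, .all φ => ∀ x, φ.Holds d k (n + 1) (Function.update ρ (.inr n) x)

/-- Absence of quantifiers. -/
def Fm.QuantFree : Fm → Prop
  | .imp φ ψ => φ.QuantFree ∧ ψ.QuantFree
  | .all _ => False
  | _ => True

/-- The value of the polynomial with the given coefficients. -/
def listEval (k : ℤ) (l : List ℤ) : ℤ := l.foldr (fun a x => a + k * x) 0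

theorem listEval_eq_sum (k : ℤ) (l : List ℤ) :
    listEval k l = ∑ i ∈ Finset.range l.length, l.getD i 0 * k ^ i := by
  induction l with
  | nil => simp [listEval]
  | cons a l ih =>
    rw [List.length_cons, Finset.sum_range_succ']
    have : listEval k (a :: l) = a + k * listEval k l := rfl
    rw [this, ih, Finset.mul_sum, add_comm]
    congr 1
    · exact Finset.sum_congr rfl fun i _ => by rw [List.getD_cons_succ]; ring
    · simp

theorem listEval_coeffList (k : ℤ) (f : ℤ[X]) : listEval k (coeffList f) = f.eval k := by
  rw [listEval_eq_sum, coeffList_length, eval_eq_sum_range]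
  simp only [coeffList_getD]

section Semantics

variable {d : ℤ[X] → ℤ → ℤ} {k : ℤ} {ρ : ℕ ⊕ ℕ → ℤ} {n : ℕ}

@[simp] theorem Fm.holds_not {φ : Fm} : (Fm.not φ).Holds d k n ρ ↔ ¬φ.Holds d k n ρ := Iff.rfl

@[simp] theorem Fm.holds_imp {φ ψ : Fm} :
    (Fm.imp φ ψ).Holds d k n ρ ↔ (φ.Holds d k n ρ → ψ.Holds d k n ρ) := Iff.rfl

@[simp] theorem Fm.holds_falsum : Fm.falsum.Holds d k n ρ ↔ False := Iff.rfl

@[simp] theorem Fm.holds_eq {s u : Tm} :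
    (Fm.eq s u).Holds d k n ρ ↔ s.eval d k ρ = u.eval d k ρ := Iff.rfl

@[simp] theorem Fm.holds_le {s u : Tm} :
    (Fm.le s u).Holds d k n ρ ↔ s.eval d k ρ ≤ u.eval d k ρ := Iff.rfl

@[simp] theorem Fm.holds_lt {s u : Tm} :
    (Fm.lt s u).Holds d k n ρ ↔ s.eval d k ρ < u.eval d k ρ := not_le

@[simp] theorem Fm.holds_and {φ ψ : Fm} :
    (Fm.and φ ψ).Holds d k n ρ ↔ φ.Holds d k n ρ ∧ ψ.Holds d k n ρ := by
  simp [Fm.and]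

theorem Fm.holds_disj {l : List Fm} :
    (Fm.disj l).Holds d k n ρ ↔ ∃ φ ∈ l, φ.Holds d k n ρ := by
  induction l with
  | nil => simp [disj]
  | cons φ l ih =>
    have : (disj (φ :: l)).Holds d k n ρ ↔ (¬φ.Holds d k n ρ → (disj l).Holds d k n ρ) := Iff.rfl
    rw [this, ih]
    simp only [List.mem_cons, exists_eq_or_imp]
    tauto

theorem Tm.eval_smul (m : ℕ) (s : Tm) : (Tm.smul m s).eval d k ρ = m * s.eval d k ρ := by
  induction m with
  | zero => simp [smul, eval]
  | succ m ih =>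
    have : Tm.smul (m + 1) s = .add s (Tm.smul m s) := rfl
    rw [this, eval, ih]
    push_cast
    ring

/-- Terms only allow natural multiples, so multiplication by `f` is split into two terms by the
signs of the coefficients. -/
theorem Tm.eval_posMul_sub (f : ℤ[X]) (s : Tm) :
    (Tm.posMul f s).eval d k ρ - (Tm.negMul f s).eval d k ρ = f.eval k * s.eval d k ρ := by
  rw [posMul, negMul, ← listEval_coeffList]
  induction coeffList f with
  | nil => simp [horner, listEval, eval]
  | cons a l ih =>
    have h : ∀ g : ℤ → ℕ, Tm.horner g (a :: l) s =
      .add (Tm.smul (g a) s) (.tmul (Tm.horner g l s)) := fun _ => rfl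
    have h' : listEval k (a :: l) = a + k * listEval k l := rfl
    simp only [h, h', eval, eval_smul]
    have ha : ((a.toNat : ℤ)) - ((-a).toNat : ℤ) = a := by omega
    linear_combination k * ih + s.eval d k ρ * ha

/-- The difference of the two remainders lies strictly between `-F` and `F`, so the floor loses one
exactly when the remainder of `a` is the smaller. -/
theorem sub_ediv_of_pos {F : ℤ} (hF : 0 < F) (a b : ℤ) :
    (b - F * (b / F) ≤ a - F * (a / F) → (a - b) / F = a / F - b / F) ∧
      (¬b - F * (b / F) ≤ a - F * (a / F) → (a - b) / F = a / F - (b / F + 1)) := by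
  have h1 := Int.mul_ediv_add_emod a F
  have h2 := Int.mul_ediv_add_emod b F
  have h3 := Int.emod_nonneg a hF.ne'
  have h4 := Int.emod_lt_of_pos a hF
  have h5 := Int.emod_nonneg b hF.ne'
  have h6 := Int.emod_lt_of_pos b hF
  constructor <;> intro h
  · have : a - b = (a % F - b % F) + F * (a / F - b / F) := by linarith
    rw [this, Int.add_mul_ediv_left _ _ hF.ne', Int.ediv_eq_zero_of_lt (by linarith) (by linarith)]
    ring
  · have : a - b = (a % F - b % F + F) + F * (a / F - (b / F + 1)) := by linarith
    rw [this, Int.add_mul_ediv_left _ _ hF.ne', Int.ediv_eq_zero_of_lt (by linarith) (by linarith)]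
    ring

theorem holds_modGe {f : ℤ[X]} (hf : f.eval k ≠ 0) (a b : Tm) :
    (modGe f a b).Holds d k n ρ ↔
      b.eval d k ρ - |f.eval k| * (b.eval d k ρ / |f.eval k|) ≤
        a.eval d k ρ - |f.eval k| * (a.eval d k ρ / |f.eval k|) := by
  have h1 := Tm.eval_posMul_sub (d := d) (k := k) (ρ := ρ) f .one
  have hP := Tm.eval_posMul_sub (d := d) (k := k) (ρ := ρ) f (.div f a)
  have hQ := Tm.eval_posMul_sub (d := d) (k := k) (ρ := ρ) f (.div f b)
  simp only [modGe, Fm.holds_and, Fm.holds_imp, Fm.holds_lt, Fm.holds_le, Tm.eval] at h1 ⊢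
  have e : ∀ s : Tm, (Tm.div f s).eval d k ρ = s.eval d k ρ / |f.eval k| := fun s => by
    rw [Tm.eval, if_neg hf]
  rw [e] at hP hQ
  rcases lt_or_gt_of_ne hf with h | h
  · rw [abs_of_neg h] at hP hQ ⊢
    constructor
    · rintro ⟨-, h2⟩
      have := h2 (by linarith)
      linarith
    · exact fun h2 => ⟨fun h3 => by linarith, fun _ => by linarith⟩
  · rw [abs_of_pos h] at hP hQ ⊢
    constructor
    · rintro ⟨h2, -⟩
      have := h2 (by linarith)
      linarith
    · exact fun h2 => ⟨fun _ => by linarith, fun h3 => by linarith⟩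

/-- The alternatives `l` describe the value `x` as a difference. -/
def Describes (d : ℤ[X] → ℤ → ℤ) (k : ℤ) (n : ℕ) (ρ : ℕ ⊕ ℕ → ℤ) (l : List (Fm × Tm × Tm)) (x : ℤ) :
    Prop :=
  (∀ a ∈ l, a.1.Holds d k n ρ → x = a.2.1.eval d k ρ - a.2.2.eval d k ρ) ∧
    ∃ a ∈ l, a.1.Holds d k n ρ

theorem describes_singleton {s u : Tm} :
    Describes d k n ρ [(.not .falsum, s, u)] (s.eval d k ρ - u.eval d k ρ) := by
  simp [Describes]

theorem Describes.add {l m : List (Fm × Tm × Tm)} {x y : ℤ} (hl : Describes d k n ρ l x)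
    (hm : Describes d k n ρ m y) : Describes d k n ρ
      (combine (fun x => (.and x.1.1 x.2.1, .add x.1.2.1 x.2.2.1, .add x.1.2.2 x.2.2.2)) l m)
      (x + y) := by
  refine ⟨fun c hc h => ?_, ?_⟩
  · simp only [combine, List.mem_flatMap, List.mem_map] at hc
    obtain ⟨a, ha, b, hb, rfl⟩ := hc
    rw [Fm.holds_and] at h
    rw [hl.1 a ha h.1, hm.1 b hb h.2]
    simp only [Tm.eval]
    ring
  · obtain ⟨a, ha, ha'⟩ := hl.2
    obtain ⟨b, hb, hb'⟩ := hm.2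
    refine ⟨_, List.mem_flatMap.2 ⟨a, ha, List.mem_map.2 ⟨b, hb, rfl⟩⟩, ?_⟩
    rw [Fm.holds_and]
    exact ⟨ha', hb'⟩

theorem Describes.tmul {l : List (Fm × Tm × Tm)} {x : ℤ} (hl : Describes d k n ρ l x) :
    Describes d k n ρ (l.map fun x => (x.1, .tmul x.2.1, .tmul x.2.2)) (k * x) := by
  refine ⟨fun c hc h => ?_, ?_⟩
  · obtain ⟨a, ha, rfl⟩ := List.mem_map.1 hc
    rw [hl.1 a ha h]
    simp only [Tm.eval]
    ring
  · obtain ⟨a, ha, ha'⟩ := hl.2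
    exact ⟨_, List.mem_map.2 ⟨a, ha, rfl⟩, ha'⟩

/-- The test `f(k) = 0` is written without division, and the two alternatives that contain the new
quotients demand `f(k) ≠ 0`. The value therefore does not involve the arbitrary function `d f` of
this division, whatever `d` is used on the left. -/
theorem Describes.div {l : List (Fm × Tm × Tm)} {x : ℤ} (hl : Describes d k n ρ l x) (f : ℤ[X]) :
    Describes d k n ρ (l.flatMap fun x => divAlts f x)
      (if f.eval k = 0 then 0 else x / |f.eval k|) := by
  have hz : (Fm.eq (.posMul f .one) (.negMul f .one)).Holds d k n ρ ↔ f.eval k = 0 := by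
    have := Tm.eval_posMul_sub (d := d) (k := k) (ρ := ρ) f .one
    simp only [Tm.eval] at this
    rw [Fm.holds_eq]
    constructor <;> intro h <;> linarith
  refine ⟨fun c hc h => ?_, ?_⟩
  · obtain ⟨a, ha, hc⟩ := List.mem_flatMap.1 hc
    simp only [divAlts, List.mem_cons, List.not_mem_nil, or_false] at hc
    rcases hc with rfl | rfl | rfl
    · rw [Fm.holds_and, hz] at h
      simp [h.2, Tm.eval]
    · simp only [Fm.holds_and, Fm.holds_not] at h
      rw [hz] at h
      obtain ⟨h1, h2, h3⟩ := h
      rw [if_neg h2, hl.1 a ha h1, (sub_ediv_of_pos (abs_pos.2 h2) _ _).1 ((holds_modGe h2 _ _).1 h3)]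
      simp [Tm.eval, h2]
    · simp only [Fm.holds_and, Fm.holds_not] at h
      rw [hz] at h
      obtain ⟨h1, h2, h3⟩ := h
      rw [if_neg h2, hl.1 a ha h1, (sub_ediv_of_pos (abs_pos.2 h2) _ _).2
        fun h => h3 ((holds_modGe h2 _ _).2 h)]
      simp [Tm.eval, h2]
  · obtain ⟨a, ha, ha'⟩ := hl.2
    simp only [List.mem_flatMap, divAlts, List.mem_cons, List.not_mem_nil, or_false]
    by_cases h0 : f.eval k = 0
    · exact ⟨_, ⟨a, ha, .inl rfl⟩, Fm.holds_and.2 ⟨ha', hz.2 h0⟩⟩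
    · by_cases hm : (modGe f a.2.1 a.2.2).Holds d k n ρ
      · exact ⟨_, ⟨a, ha, .inr (.inl rfl)⟩,
          Fm.holds_and.2 ⟨ha', Fm.holds_and.2 ⟨fun h => h0 (hz.1 h), hm⟩⟩⟩
      · exact ⟨_, ⟨a, ha, .inr (.inr rfl)⟩,
          Fm.holds_and.2 ⟨ha', Fm.holds_and.2 ⟨fun h => h0 (hz.1 h), hm⟩⟩⟩

/-- The alternatives are read with an arbitrary `d`, while the original term is read with `⌊x / 0⌋ =
0`: substitution guards every division of the term it acts on. The inserted terms `r.1`, `r.2.1` are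
still read with `d`. -/
theorem Tm.describes_alts (r : Tm × Tm × ℕ) (s : Tm) :
    Describes d k n ρ (s.alts r) (s.eval (fun _ _ => 0) k
      (Function.update ρ (.inr r.2.2) (r.1.eval d k ρ - r.2.1.eval d k ρ))) := by
  induction s with
  | var x =>
    simp only [alts, eval]
    split_ifs with h
    · rw [h, Function.update_self]
      exact describes_singleton
    · rw [Function.update_of_ne h]
      simpa [eval] using describes_singleton (d := d) (k := k) (n := n) (ρ := ρ) (s := .var x)
        (u := .zero)
  | zero =>
    simpa [eval, alts] using describes_singleton (d := d) (k := k) (n := n) (ρ := ρ) (s := .zero)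
      (u := .zero)
  | one =>
    simpa [eval, alts] using describes_singleton (d := d) (k := k) (n := n) (ρ := ρ) (s := .one)
      (u := .zero)
  | add s u hs hu => exact hs.add hu
  | tmul s hs => exact hs.tmul
  | div f s hs => exact hs.div f

theorem Describes.holds_disj {l m : List (Fm × Tm × Tm)} {x y : ℤ} (hl : Describes d k n ρ l x)
    (hm : Describes d k n ρ m y) {c : Tm → Tm → Fm} {p : Prop}
    (hc : ∀ a a' b b' : Tm, x = a.eval d k ρ - a'.eval d k ρ → y = b.eval d k ρ - b'.eval d k ρ →
      ((c (.add a b') (.add b a')).Holds d k n ρ ↔ p)) :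
    (Fm.disj (combine (fun x => .and (.and x.1.1 x.2.1)
      (c (.add x.1.2.1 x.2.2.2) (.add x.2.2.1 x.1.2.2))) l m)).Holds d k n ρ ↔ p := by
  rw [Fm.holds_disj]
  constructor
  · rintro ⟨φ, hφ, h⟩
    simp only [combine, List.mem_flatMap, List.mem_map] at hφ
    obtain ⟨a, ha, b, hb, rfl⟩ := hφ
    rw [Fm.holds_and, Fm.holds_and] at h
    exact (hc _ _ _ _ (hl.1 a ha h.1.1) (hm.1 b hb h.1.2)).1 h.2
  · intro hp
    obtain ⟨a, ha, ha'⟩ := hl.2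
    obtain ⟨b, hb, hb'⟩ := hm.2
    refine ⟨_, List.mem_flatMap.2 ⟨a, ha, List.mem_map.2 ⟨b, hb, rfl⟩⟩, ?_⟩
    rw [Fm.holds_and, Fm.holds_and]
    exact ⟨⟨ha', hb'⟩, (hc _ _ _ _ (hl.1 a ha ha') (hm.1 b hb hb')).2 hp⟩

theorem Fm.holds_subst (r : Tm × Tm × ℕ) {φ : Fm} (hφ : φ.QuantFree) :
    (φ.subst r).Holds d k n ρ ↔ φ.Holds (fun _ _ => 0) k n
      (Function.update ρ (.inr r.2.2) (r.1.eval d k ρ - r.2.1.eval d k ρ)) := by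
  induction φ with
  | falsum => exact Iff.rfl
  | eq s u =>
    refine Describes.holds_disj (s.describes_alts r) (u.describes_alts r) fun a a' b b' ha hb => ?_
    rw [holds_eq, holds_eq, ha, hb]
    simp only [Tm.eval]
    constructor <;> intro h <;> linarith
  | le s u =>
    refine Describes.holds_disj (s.describes_alts r) (u.describes_alts r) fun a a' b b' ha hb => ?_
    rw [holds_le, holds_le, ha, hb]
    simp only [Tm.eval]
    constructor <;> intro h <;> linarith
  | imp φ ψ h₁ h₂ => exact imp_congr (h₁ hφ.1) (h₂ hφ.2)
  | all φ => exact hφ.elim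

end Semantics

/-! ### Complexity of polynomials and terms -/

theorem pair_le_pair {a b c d : ℕ} (h : a ≤ c) (h' : b ≤ d) : Nat.pair a b ≤ Nat.pair c d := by
  rcases h.lt_or_eq with h | rfl <;> rcases h'.lt_or_eq with h' | rfl
  · exact ((Nat.pair_lt_pair_left b h).trans (Nat.pair_lt_pair_right c h')).le
  · exact (Nat.pair_lt_pair_left b h).le
  · exact (Nat.pair_lt_pair_right a h').le
  · exact le_rfl

/-- `PolyLevel c f`: the polynomial `f` is obtained from `0`, `1` and `-1` by sums and
multiplications by the indeterminate, with nesting depth at most `c`. -/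
inductive PolyLevel : ℕ → ℤ[X] → Prop
  | zero : PolyLevel 0 0
  | one : PolyLevel 0 1
  | neg_one : PolyLevel 0 (-1)
  | succ {c f} : PolyLevel c f → PolyLevel (c + 1) f
  | add {c f g} : PolyLevel c f → PolyLevel c g → PolyLevel (c + 1) (f + g)
  | X_mul {c f} : PolyLevel c f → PolyLevel (c + 1) (X * f)

namespace PolyLevel

theorem mono {c e : ℕ} {f : ℤ[X]} (h : c ≤ e) (hf : PolyLevel c f) : PolyLevel e f := by
  induction h with
  | refl => exact hf
  | step _ ih => exact ih.succ

theorem neg {c : ℕ} {f : ℤ[X]} (hf : PolyLevel c f) : PolyLevel c (-f) := by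
  induction hf with
  | zero => simpa using zero
  | one => exact neg_one
  | neg_one => simpa using one
  | succ _ ih => exact ih.succ
  | add _ _ h₁ h₂ => rw [neg_add]; exact h₁.add h₂
  | X_mul _ ih => rw [← mul_neg]; exact ih.X_mul

/-- The construction of `f` is repeated with `g` in place of `1`, so depths add. -/
theorem mul {c e : ℕ} {f g : ℤ[X]} (hf : PolyLevel c f) (hg : PolyLevel e g) :
    PolyLevel (c + e) (f * g) := by
  induction hf with
  | zero => simpa using zero.mono (Nat.zero_le e)
  | one => simpa using hg
  | neg_one => simpa using hg.neg
  | succ _ ih => exact ih.succ.mono (by omega)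
  | add _ _ h₁ h₂ => rw [add_mul]; exact (h₁.add h₂).mono (by omega)
  | X_mul _ ih => rw [mul_assoc]; exact ih.X_mul.mono (by omega)

theorem natCast (m : ℕ) : PolyLevel m (m : ℤ[X]) := by
  induction m with
  | zero => simpa using zero
  | succ m ih => push_cast; exact ih.add (one.mono (Nat.zero_le m))

theorem intCast (m : ℤ) : PolyLevel m.natAbs (C m) := by
  obtain ⟨a, rfl | rfl⟩ := m.eq_nat_or_neg
  · simpa using natCast a
  · simpa using (natCast a).neg

theorem coeff_le {c : ℕ} {f : ℤ[X]} (hf : PolyLevel c f) (i : ℕ) : |f.coeff i| ≤ 2 ^ c := by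
  induction hf generalizing i with
  | zero => simp
  | one => rw [coeff_one]; split_ifs <;> simp
  | neg_one => rw [coeff_neg, coeff_one]; split_ifs <;> simp
  | succ _ ih => exact (ih i).trans (pow_le_pow_right₀ (by norm_num) (by omega))
  | @add c f g _ _ h₁ h₂ =>
    rw [coeff_add, pow_succ]
    linarith [abs_add_le (f.coeff i) (g.coeff i), h₁ i, h₂ i]
  | @X_mul c f _ ih =>
    cases i with
    | zero => simp
    | succ i =>
      rw [coeff_X_mul]
      exact (ih i).trans (pow_le_pow_right₀ (by norm_num) (by omega))

theorem natDegree_le {c : ℕ} {f : ℤ[X]} (hf : PolyLevel c f) : f.natDegree ≤ c := by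
  induction hf with
  | zero => simp
  | one => simp
  | neg_one => simp
  | succ _ ih => omega
  | add _ _ h₁ h₂ => exact (natDegree_add_le _ _).trans (by omega)
  | X_mul _ ih => exact natDegree_mul_le.trans (by have := natDegree_X_le (R := ℤ); omega)

theorem eval_le {c : ℕ} {f : ℤ[X]} (hf : PolyLevel c f) (k : ℤ) :
    |f.eval k| ≤ max 2 |k| ^ c := by
  have h2 : (2 : ℤ) ≤ max 2 |k| := le_max_left _ _
  have hk : |k| ≤ max 2 |k| := le_max_right _ _
  generalize max 2 |k| = M at h2 hk
  induction hf with
  | zero => simp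
  | one => simp
  | neg_one => simp
  | succ _ ih => exact ih.trans (pow_le_pow_right₀ (by omega) (by omega))
  | @add c f g _ _ h₁ h₂ =>
    rw [eval_add, pow_succ]
    have := abs_add_le (f.eval k) (g.eval k)
    have := pow_pos (by omega : 0 < M) c
    nlinarith
  | X_mul _ ih =>
    rw [eval_mul, eval_X, abs_mul, pow_succ, mul_comm]
    exact mul_le_mul ih hk (abs_nonneg _) (by positivity)

/-- Polynomials have complexity bounded in terms of their codes. -/
theorem of_encode (f : ℤ[X]) : PolyLevel (2 * codePoly f) f := by
  have key : ∀ l : List ℤ, ∃ g : ℤ[X], PolyLevel (2 * Encodable.encode l) g ∧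
      ∀ i, g.coeff i = l.getD i 0 := by
    intro l
    induction l with
    | nil => exact ⟨0, zero.mono (Nat.zero_le _), by simp⟩
    | cons a l ih =>
      obtain ⟨g, hg, hc⟩ := ih
      refine ⟨C a + X * g, ?_, fun i => ?_⟩
      · have h1 := Nat.add_le_pair (Encodable.encode a) (Encodable.encode l)
        have h2 := encode_int a
        rw [Encodable.encode_list_cons]
        refine ((intCast a).mono (?_ : _ ≤ 2 * (Encodable.encode a + Encodable.encode l) + 1)).add
          (hg.X_mul.mono ?_) |>.mono ?_
        · split_ifs at h2 <;> omega
        · omega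
        · omega
      · cases i <;> simp [hc, coeff_C, -eq_intCast]
  obtain ⟨g, hg, hc⟩ := key (coeffList f)
  have : g = f := by
    ext i
    rw [hc, coeffList_getD]
  exact this ▸ hg

/-- Such an `f` has at most `c + 1` coefficients, each of absolute value at most `2 ^ c` and hence
of code at most `2 * 2 ^ c + 1`. Pairing is monotone, so the code of `f` is bounded by the
recursively defined number in `polyList`. -/
theorem mem_polyList {c : ℕ} {f : ℤ[X]} (hf : PolyLevel c f) : f ∈ polyList c := by
  have key : ∀ (m : ℕ) (l : List ℤ), l.length ≤ m → (∀ a ∈ l, |a| ≤ 2 ^ c) →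
      Encodable.encode l ≤ m.rec 0 fun _ w => Nat.succ (Nat.pair (2 * 2 ^ c + 1) w) := by
    intro m
    induction m with
    | zero =>
      intro l hl _
      rw [List.length_eq_zero_iff.1 (Nat.le_zero.1 hl)]
      simp
    | succ m ih =>
      intro l hl ha
      cases l with
      | nil => simp
      | cons a l =>
        rw [Encodable.encode_list_cons]
        refine Nat.succ_le_succ ((pair_le_pair ?_ (ih l (by simpa using hl)
          fun a h => ha a (by simp [h]))))
        have h1 := abs_le.1 (ha a (by simp))
        rw [encode_int]
        zify
        split_ifs <;> omega
  refine List.mem_filterMap.2 ⟨codePoly f, List.mem_range.2 (Nat.lt_succ_of_le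
    (key (c + 1) (coeffList f) ?_ ?_)), Encodable.encodek f⟩
  · have := hf.natDegree_le
    rw [coeffList_length]
    omega
  · intro a ha
    obtain ⟨i, -, rfl⟩ := List.mem_map.1 ha
    exact hf.coeff_le i

end PolyLevel

/-- The values of the polynomials of complexity `c`. -/
def polyValues (k : ℤ) (c : ℕ) : Set ℤ := {a | ∃ f, PolyLevel c f ∧ f.eval k = a}

/-- The values of the differences of terms of complexity `c`. -/
def termValues (k : ℤ) (ρ : ℕ ⊕ ℕ → ℤ) (l : List Tm) (c : ℕ) : Set ℤ :=
  {x | ∃ p ∈ testTerms l c, ∃ q ∈ testTerms l c,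
    x = p.eval (fun _ _ => 0) k ρ - q.eval (fun _ _ => 0) k ρ}

section TestTerms

variable {l : List Tm} {c : ℕ}

theorem mem_testTerms_succ {s : Tm} : s ∈ testTerms l (c + 1) ↔ s ∈ testTerms l c ∨
    (∃ u ∈ testTerms l c, ∃ v ∈ testTerms l c, Tm.add u v = s) ∨
    (∃ u ∈ testTerms l c, Tm.tmul u = s) ∨
    ∃ f ∈ polyList c, ∃ u ∈ testTerms l c, Tm.div f u = s := by
  have : testTerms l (c + 1) = testTerms l c ++
    ((testTerms l c).flatMap fun s => (testTerms l c).map fun u => .add s u) ++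
    (testTerms l c).map .tmul ++
    (polyList c).flatMap fun f => (testTerms l c).map fun s => .div f s := rfl
  rw [this]
  simp only [List.mem_append, List.mem_flatMap, List.mem_map, or_assoc]

theorem testTerms_mono {e : ℕ} (h : c ≤ e) {s : Tm} (hs : s ∈ testTerms l c) :
    s ∈ testTerms l e := by
  induction h with
  | refl => exact hs
  | step _ ih => exact mem_testTerms_succ.2 (.inl ih)

theorem mem_testTerms_zero {s : Tm} : s ∈ testTerms l 0 ↔ s ∈ l ∨ s = .zero ∨ s = .one := by
  have : testTerms l 0 = l ++ [.zero, .one] := rfl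
  simp [this]

end TestTerms

/-- This is where the abstract solution theory meets the language. The bounds concern syntactic
depth, so they are the same for all `k` and `ρ`. -/
theorem levels (k : ℤ) (ρ : ℕ ⊕ ℕ → ℤ) (l : List Tm) :
    Levels k (polyValues k) (termValues k ρ l) := by
  have R_mono : Monotone (termValues k ρ l) := by
    rintro c e h _ ⟨p, hp, q, hq, rfl⟩
    exact ⟨p, testTerms_mono h hp, q, testTerms_mono h hq, rfl⟩
  have R_add : ∀ {c x y}, x ∈ termValues k ρ l c → y ∈ termValues k ρ l c →
      x + y ∈ termValues k ρ l (c + 1) := by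
    rintro c _ _ ⟨p, hp, q, hq, rfl⟩ ⟨p', hp', q', hq', rfl⟩
    refine ⟨.add p p', mem_testTerms_succ.2 (.inr (.inl ⟨_, hp, _, hp', rfl⟩)), .add q q',
      mem_testTerms_succ.2 (.inr (.inl ⟨_, hq, _, hq', rfl⟩)), ?_⟩
    simp only [Tm.eval]
    ring
  have hzero : ∀ c, Tm.zero ∈ testTerms l c := fun c =>
    testTerms_mono (Nat.zero_le c) (mem_testTerms_zero.2 (by simp))
  have hone : ∀ c, Tm.one ∈ testTerms l c := fun c =>
    testTerms_mono (Nat.zero_le c) (mem_testTerms_zero.2 (by simp))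
  constructor
  · rintro c e h _ ⟨f, hf, rfl⟩
    exact ⟨f, hf.mono h, rfl⟩
  · exact R_mono
  · exact fun m => ⟨C m, .intCast m, eval_C⟩
  · exact ⟨X * 1, .X_mul .one, by simp⟩
  · rintro c _ _ ⟨f, hf, rfl⟩ ⟨g, hg, rfl⟩
    exact ⟨f + g, hf.add hg, eval_add⟩
  · rintro c e _ _ ⟨f, hf, rfl⟩ ⟨g, hg, rfl⟩
    exact ⟨f * g, hf.mul hg, eval_mul⟩
  · rintro c _ ⟨f, hf, rfl⟩
    exact hf.eval_le k
  · rintro c _ ⟨f, hf, rfl⟩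
    -- The expansion is in powers of `|k|`, so the signs of the powers of `k` move into the
    -- coefficients.
    refine ⟨fun i => f.coeff i * k.sign ^ i, fun i => ?_, ?_⟩
    · rw [abs_mul, abs_pow]
      have h1 : |k.sign| ≤ 1 := by
        rcases lt_trichotomy k 0 with h | rfl | h
        · simp [Int.sign_eq_neg_one_of_neg h]
        · simp
        · simp [Int.sign_eq_one_of_pos h]
      exact (mul_le_of_le_one_right (abs_nonneg _) (pow_le_one₀ (abs_nonneg _) h1)).trans
        (hf.coeff_le i)
    · rw [eval_eq_sum_range' (Nat.lt_succ_of_le hf.natDegree_le)]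
      refine Finset.sum_congr rfl fun i _ => ?_
      rw [mul_assoc, ← mul_pow, Int.sign_mul_abs]
  · exact ⟨.one, hone 0, .zero, hzero 0, by simp [Tm.eval]⟩
  · exact R_add
  · rintro c e _ x ⟨f, hf, rfl⟩ hx
    induction hf with
    | zero => simpa using ⟨.zero, hzero _, .zero, hzero _, by simp⟩
    | one => simpa using hx
    | neg_one =>
      obtain ⟨p, hp, q, hq, rfl⟩ := hx
      exact ⟨q, testTerms_mono (by omega) hq, p, testTerms_mono (by omega) hp, by simp⟩
    | succ _ ih => exact R_mono (by omega) ih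
    | add _ _ h₁ h₂ =>
      rw [eval_add, add_mul]
      exact R_mono (by omega) (R_add h₁ h₂)
    | @X_mul c f _ ih =>
      obtain ⟨p, hp, q, hq, h⟩ := ih
      rw [eval_mul, eval_X, mul_assoc, h]
      refine R_mono (by omega : c + e + 1 ≤ _)
        ⟨.tmul p, mem_testTerms_succ.2 (.inr (.inr (.inl ⟨_, hp, rfl⟩))), .tmul q,
        mem_testTerms_succ.2 (.inr (.inr (.inl ⟨_, hq, rfl⟩))), ?_⟩
      simp only [Tm.eval]
      ring
  · rintro c e _ _ ⟨f, hf, rfl⟩ ⟨p, hp, q, hq, rfl⟩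
    by_cases h0 : f.eval k = 0
    -- Here the quotient is division of integers by zero, whose value is `0`.
    · rw [h0]
      exact ⟨.zero, hzero _, .zero, hzero _, by simp⟩
    · have hf' : f ∈ polyList (c + e) := (hf.mono (by omega)).mem_polyList
      have hdiv : ∀ {u : Tm}, u ∈ testTerms l e → Tm.div f u ∈ testTerms l (c + e + 1) := fun hu =>
        mem_testTerms_succ.2 (.inr (.inr (.inr ⟨f, hf', _, testTerms_mono (by omega) hu, rfl⟩)))
      have hs := sub_ediv_of_pos (abs_pos.2 h0) (p.eval (fun _ _ => 0) k ρ)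
        (q.eval (fun _ _ => 0) k ρ)
      -- The quotient of a difference is the difference of the quotients up to a carry: one level
      -- pays for the divisions and one for adding `1`.
      refine ⟨.div f p, testTerms_mono (by omega) (hdiv hp), ?_⟩
      by_cases hle : q.eval (fun _ _ => 0) k ρ - |f.eval k| * (q.eval (fun _ _ => 0) k ρ / |f.eval k|) ≤
        p.eval (fun _ _ => 0) k ρ - |f.eval k| * (p.eval (fun _ _ => 0) k ρ / |f.eval k|)
      · exact ⟨.div f q, testTerms_mono (by omega) (hdiv hq), by
          rw [hs.1 hle]; simp [Tm.eval, h0]⟩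
      · exact ⟨.add (.div f q) .one, mem_testTerms_succ.2 (.inr (.inl ⟨_, hdiv hq, _, hone _, rfl⟩)),
          by rw [hs.2 hle]; simp [Tm.eval, h0]⟩

/-! ### Quantifier-free formulas as linear systems -/

section Enforceable

variable {ι : Type*} {P R : ℕ → Set ℤ} {S : Finset ι} {c : ℕ} {k : ℤ}

/-- Affine functions of the unknowns in `S` with coefficients of complexity `c`. -/
def IsAffine (P R : ℕ → Set ℤ) (S : Finset ι) (c : ℕ) (l : (ι → ℤ) → ℤ) : Prop :=
  ∃ (a : ι → ℤ) (β : ℤ), (∀ j ∈ S, a j ∈ P c) ∧ β ∈ R c ∧ ∀ X, l X = ∑ j ∈ S, a j * X j + β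

/-- A property of the unknowns in `S` that follows from linear inequalities with coefficients of
complexity `c` satisfied by `X₀`. -/
def Enforceable (P R : ℕ → Set ℤ) (S : Finset ι) (c : ℕ) (X₀ : ι → ℤ) (Q : (ι → ℤ) → Prop) : Prop :=
  ∃ W : Set ((ι → ℤ) × ℤ),
    (∀ w ∈ W, (∀ j ∈ S, w.1 j ∈ P c) ∧ w.2 ∈ R c ∧ ∑ j ∈ S, w.1 j * X₀ j ≤ w.2) ∧
    ∀ X, (∀ w ∈ W, ∑ j ∈ S, w.1 j * X j ≤ w.2) → Q X

namespace IsAffine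

theorem mono (h : Levels k P R) {e : ℕ} (hce : c ≤ e) {l : (ι → ℤ) → ℤ} (hl : IsAffine P R S c l) :
    IsAffine P R S e l := by
  obtain ⟨a, β, ha, hβ, hX⟩ := hl
  exact ⟨a, β, fun j hj => h.P_mono hce (ha j hj), h.R_mono hce hβ, hX⟩

theorem const (h : Levels k P R) {β : ℤ} (hβ : β ∈ R c) : IsAffine P R S c fun _ => β :=
  ⟨0, β, fun _ _ => h.P_mono (Nat.zero_le c) (h.P_int 0), hβ, by simp⟩

theorem apply [DecidableEq ι] (h : Levels k P R) {j : ι} (hj : j ∈ S) :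
    IsAffine P R S 1 fun X => X j :=
  ⟨Pi.single j 1, 0, fun i _ => by
    rcases eq_or_ne i j with rfl | hij
    · simpa using h.P_int 1
    · rw [Pi.single_eq_of_ne hij]; exact h.P_mono zero_le_one (h.P_int 0),
    h.R_mono zero_le_one (h.R_int 0), fun X => by
      simp [Pi.single_apply, hj]⟩

theorem add (h : Levels k P R) {l m : (ι → ℤ) → ℤ} (hl : IsAffine P R S c l)
    (hm : IsAffine P R S c m) : IsAffine P R S (c + 1) fun X => l X + m X := by
  obtain ⟨a, β, ha, hβ, hX⟩ := hl
  obtain ⟨a', β', ha', hβ', hX'⟩ := hm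
  refine ⟨a + a', β + β', fun j hj => h.P_add (ha j hj) (ha' j hj), h.R_add hβ hβ', fun X => ?_⟩
  simp only [hX, hX', Pi.add_apply, add_mul, Finset.sum_add_distrib]
  ring

theorem smul (h : Levels k P R) {e : ℕ} {p : ℤ} (hp : p ∈ P e) {l : (ι → ℤ) → ℤ}
    (hl : IsAffine P R S c l) : IsAffine P R S (e + c) fun X => p * l X := by
  obtain ⟨a, β, ha, hβ, hX⟩ := hl
  refine ⟨fun j => p * a j, p * β, fun j hj => h.P_mul hp (ha j hj), h.R_smul hp hβ, fun X => ?_⟩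
  simp only [hX, mul_add, Finset.mul_sum, mul_assoc]

end IsAffine

namespace Enforceable

variable {X₀ : ι → ℤ} {Q Q' : (ι → ℤ) → Prop}

theorem imp (hQ : Enforceable P R S c X₀ Q) (h : ∀ X, Q X → Q' X) : Enforceable P R S c X₀ Q' :=
  let ⟨W, hW, hW'⟩ := hQ
  ⟨W, hW, fun X hX => h X (hW' X hX)⟩

theorem and (hQ : Enforceable P R S c X₀ Q) (hQ' : Enforceable P R S c X₀ Q') :
    Enforceable P R S c X₀ fun X => Q X ∧ Q' X := by
  obtain ⟨W, hW, hQ⟩ := hQ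
  obtain ⟨W', hW', hQ'⟩ := hQ'
  refine ⟨W ∪ W', ?_, fun X hX => ⟨hQ X fun w hw => hX w (.inl hw), hQ' X fun w hw => hX w (.inr hw)⟩⟩
  rintro w (hw | hw)
  · exact hW w hw
  · exact hW' w hw

theorem of_forall (h : ∀ X, Q X) : Enforceable P R S c X₀ Q := ⟨∅, by simp, fun X _ => h X⟩

theorem le (h : Levels k P R) {l m : (ι → ℤ) → ℤ} (hl : IsAffine P R S c l)
    (hm : IsAffine P R S c m) (h₀ : l X₀ ≤ m X₀) :
    Enforceable P R S (c + 2) X₀ fun X => l X ≤ m X := by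
  obtain ⟨a, β, ha, hβ, hX⟩ := hl
  obtain ⟨a', β', ha', hβ', hX'⟩ := hm
  have key : ∀ X, ∑ j ∈ S, (a j - a' j) * X j ≤ β' - β ↔ l X ≤ m X := fun X => by
    simp only [hX, hX', sub_mul, Finset.sum_sub_distrib]
    constructor <;> intro h <;> linarith
  exact ⟨{(fun j => a j - a' j, β' - β)}, by
    rintro _ rfl
    exact ⟨fun j hj => h.P_sub (ha j hj) (ha' j hj), h.R_sub hβ' hβ, (key _).2 h₀⟩,
    fun X hX => (key X).1 (hX _ rfl)⟩

theorem exists_solution [DecidableEq ι] (h : Levels k P R) (hS : S.card ≤ c)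
    (hQ : Enforceable P R S c X₀ Q) : ∃ X, Q X ∧ ∀ j ∈ S, X j ∈ R (solLevel c) := by
  obtain ⟨W, hW, hQ⟩ := hQ
  obtain ⟨X, hX, hR⟩ := h.exists_solution S hS (fun w : W => w.1.1) (fun w => w.1.2) X₀
    (fun w => (hW w w.2).1) (fun w => (hW w w.2).2.1) fun w => (hW w w.2).2.2
  exact ⟨X, hQ X fun w hw => hX ⟨w, hw⟩, hR⟩

end Enforceable

end Enforceable

/-- A measure of the complexity of terms. -/
noncomputable def Tm.size : Tm → ℕ
  | .var _ => 1
  | .zero => 1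
  | .one => 1
  | .add s u => s.size + u.size + 1
  | .tmul s => s.size + 1
  | .div f s => 2 * codePoly f + s.size + 1

/-- A measure of the complexity of formulas. -/
noncomputable def Fm.size : Fm → ℕ
  | .falsum => 1
  | .eq s u => s.size + u.size + 1
  | .le s u => s.size + u.size + 1
  | .imp φ ψ => φ.size + ψ.size + 1
  | .all φ => φ.size + 1

theorem Tm.size_le (s : Tm) : s.size ≤ 2 * s.code + 1 := by
  induction s with
  | var x => simp [size]
  | zero => simp [size]
  | one => simp [size]
  | add s u hs hu =>
    have h1 := Nat.add_le_pair 4 (Nat.pair s.code u.code)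
    have h2 := Nat.add_le_pair s.code u.code
    simp only [size, code]
    omega
  | tmul s hs =>
    have h1 := Nat.add_le_pair 5 s.code
    simp only [size, code]
    omega
  | div f s hs =>
    have h1 := Nat.add_le_pair 6 (Nat.pair (codePoly f) s.code)
    have h2 := Nat.add_le_pair (codePoly f) s.code
    simp only [size, code]
    omega

theorem Fm.size_le (φ : Fm) : φ.size ≤ 2 * φ.code + 1 := by
  induction φ with
  | falsum => simp [size]
  | eq s u =>
    have h1 := Nat.add_le_pair 1 (Nat.pair s.code u.code)
    have h2 := Nat.add_le_pair s.code u.code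
    have := s.size_le
    have := u.size_le
    simp only [size, code]
    omega
  | le s u =>
    have h1 := Nat.add_le_pair 2 (Nat.pair s.code u.code)
    have h2 := Nat.add_le_pair s.code u.code
    have := s.size_le
    have := u.size_le
    simp only [size, code]
    omega
  | imp φ ψ hs hu =>
    have h1 := Nat.add_le_pair 3 (Nat.pair φ.code ψ.code)
    have h2 := Nat.add_le_pair φ.code ψ.code
    simp only [size, code]
    omega
  | all φ h =>
    have h1 := Nat.add_le_pair 4 φ.code
    simp only [size, code]
    omega

/-- The subterms that are quotients. -/
def Tm.divs : Tm → List Tm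
  | .add s u => s.divs ++ u.divs
  | .tmul s => s.divs
  | .div f s => .div f s :: s.divs
  | _ => []

/-- The quotients in a formula. -/
def Fm.divs : Fm → List Tm
  | .falsum => []
  | .eq s u => s.divs ++ u.divs
  | .le s u => s.divs ++ u.divs
  | .imp φ ψ => φ.divs ++ ψ.divs
  | .all φ => φ.divs

theorem Tm.length_divs_le (s : Tm) : s.divs.length ≤ s.size := by
  induction s <;> simp [divs, size] <;> omega

theorem Fm.length_divs_le (φ : Fm) : φ.divs.length ≤ φ.size := by
  induction φ with
  | falsum => simp [divs, size]
  | eq s u =>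
    have := s.length_divs_le
    have := u.length_divs_le
    simp [divs, size]
    omega
  | le s u =>
    have := s.length_divs_le
    have := u.length_divs_le
    simp [divs, size]
    omega
  | imp φ ψ h₁ h₂ => simp [divs, size]; omega
  | all φ h => simp [divs, size]; omega

/-- The value of a term where the values of the variable `y` and of the quotients are unknowns. -/
def Tm.linEval (k : ℤ) (ρ : ℕ ⊕ ℕ → ℤ) (y : ℕ ⊕ ℕ) (X : Tm → ℤ) : Tm → ℤ
  | .var x => if x = y then X (.var y) else ρ x
  | .zero => 0
  | .one => 1
  | .add s u => s.linEval k ρ y X + u.linEval k ρ y X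
  | .tmul s => k * s.linEval k ρ y X
  | .div f s => X (.div f s)

/-- The unknowns `X` satisfy the defining conditions of the quotients in `s`. -/
def Tm.Consistent (k : ℤ) (ρ : ℕ ⊕ ℕ → ℤ) (y : ℕ ⊕ ℕ) (X : Tm → ℤ) : Tm → Prop
  | .add s u => s.Consistent k ρ y X ∧ u.Consistent k ρ y X
  | .tmul s => s.Consistent k ρ y X
  | .div f s => s.Consistent k ρ y X ∧
      X (.div f s) = if f.eval k = 0 then 0 else s.linEval k ρ y X / |f.eval k|
  | _ => True

/-! ### Existence of witnesses -/

section Witness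

variable {k : ℤ} {ρ : ℕ ⊕ ℕ → ℤ} {y : ℕ ⊕ ℕ}

theorem Tm.Consistent.linEval_eq {X : Tm → ℤ} {s : Tm} (h : s.Consistent k ρ y X) :
    s.linEval k ρ y X = s.eval (fun _ _ => 0) k (Function.update ρ y (X (.var y))) := by
  induction s with
  | var x =>
    simp only [linEval, eval]
    split_ifs with hx
    · rw [hx, Function.update_self]
    · rw [Function.update_of_ne hx]
  | zero => rfl
  | one => rfl
  | add s u hs hu => rw [linEval, eval, hs h.1, hu h.2]
  | tmul s hs => rw [linEval, eval, hs h]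
  | div f s hs => rw [linEval, eval, h.2, hs h.1]

theorem Tm.linEval_self (s : Tm) :
    s.linEval k ρ y (fun u => u.eval (fun _ _ => 0) k ρ) = s.eval (fun _ _ => 0) k ρ := by
  induction s with
  | var x =>
    simp only [linEval, eval]
    split_ifs with hx
    · rw [hx]
    · rfl
  | zero => rfl
  | one => rfl
  | add s u hs hu => rw [linEval, eval, hs, hu]
  | tmul s hs => rw [linEval, eval, hs]
  | div f s hs => rfl

variable {l : List Tm} {S : Finset Tm}

/-- Once the quotients are unknowns, only addition and multiplication by `t` remain; the variables
other than `y` contribute to the constant part. -/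
theorem Tm.isAffine_linEval (hyS : .var y ∈ S) {s : Tm} (hS : ∀ u ∈ s.divs, u ∈ S)
    (hl : ∀ x ∈ s.vars, x ≠ y → .var x ∈ l) :
    IsAffine (polyValues k) (termValues k ρ l) S s.size fun X => s.linEval k ρ y X := by
  classical
  have h := levels k ρ l
  induction s with
  | var x =>
    simp only [linEval, size]
    split_ifs with hx
    · exact .apply h hyS
    · refine .const h (h.R_mono zero_le_one ⟨.var x, ?_, .zero, ?_, by simp [eval]⟩)
      · exact mem_testTerms_zero.2 (.inl (hl x (by simp [vars]) hx))
      · exact mem_testTerms_zero.2 (by simp)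
  | zero => exact .const h (h.R_mono zero_le_one (h.R_int 0))
  | one => exact .const h (h.R_int 1)
  | add s u hs hu =>
    simp only [divs, vars, List.mem_append] at hS hl
    exact .mono h (by simp only [size]; omega) (.add (c := s.size + u.size) h
      (.mono h (by omega) (hs (fun u hu => hS u (.inl hu)) fun x hx => hl x (.inl hx)))
      (.mono h (by omega) (hu (fun u hu => hS u (.inr hu)) fun x hx => hl x (.inr hx))))
  | tmul s hs => exact .mono h (by simp only [size]; omega) (.smul h h.P_param (hs hS hl))
  | div f s hs => exact .mono h (by simp only [size]; omega) (.apply h (hS _ (by simp [divs])))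

/-- For fixed `k`, a quotient `q = ⌊s / |f(k)|⌋` is determined by the linear inequalities `|f(k)| *
q ≤ s ≤ |f(k)| * q + |f(k)| - 1`, and by `q = 0` if `f(k) = 0`. -/
theorem Tm.enforceable_consistent (hyS : .var y ∈ S) {s : Tm} {c : ℕ} (hc : s.size + 7 ≤ c)
    (hS : ∀ u ∈ s.divs, u ∈ S) (hl : ∀ x ∈ s.vars, x ≠ y → .var x ∈ l) :
    Enforceable (polyValues k) (termValues k ρ l) S c (fun u => u.eval (fun _ _ => 0) k ρ)
      fun X => s.Consistent k ρ y X := by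
  classical
  have h := levels k ρ l
  induction s with
  | var x => exact .of_forall fun _ => trivial
  | zero => exact .of_forall fun _ => trivial
  | one => exact .of_forall fun _ => trivial
  | add s u hs hu =>
    simp only [divs, vars, size, List.mem_append] at hS hl hc
    exact .and (hs (by omega) (fun u hu => hS u (.inl hu)) fun x hx => hl x (.inl hx))
      (hu (by omega) (fun u hu => hS u (.inr hu)) fun x hx => hl x (.inr hx))
  | tmul s hs => exact hs (by simp only [size] at hc; omega) hS hl
  | div f s hs =>
    simp only [divs, vars, size, List.mem_cons] at hS hl hc
    refine .and (hs (by omega) (fun u hu => hS u (.inr hu)) hl) ?_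
    have hX : IsAffine (polyValues k) (termValues k ρ l) S 1 fun X => X (.div f s) :=
      .apply h (hS _ (.inl rfl))
    obtain ⟨e, rfl⟩ : ∃ e, c = e + 2 := ⟨c - 2, by omega⟩
    by_cases h0 : f.eval k = 0
    · simp only [h0, if_true]
      have hz : IsAffine (polyValues k) (termValues k ρ l) S e fun _ => 0 :=
        .const h (h.R_mono (Nat.zero_le e) (h.R_int 0))
      have hX' := hX.mono h (by omega : 1 ≤ e)
      have e0 : (Tm.div f s).eval (fun _ _ => 0) k ρ = 0 := by rw [eval, if_pos h0]
      exact (Enforceable.and (.le h hX' hz e0.le) (.le h hz hX' e0.ge)).imp fun X hX =>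
        le_antisymm hX.1 hX.2
    · simp only [h0, if_false]
      have hF := abs_pos.2 h0
      have hfP : |f.eval k| ∈ polyValues k (2 * codePoly f + 1) := by
        have hf : f.eval k ∈ polyValues k (2 * codePoly f) := ⟨f, .of_encode f, rfl⟩
        rcases abs_choice (f.eval k) with h' | h' <;> rw [h']
        · exact h.P_mono (by omega) hf
        · exact h.P_neg hf
      have e0 : (Tm.div f s).eval (fun _ _ => 0) k ρ = s.eval (fun _ _ => 0) k ρ / |f.eval k| := by
        rw [eval, if_neg h0]
      have hlin := Tm.isAffine_linEval (k := k) (ρ := ρ) (l := l) (s := s) hyS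
        (fun u hu => hS u (.inr hu)) hl
      have hFX := IsAffine.smul h hfP hX
      have hF1 : |f.eval k| - 1 ∈ termValues k ρ l (2 * codePoly f + 1 + 2) :=
        h.R_sub (h.R_of_P hfP) (h.R_mono (Nat.zero_le _) h.R_one)
      have hFX1 := IsAffine.add (c := 2 * codePoly f + 3) h (hFX.mono h (by omega))
        (.const h (h.R_mono (by omega) hF1))
      have hdiv := Int.mul_ediv_add_emod (s.eval (fun _ _ => 0) k ρ) |f.eval k|
      have h1 := Int.emod_nonneg (s.eval (fun _ _ => 0) k ρ) hF.ne'
      have h2 := Int.emod_lt_of_pos (s.eval (fun _ _ => 0) k ρ) hF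
      refine (Enforceable.and
        (.le h (hFX.mono h (by omega : _ ≤ e)) (hlin.mono h (by omega : _ ≤ e)) ?_)
        (.le h (hlin.mono h (by omega : _ ≤ e)) (hFX1.mono h (by omega : _ ≤ e)) ?_)).imp
        fun X hX => ?_
      · rw [Tm.linEval_self]
        dsimp only
        rw [e0]
        linarith
      · rw [Tm.linEval_self]
        dsimp only
        rw [e0]
        linarith
      · refine le_antisymm ((Int.le_ediv_iff_mul_le hF).2 ?_)
          (Int.lt_add_one_iff.1 ((Int.ediv_lt_iff_lt_mul hF).2 ?_))
        · linarith [hX.1]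
        · linarith [hX.2]

/-- The truth value of each atom at the given point is preserved: a true `s ≤ u` is imposed as it
is, a false one as `u + 1 ≤ s`, and an equation is treated as two inequalities. Propositional
combinations then keep their truth values too, so no disjunctive normal form is needed. -/
theorem Fm.enforceable_holds (hyS : .var y ∈ S) {φ : Fm} (hφ : φ.QuantFree) {c n : ℕ}
    (hc : φ.size + 7 ≤ c) (hS : ∀ u ∈ φ.divs, u ∈ S) (hl : ∀ x ∈ φ.vars, x ≠ y → .var x ∈ l) :
    Enforceable (polyValues k) (termValues k ρ l) S c (fun u => u.eval (fun _ _ => 0) k ρ)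
      fun X => (φ.Holds (fun _ _ => 0) k n (Function.update ρ y (X (.var y))) ↔
        φ.Holds (fun _ _ => 0) k n ρ) := by
  have h := levels k ρ l
  have atom : ∀ s u : Tm, s.size + u.size + 8 ≤ c → (∀ v ∈ s.divs ++ u.divs, v ∈ S) →
      (∀ x ∈ s.vars ++ u.vars, x ≠ y → .var x ∈ l) →
      Enforceable (polyValues k) (termValues k ρ l) S c (fun u => u.eval (fun _ _ => 0) k ρ)
      fun X => (s.eval (fun _ _ => 0) k (Function.update ρ y (X (.var y))) ≤
        u.eval (fun _ _ => 0) k (Function.update ρ y (X (.var y))) ↔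
        s.eval (fun _ _ => 0) k ρ ≤ u.eval (fun _ _ => 0) k ρ) := by
    intro s u hc hS hl
    simp only [List.mem_append] at hS hl
    have hs := Tm.isAffine_linEval (k := k) (ρ := ρ) (l := l) (s := s) hyS
      (fun v hv => hS v (.inl hv)) fun x hx => hl x (.inl hx)
    have hu := Tm.isAffine_linEval (k := k) (ρ := ρ) (l := l) (s := u) hyS
      (fun v hv => hS v (.inr hv)) fun x hx => hl x (.inr hx)
    have cs := Tm.enforceable_consistent (k := k) (ρ := ρ) (l := l) (s := s) hyS (c := c) (by omega)
      (fun v hv => hS v (.inl hv)) fun x hx => hl x (.inl hx)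
    have cu := Tm.enforceable_consistent (k := k) (ρ := ρ) (l := l) (s := u) hyS (c := c) (by omega)
      (fun v hv => hS v (.inr hv)) fun x hx => hl x (.inr hx)
    obtain ⟨e, rfl⟩ : ∃ e, c = e + 2 := ⟨c - 2, by omega⟩
    by_cases hle : s.eval (fun _ _ => 0) k ρ ≤ u.eval (fun _ _ => 0) k ρ
    · refine ((cs.and cu).and (.le h (hs.mono h (by omega : _ ≤ e)) (hu.mono h (by omega : _ ≤ e))
        ?_)).imp fun X hX => ?_
      · rwa [Tm.linEval_self, Tm.linEval_self]
      · rw [← hX.1.1.linEval_eq, ← hX.1.2.linEval_eq]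
        exact iff_of_true hX.2 hle
    · have hu1 := IsAffine.add (c := u.size + 1) h (hu.mono h (by omega))
        (.const h (h.R_mono (by omega) (h.R_int 1)))
      refine ((cs.and cu).and (.le h (hu1.mono h (by omega : _ ≤ e)) (hs.mono h (by omega : _ ≤ e))
        ?_)).imp fun X hX => ?_
      · rw [Tm.linEval_self, Tm.linEval_self]
        omega
      · rw [← hX.1.1.linEval_eq, ← hX.1.2.linEval_eq]
        exact iff_of_false (by have := hX.2; omega) hle
  induction φ with
  | falsum => exact .of_forall fun _ => Iff.rfl
  | eq s u =>
    simp only [size] at hc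
    refine ((atom s u (by omega) hS hl).and (atom u s (by omega) ?_ ?_)).imp fun X hX => ?_
    · simp only [divs, List.mem_append] at hS ⊢
      exact fun v hv => hS v hv.symm
    · simp only [vars, List.mem_append] at hl ⊢
      exact fun v hv => hl v hv.symm
    · rw [holds_eq, holds_eq, le_antisymm_iff, hX.1, hX.2, ← le_antisymm_iff]
  | le s u =>
    simp only [size] at hc
    exact atom s u (by omega) hS hl
  | imp φ ψ h₁ h₂ =>
    simp only [divs, vars, size, List.mem_append] at hS hl hc
    exact ((h₁ hφ.1 (by omega) (fun u hu => hS u (.inl hu)) fun x hx => hl x (.inl hx)).and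
      (h₂ hφ.2 (by omega) (fun u hu => hS u (.inr hu)) fun x hx => hl x (.inr hx))).imp
      fun X hX => imp_congr hX.1 hX.2
  | all φ => exact hφ.elim

theorem Tm.eval_congr {d : ℤ[X] → ℤ → ℤ} {ρ' : ℕ ⊕ ℕ → ℤ} {s : Tm}
    (h : ∀ x ∈ s.vars, ρ x = ρ' x) : s.eval d k ρ = s.eval d k ρ' := by
  induction s with
  | var x => exact h x (by simp [vars])
  | zero => rfl
  | one => rfl
  | add s u hs hu =>
    simp only [vars, List.mem_append] at h
    rw [eval, eval, hs fun x hx => h x (.inl hx), hu fun x hx => h x (.inr hx)]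
  | tmul s hs => rw [eval, eval, hs h]
  | div f s hs => rw [eval, eval, hs h]

theorem exists_mem_vars_of_mem_testTerms {c : ℕ} {s : Tm} (hs : s ∈ testTerms l c) {x : ℕ ⊕ ℕ}
    (hx : x ∈ s.vars) : ∃ u ∈ l, x ∈ u.vars := by
  induction c generalizing s with
  | zero =>
    rcases mem_testTerms_zero.1 hs with h | rfl | rfl
    · exact ⟨s, h, hx⟩
    · simp [Tm.vars] at hx
    · simp [Tm.vars] at hx
  | succ c ih =>
    rcases mem_testTerms_succ.1 hs with h | ⟨u, hu, v, hv, rfl⟩ | ⟨u, hu, rfl⟩ | ⟨f, -, u, hu, rfl⟩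
    · exact ih h hx
    · rcases List.mem_append.1 hx with h | h
      · exact ih hu h
      · exact ih hv h
    · exact ih hu hx
    · exact ih hu hx

theorem Fm.mem_vars_of_mem_witnessTerms {φ : Fm} {n : ℕ} {s : Tm} (hs : s ∈ φ.witnessTerms n)
    {x : ℕ ⊕ ℕ} (hx : x ∈ s.vars) : x ∈ φ.vars ∧ x ≠ .inr n := by
  obtain ⟨u, hu, hxu⟩ := exists_mem_vars_of_mem_testTerms hs hx
  obtain ⟨z, hz, hu⟩ := List.mem_flatMap.1 hu
  split_ifs at hu with h
  · simp at hu
  · rw [List.mem_singleton.1 hu, Tm.vars, List.mem_singleton] at hxu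
    rw [hxu]
    exact ⟨hz, h⟩

/-- A satisfiable quantifier-free formula is satisfied by a difference of witness terms. -/
theorem Fm.exists_witness {φ : Fm} (hφ : φ.QuantFree) {n m : ℕ} {x : ℤ}
    (hx : φ.Holds (fun _ _ => 0) k m (Function.update ρ (.inr n) x)) :
    ∃ p ∈ φ.witnessTerms n, ∃ q ∈ φ.witnessTerms n, φ.Holds (fun _ _ => 0) k m
      (Function.update ρ (.inr n) (p.eval (fun _ _ => 0) k ρ - q.eval (fun _ _ => 0) k ρ)) := by
  classical
  have hsize := φ.size_le
  have hlen := φ.length_divs_le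
  obtain ⟨X, hX, hR⟩ := (Fm.enforceable_holds (k := k) (ρ := Function.update ρ (.inr n) x)
    (y := .inr n) (l := φ.varTerms n) (S := insert (.var (.inr n)) φ.divs.toFinset)
    (Finset.mem_insert_self _ _) hφ (c := 2 * φ.code + 11) (n := m) (by omega)
    (fun u hu => Finset.mem_insert_of_mem (List.mem_toFinset.2 hu))
    fun z hz hzn => List.mem_flatMap.2 ⟨z, hz, by simp [hzn]⟩).exists_solution (levels k _ _)
    ((Finset.card_insert_le _ _).trans (by have := φ.divs.toFinset_card_le; omega))
  obtain ⟨p, hp, q, hq, hpq⟩ := hR _ (Finset.mem_insert_self _ _)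
  -- Witness terms do not mention the eliminated variable, so their values do not depend on the
  -- unknown satisfying `x`.
  have key : ∀ s ∈ φ.witnessTerms n, s.eval (fun _ _ => 0) k (Function.update ρ (.inr n) x) =
      s.eval (fun _ _ => 0) k ρ := fun s hs => Tm.eval_congr fun z hz =>
    Function.update_of_ne (Fm.mem_vars_of_mem_witnessTerms hs hz).2 _ _
  have h := hX.2 hx
  rw [Function.update_idem, hpq, key p hp, key q hq] at h
  exact ⟨p, hp, q, hq, h⟩

end Witness

/-! ### Correctness of the elimination and control of variables -/

section Elimination

attribute [local irreducible] Fm.witnessTerms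

variable {d : ℤ[X] → ℤ → ℤ} {k : ℤ} {ρ : ℕ ⊕ ℕ → ℤ}

/-- The depth only tells a quantifier which variable it binds. -/
theorem Fm.QuantFree.holds_iff {φ : Fm} (hφ : φ.QuantFree) {m n : ℕ} :
    φ.Holds d k m ρ ↔ φ.Holds d k n ρ := by
  induction φ with
  | falsum => rfl
  | eq s u => rfl
  | le s u => rfl
  | imp φ ψ h₁ h₂ => exact imp_congr (h₁ hφ.1) (h₂ hφ.2)
  | all φ => exact hφ.elim

theorem Fm.holds_elimEx {φ : Fm} (hφ : φ.QuantFree) {m n : ℕ} :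
    (φ.elimEx n).Holds (fun _ _ => 0) k m ρ ↔
      ∃ x, φ.Holds (fun _ _ => 0) k m (Function.update ρ (.inr n) x) := by
  rw [elimEx, holds_disj]
  constructor
  · rintro ⟨ψ, hψ, h⟩
    obtain ⟨p, -, hψ⟩ := List.mem_flatMap.1 hψ
    obtain ⟨q, -, rfl⟩ := List.mem_map.1 hψ
    exact ⟨_, (holds_subst (p, q, n) hφ).1 h⟩
  · rintro ⟨x, hx⟩
    obtain ⟨p, hp, q, hq, h⟩ := exists_witness hφ hx
    exact ⟨_, List.mem_flatMap.2 ⟨p, hp, List.mem_map.2 ⟨q, hq, rfl⟩⟩,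
      (holds_subst (p, q, n) hφ).2 h⟩

/-- All variables of a term belong to `V`. -/
def Tm.Over (V : Set (ℕ ⊕ ℕ)) : Tm → Prop
  | .var x => x ∈ V
  | .zero => True
  | .one => True
  | .add s u => s.Over V ∧ u.Over V
  | .tmul s => s.Over V
  | .div _ s => s.Over V

/-- A formula is quantifier-free and all its variables belong to `V`. -/
def Fm.QuantFreeOver (V : Set (ℕ ⊕ ℕ)) : Fm → Prop
  | .falsum => True
  | .eq s u => s.Over V ∧ u.Over V
  | .le s u => s.Over V ∧ u.Over V
  | .imp φ ψ => φ.QuantFreeOver V ∧ ψ.QuantFreeOver V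
  | .all _ => False

variable {V W : Set (ℕ ⊕ ℕ)}

theorem Tm.over_iff {s : Tm} : s.Over V ↔ ∀ x ∈ s.vars, x ∈ V := by
  induction s with
  | var x => simp [Over, vars]
  | zero => simp [Over, vars]
  | one => simp [Over, vars]
  | add s u hs hu => simp [Over, vars, hs, hu, or_imp, forall_and]
  | tmul s hs => exact hs
  | div f s hs => exact hs

theorem Fm.quantFreeOver_iff {φ : Fm} :
    φ.QuantFreeOver V ↔ φ.QuantFree ∧ ∀ x ∈ φ.vars, x ∈ V := by
  induction φ with
  | falsum => simp [QuantFreeOver, QuantFree, vars]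
  | eq s u => simp [QuantFreeOver, QuantFree, vars, Tm.over_iff, or_imp, forall_and]
  | le s u => simp [QuantFreeOver, QuantFree, vars, Tm.over_iff, or_imp, forall_and]
  | imp φ ψ h₁ h₂ =>
    simp only [QuantFreeOver, QuantFree, vars, h₁, h₂, List.mem_append, or_imp, forall_and]
    tauto
  | all φ => simp [QuantFreeOver, QuantFree]

theorem Fm.quantFreeOver_not {φ : Fm} : (Fm.not φ).QuantFreeOver V ↔ φ.QuantFreeOver V := by
  simp [Fm.not, QuantFreeOver]

theorem Fm.quantFreeOver_disj {l : List Fm} (h : ∀ φ ∈ l, φ.QuantFreeOver V) :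
    (disj l).QuantFreeOver V := by
  induction l with
  | nil => trivial
  | cons φ l ih =>
    exact ⟨⟨h φ (by simp), trivial⟩, ih fun ψ hψ => h ψ (by simp [hψ])⟩

theorem Tm.Over.smul {s : Tm} (hs : s.Over V) (m : ℕ) : (Tm.smul m s).Over V := by
  induction m with
  | zero => trivial
  | succ m ih => exact ⟨hs, ih⟩

theorem Tm.Over.horner {s : Tm} (hs : s.Over V) (g : ℤ → ℕ) (l : List ℤ) :
    (Tm.horner g l s).Over V := by
  induction l with
  | nil => trivial
  | cons a l ih => exact ⟨hs.smul _, ih⟩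

theorem Tm.Over.posMul {s : Tm} (hs : s.Over V) (f : ℤ[X]) : (Tm.posMul f s).Over V :=
  hs.horner _ _

theorem Tm.Over.negMul {s : Tm} (hs : s.Over V) (f : ℤ[X]) : (Tm.negMul f s).Over V :=
  hs.horner _ _

theorem quantFreeOver_modGe {a b : Tm} (ha : a.Over V) (hb : b.Over V) (f : ℤ[X]) :
    (modGe f a b).QuantFreeOver V := by
  have h1 : Tm.one.Over V := trivial
  have hP : (Tm.div f a).Over V := ha
  have hQ : (Tm.div f b).Over V := hb
  simp [modGe, Fm.and, Fm.lt, Fm.not, Fm.QuantFreeOver, Tm.Over, ha, hb, h1.posMul f, h1.negMul f,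
    hP.posMul f, hP.negMul f, hQ.posMul f, hQ.negMul f]

theorem Tm.over_alts {r : Tm × Tm × ℕ} (h₁ : r.1.Over V) (h₂ : r.2.1.Over V) {s : Tm}
    (hs : s.Over (insert (.inr r.2.2) V)) :
    ∀ a ∈ s.alts r, a.1.QuantFreeOver V ∧ a.2.1.Over V ∧ a.2.2.Over V := by
  induction s with
  | var x =>
    intro a ha
    rw [alts] at ha
    split_ifs at ha with hx
    · rw [List.mem_singleton.1 ha]
      exact ⟨⟨trivial, trivial⟩, h₁, h₂⟩
    · rw [List.mem_singleton.1 ha]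
      exact ⟨⟨trivial, trivial⟩, hs.resolve_left hx, trivial⟩
  | zero =>
    intro a ha
    rw [List.mem_singleton.1 ha]
    exact ⟨⟨trivial, trivial⟩, trivial, trivial⟩
  | one =>
    intro a ha
    rw [List.mem_singleton.1 ha]
    exact ⟨⟨trivial, trivial⟩, trivial, trivial⟩
  | add s u ihs ihu =>
    intro c hc
    simp only [alts, combine, List.mem_flatMap, List.mem_map] at hc
    obtain ⟨a, ha, b, hb, rfl⟩ := hc
    have ha' := ihs hs.1 a ha
    have hb' := ihu hs.2 b hb
    simp [Fm.and, Fm.not, Fm.QuantFreeOver, Over, ha', hb']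
  | tmul s ihs =>
    intro c hc
    obtain ⟨a, ha, rfl⟩ := List.mem_map.1 hc
    exact ihs hs a ha
  | div f s ihs =>
    intro c hc
    obtain ⟨a, ha, hc⟩ := List.mem_flatMap.1 hc
    obtain ⟨ha₁, ha₂, ha₃⟩ := ihs hs a ha
    have hone : Tm.one.Over V := trivial
    have hm := quantFreeOver_modGe ha₂ ha₃ f
    simp only [divAlts, List.mem_cons, List.not_mem_nil, or_false] at hc
    rcases hc with rfl | rfl | rfl <;>
      simp [Fm.and, Fm.not, Fm.QuantFreeOver, Over, ha₁, ha₂, ha₃, hm, hone.posMul f, hone.negMul f]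

theorem Fm.QuantFreeOver.subst {r : Tm × Tm × ℕ} (h₁ : r.1.Over V) (h₂ : r.2.1.Over V) {φ : Fm}
    (hφ : φ.QuantFreeOver (insert (.inr r.2.2) V)) : (φ.subst r).QuantFreeOver V := by
  have atom : ∀ {s u : Tm}, s.Over (insert (.inr r.2.2) V) → u.Over (insert (.inr r.2.2) V) →
      ∀ {c : Tm → Tm → Fm}, (∀ {a b : Tm}, a.Over V → b.Over V → (c a b).QuantFreeOver V) →
      (Fm.disj (combine (fun x => .and (.and x.1.1 x.2.1)
        (c (.add x.1.2.1 x.2.2.2) (.add x.2.2.1 x.1.2.2)))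
        (s.alts r) (u.alts r))).QuantFreeOver V := by
    intro s u hs hu c hc
    refine quantFreeOver_disj fun ψ hψ => ?_
    simp only [combine, List.mem_flatMap, List.mem_map] at hψ
    obtain ⟨a, ha, b, hb, rfl⟩ := hψ
    obtain ⟨ha₁, ha₂, ha₃⟩ := Tm.over_alts h₁ h₂ hs a ha
    obtain ⟨hb₁, hb₂, hb₃⟩ := Tm.over_alts h₁ h₂ hu b hb
    have := hc (a := .add a.2.1 b.2.2) (b := .add b.2.1 a.2.2) ⟨ha₂, hb₃⟩ ⟨hb₂, ha₃⟩
    simp [Fm.and, Fm.not, QuantFreeOver, ha₁, hb₁, this]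
  induction φ with
  | falsum => trivial
  | eq s u => exact atom hφ.1 hφ.2 fun ha hb => ⟨ha, hb⟩
  | le s u => exact atom hφ.1 hφ.2 fun ha hb => ⟨ha, hb⟩
  | imp φ ψ ih₁ ih₂ => exact ⟨ih₁ hφ.1, ih₂ hφ.2⟩
  | all φ => exact hφ.elim

theorem Fm.QuantFreeOver.elimEx {φ : Fm} {n : ℕ} (hφ : φ.QuantFreeOver (insert (.inr n) V)) :
    (φ.elimEx n).QuantFreeOver V := by
  have hvars := (quantFreeOver_iff.1 hφ).2
  have hw : ∀ s ∈ φ.witnessTerms n, s.Over V := fun s hs => Tm.over_iff.2 fun x hx =>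
    have h := mem_vars_of_mem_witnessTerms hs hx
    (hvars x h.1).resolve_left h.2
  rw [Fm.elimEx]
  refine quantFreeOver_disj fun ψ hψ => ?_
  obtain ⟨p, hp, hψ⟩ := List.mem_flatMap.1 hψ
  obtain ⟨q, hq, rfl⟩ := List.mem_map.1 hψ
  exact hφ.subst (r := (p, q, n)) (hw p hp) (hw q hq)

/-- The free variables in `A` and the first `n` bound variables. -/
def scope (A : Set ℕ) (n : ℕ) : Set (ℕ ⊕ ℕ) := {x | Sum.elim (· ∈ A) (· < n) x}

/-- Under `n` quantifiers, all variables of the formula are bound or belong to `A`. -/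
def Fm.Scoped (A : Set ℕ) : ℕ → Fm → Prop
  | _, .falsum => True
  | n, .eq s u => s.Over (scope A n) ∧ u.Over (scope A n)
  | n, .le s u => s.Over (scope A n) ∧ u.Over (scope A n)
  | n, .imp φ ψ => φ.Scoped A n ∧ ψ.Scoped A n
  | n, .all φ => φ.Scoped A (n + 1)

theorem scope_succ (A : Set ℕ) (n : ℕ) : scope A (n + 1) = insert (.inr n) (scope A n) := by
  ext x
  rcases x with i | j
  · simp [scope]
  · simp only [scope, Set.mem_ofPred_eq, Sum.elim_inr, Set.mem_insert_iff, Sum.inr.injEq]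
    omega

theorem Fm.Scoped.quantFreeOver_qe {A : Set ℕ} {n : ℕ} {φ : Fm} (hφ : φ.Scoped A n) :
    (φ.qe n).QuantFreeOver (scope A n) := by
  induction φ generalizing n with
  | falsum => trivial
  | eq s u => exact hφ
  | le s u => exact hφ
  | imp φ ψ h₁ h₂ => exact ⟨h₁ hφ.1, h₂ hφ.2⟩
  | all φ h =>
    have := h hφ
    rw [scope_succ] at this
    rw [qe, quantFreeOver_not]
    exact (quantFreeOver_not.2 this).elimEx

theorem Fm.Scoped.holds_qe {A : Set ℕ} {n : ℕ} {φ : Fm} (hφ : φ.Scoped A n) :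
    (φ.qe n).Holds (fun _ _ => 0) k n ρ ↔ φ.Holds (fun _ _ => 0) k n ρ := by
  induction φ generalizing n ρ with
  | falsum => rfl
  | eq s u => rfl
  | le s u => rfl
  | imp φ ψ h₁ h₂ => exact imp_congr (h₁ hφ.1) (h₂ hφ.2)
  | all φ h =>
    have hq := (quantFreeOver_iff.1 (Scoped.quantFreeOver_qe (φ := φ) hφ)).1
    have hn : (Fm.not (φ.qe (n + 1))).QuantFree := ⟨hq, trivial⟩
    rw [qe, holds_not, holds_elimEx hn, not_exists]
    refine forall_congr' fun x => ?_
    rw [holds_not, not_not, hq.holds_iff (n := n + 1)]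
    exact h hφ

end Elimination

/-! ### Translation between formulas of the language and syntax trees -/

section Translation

/-- Terms of the language as elements of `Tm`. -/
def ofTerm {n : ℕ} : L.Term (ℕ ⊕ Fin n) → Tm
  | .var (.inl i) => .var (.inl i)
  | .var (.inr i) => .var (.inr i)
  | .func .zero _ => .zero
  | .func .one _ => .one
  | .func .add ts => .add (ofTerm (ts 0)) (ofTerm (ts 1))
  | .func .tmul ts => .tmul (ofTerm (ts 0))
  | .func (.div f) ts => .div f (ofTerm (ts 0))

/-- Formulas of the language as elements of `Fm`. -/
def ofBounded : {n : ℕ} → L.BoundedFormula ℕ n → Fm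
  | _, .falsum => .falsum
  | _, .equal s u => .eq (ofTerm s) (ofTerm u)
  | _, .rel .le ts => .le (ofTerm (ts 0)) (ofTerm (ts 1))
  | _, .imp φ ψ => .imp (ofBounded φ) (ofBounded ψ)
  | _, .all φ => .all (ofBounded φ)

/-- Elements of `Tm` as terms of the language, with `0` for the bound variables. -/
def toTerm : Tm → L.Term (ℕ ⊕ Fin 0)
  | .var (.inl i) => .var (.inl i)
  | .var (.inr _) => .func (Func.zero : L.Functions 0) ![]
  | .zero => .func (Func.zero : L.Functions 0) ![]
  | .one => .func (Func.one : L.Functions 0) ![]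
  | .add s u => .func (Func.add : L.Functions 2) ![toTerm s, toTerm u]
  | .tmul s => .func (Func.tmul : L.Functions 1) ![toTerm s]
  | .div f s => .func (Func.div f : L.Functions 1) ![toTerm s]

/-- Quantifier-free elements of `Fm` as formulas of the language. -/
def toFormula : Fm → L.Formula ℕ
  | .falsum => .falsum
  | .eq s u => .equal (toTerm s) (toTerm u)
  | .le s u => .rel (Rel.le : L.Relations 2) ![toTerm s, toTerm u]
  | .imp φ ψ => .imp (toFormula φ) (toFormula ψ)
  | .all _ => .falsum

theorem code_ofTerm {n : ℕ} (s : L.Term (ℕ ⊕ Fin n)) : (ofTerm s).code = codeTerm s := by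
  induction s with
  | var x => rcases x with i | i <;> simp [ofTerm, Tm.code, codeTerm]
  | func f ts ih => cases f <;> simp [ofTerm, Tm.code, codeTerm, ih]

theorem code_ofBounded {n : ℕ} (φ : L.BoundedFormula ℕ n) : (ofBounded φ).code = codeBounded φ := by
  induction φ with
  | falsum => simp [ofBounded, Fm.code, codeBounded]
  | equal s u => simp [ofBounded, Fm.code, codeBounded, code_ofTerm]
  | rel R ts => cases R; simp [ofBounded, Fm.code, codeBounded, code_ofTerm]
  | imp φ ψ h₁ h₂ => simp [ofBounded, Fm.code, codeBounded, h₁, h₂]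
  | all φ h => simp [ofBounded, Fm.code, codeBounded, h]

/-- The hypothesis excludes bound variables, for which `toTerm` returns the placeholder `0`. -/
theorem code_toTerm {A : Set ℕ} {s : Tm} (hs : s.Over (scope A 0)) :
    codeTerm (toTerm s) = s.code := by
  induction s with
  | var x =>
    rcases x with i | i
    · simp [toTerm, Tm.code, codeTerm]
    · exact absurd hs (Nat.not_lt_zero i)
  | zero => simp [toTerm, Tm.code, codeTerm]
  | one => simp [toTerm, Tm.code, codeTerm]
  | add s u ihs ihu => simp [toTerm, Tm.code, codeTerm, ihs hs.1, ihu hs.2]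
  | tmul s ihs => simp [toTerm, Tm.code, codeTerm, ihs hs]
  | div f s ihs => simp [toTerm, Tm.code, codeTerm, ihs hs]

theorem code_toFormula {A : Set ℕ} {φ : Fm} (hφ : φ.QuantFreeOver (scope A 0)) :
    code (toFormula φ) = φ.code := by
  rw [code]
  induction φ with
  | falsum => simp [toFormula, Fm.code, codeBounded]
  | eq s u => simp [toFormula, Fm.code, codeBounded, code_toTerm hφ.1, code_toTerm hφ.2]
  | le s u => simp [toFormula, Fm.code, codeBounded, code_toTerm hφ.1, code_toTerm hφ.2]
  | imp φ ψ h₁ h₂ => simp [toFormula, Fm.code, codeBounded, h₁ hφ.1, h₂ hφ.2]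
  | all φ => exact hφ.elim

theorem isQF_toFormula (φ : Fm) : (toFormula φ).IsQF := by
  induction φ with
  | falsum => exact .falsum
  | eq s u => exact .of_isAtomic (.equal _ _)
  | le s u => exact .of_isAtomic (.rel _ _)
  | imp φ ψ h₁ h₂ => exact h₁.imp h₂
  | all φ => exact .falsum

theorem varFinsetLeft_toTerm {A : Set ℕ} {s : Tm} (hs : s.Over (scope A 0)) :
    ∀ i ∈ (toTerm s).varFinsetLeft, i ∈ A := by
  induction s with
  | var x =>
    rcases x with i | i
    · intro j hj
      rw [toTerm, Language.Term.varFinsetLeft, Finset.mem_singleton] at hj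
      exact hj ▸ hs
    · simp [toTerm, Language.Term.varFinsetLeft]
  | zero => simp [toTerm, Language.Term.varFinsetLeft]
  | one => simp [toTerm, Language.Term.varFinsetLeft]
  | add s u ihs ihu =>
    intro i hi
    simp only [toTerm, Language.Term.varFinsetLeft, Finset.mem_biUnion, Fin.exists_fin_two] at hi
    rcases hi with ⟨-, h⟩ | ⟨-, h⟩
    · exact ihs hs.1 i h
    · exact ihu hs.2 i h
  | tmul s ihs =>
    intro i hi
    simp only [toTerm, Language.Term.varFinsetLeft, Finset.mem_biUnion, Fin.exists_fin_one] at hi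
    exact ihs hs i hi.2
  | div f s ihs =>
    intro i hi
    simp only [toTerm, Language.Term.varFinsetLeft, Finset.mem_biUnion, Fin.exists_fin_one] at hi
    exact ihs hs i hi.2

theorem freeVarFinset_toFormula {A : Set ℕ} {φ : Fm} (hφ : φ.QuantFreeOver (scope A 0)) :
    ∀ i ∈ (toFormula φ).freeVarFinset, i ∈ A := by
  induction φ with
  | falsum => simp [toFormula, Language.BoundedFormula.freeVarFinset]
  | eq s u =>
    intro i hi
    simp only [toFormula, Language.BoundedFormula.freeVarFinset, Finset.mem_union] at hi
    exact hi.elim (varFinsetLeft_toTerm hφ.1 i) (varFinsetLeft_toTerm hφ.2 i)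
  | le s u =>
    intro i hi
    simp only [toFormula, Language.BoundedFormula.freeVarFinset, Finset.mem_biUnion,
      Fin.exists_fin_two] at hi
    rcases hi with ⟨-, h⟩ | ⟨-, h⟩
    · exact varFinsetLeft_toTerm hφ.1 i h
    · exact varFinsetLeft_toTerm hφ.2 i h
  | imp φ ψ h₁ h₂ =>
    intro i hi
    simp only [toFormula, Language.BoundedFormula.freeVarFinset, Finset.mem_union] at hi
    exact hi.elim (h₁ hφ.1 i) (h₂ hφ.2 i)
  | all φ => exact hφ.elim

theorem over_ofTerm {A : Set ℕ} {n : ℕ} {s : L.Term (ℕ ⊕ Fin n)} (hs : ↑s.varFinsetLeft ⊆ A) :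
    (ofTerm s).Over (scope A n) := by
  induction s with
  | var x =>
    rcases x with i | i
    · exact hs (by simp [Language.Term.varFinsetLeft])
    · exact i.2
  | func f ts ih =>
    have h : ∀ i, (ofTerm (ts i)).Over (scope A n) := fun i => ih i fun j hj =>
      hs (by simpa [Language.Term.varFinsetLeft] using ⟨i, hj⟩)
    cases f with
    | zero => simp [ofTerm, Tm.Over]
    | one => simp [ofTerm, Tm.Over]
    | add => simpa [ofTerm, Tm.Over] using ⟨h 0, h 1⟩
    | tmul => simpa [ofTerm, Tm.Over] using h 0
    | div f => simpa [ofTerm, Tm.Over] using h 0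

theorem scoped_ofBounded {A : Set ℕ} {n : ℕ} {φ : L.BoundedFormula ℕ n}
    (hφ : ↑φ.freeVarFinset ⊆ A) : (ofBounded φ).Scoped A n := by
  induction φ with
  | falsum => simp [ofBounded, Fm.Scoped]
  | equal s u =>
    simp only [Language.BoundedFormula.freeVarFinset, Finset.coe_union, Set.union_subset_iff] at hφ
    simpa [ofBounded, Fm.Scoped] using ⟨over_ofTerm hφ.1, over_ofTerm hφ.2⟩
  | rel R ts =>
    cases R
    have h : ∀ i, (ofTerm (ts i)).Over (scope A _) := fun i => over_ofTerm fun j hj =>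
      hφ (Finset.mem_coe.2 (Finset.mem_biUnion.2 ⟨i, Finset.mem_univ i, hj⟩))
    simpa [ofBounded, Fm.Scoped] using ⟨h 0, h 1⟩
  | imp φ ψ h₁ h₂ =>
    simp only [Language.BoundedFormula.freeVarFinset, Finset.coe_union, Set.union_subset_iff] at hφ
    simpa [ofBounded, Fm.Scoped] using ⟨h₁ hφ.1, h₂ hφ.2⟩
  | all φ h => simpa [ofBounded, Fm.Scoped] using h hφ

variable {d : ℤ[X] → ℤ → ℤ} {k : ℤ}

theorem eval_ofTerm {n : ℕ} {ρ : ℕ ⊕ ℕ → ℤ} {v : ℕ → ℤ} {xs : Fin n → ℤ}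
    (hv : ∀ i, ρ (.inl i) = v i) (hx : ∀ i : Fin n, ρ (.inr i) = xs i) (s : L.Term (ℕ ⊕ Fin n)) :
    (ofTerm s).eval d k ρ = @Language.Term.realize L ℤ (str d k) _ (Sum.elim v xs) s := by
  induction s with
  | var x =>
    rcases x with i | i
    · simp [ofTerm, Tm.eval, Language.Term.realize, hv]
    · simp [ofTerm, Tm.eval, Language.Term.realize, hx]
  | func f ts ih =>
    cases f <;> simp [ofTerm, Tm.eval, Language.Term.realize, ih, Language.Structure.funMap]

theorem holds_ofBounded {n : ℕ} {ρ : ℕ ⊕ ℕ → ℤ} {v : ℕ → ℤ} {xs : Fin n → ℤ}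
    (hv : ∀ i, ρ (.inl i) = v i) (hx : ∀ i : Fin n, ρ (.inr i) = xs i)
    (φ : L.BoundedFormula ℕ n) :
    (ofBounded φ).Holds d k n ρ ↔ @Language.BoundedFormula.Realize L ℤ (str d k) _ _ φ v xs := by
  induction φ generalizing ρ with
  | falsum => simp [ofBounded, Language.BoundedFormula.Realize]
  | equal s u =>
    simp [ofBounded, Language.BoundedFormula.Realize, eval_ofTerm hv hx]
  | rel R ts =>
    cases R
    simp [ofBounded, Language.BoundedFormula.Realize, eval_ofTerm hv hx,
      Language.Structure.RelMap]
  | imp φ ψ h₁ h₂ =>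
    simp [ofBounded, Language.BoundedFormula.Realize, h₁ hv hx, h₂ hv hx]
  | @all n φ h =>
    simp only [ofBounded, Fm.Holds, Language.BoundedFormula.Realize]
    refine forall_congr' fun x => h (fun i => ?_) fun i => ?_
    · rw [Function.update_of_ne (by simp), hv]
    · induction i using Fin.lastCases with
      | last => simp
      | cast i =>
        rw [Fin.snoc_castSucc, Function.update_of_ne (by simpa using i.2.ne), Fin.val_castSucc, hx]

theorem realize_toTerm {ρ : ℕ ⊕ ℕ → ℤ} {v : ℕ → ℤ} {xs : Fin 0 → ℤ}
    (hv : ∀ i, ρ (.inl i) = v i) {A : Set ℕ} {s : Tm} (hs : s.Over (scope A 0)) :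
    @Language.Term.realize L ℤ (str d k) _ (Sum.elim v xs) (toTerm s) = s.eval d k ρ := by
  induction s with
  | var x =>
    rcases x with i | i
    · simp [toTerm, Tm.eval, hv]
    · exact absurd hs (Nat.not_lt_zero i)
  | zero => rfl
  | one => rfl
  | add s u ihs ihu =>
    simp [toTerm, Tm.eval, ← ihs hs.1, ← ihu hs.2,
      Language.Structure.funMap]
  | tmul s ihs =>
    simp [toTerm, Tm.eval, ← ihs hs, Language.Structure.funMap]
  | div f s ihs =>
    simp [toTerm, Tm.eval, ← ihs hs, Language.Structure.funMap]

theorem satWith_toFormula {ρ : ℕ ⊕ ℕ → ℤ} {v : ℕ → ℤ} (hv : ∀ i, ρ (.inl i) = v i)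
    {A : Set ℕ} {φ : Fm} (hφ : φ.QuantFreeOver (scope A 0)) :
    SatWith d k (toFormula φ) v ↔ φ.Holds d k 0 ρ := by
  unfold SatWith Language.Formula.Realize
  induction φ with
  | falsum => rfl
  | eq s u =>
    simp [toFormula, Fm.Holds, Language.BoundedFormula.Realize, realize_toTerm hv hφ.1,
      realize_toTerm hv hφ.2]
  | le s u =>
    simp [toFormula, Fm.Holds, Language.BoundedFormula.Realize, realize_toTerm hv hφ.1,
      realize_toTerm hv hφ.2, Language.Structure.RelMap]
  | imp φ ψ h₁ h₂ => exact imp_congr (h₁ hφ.1) (h₂ hφ.2)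
  | all φ => exact hφ.elim

end Translation

/-! ### Assembly of the algorithm -/

/-- Quantifier elimination. The substitution guards the divisions against division by zero. -/
noncomputable def Fm.guardedQE (φ : Fm) : Fm := (φ.qe 0).subst (.zero, .zero, 0)

theorem quantFreeOver_guardedQE (φ : L.Formula ℕ) :
    (ofBounded φ).guardedQE.QuantFreeOver (scope φ.freeVarFinset 0) := by
  -- No bound variable occurs at depth `0`, so replacing `Sum.inr 0` by `0 - 0` is a dummy
  -- substitution, performed only for its guards. They are needed because the witness terms inserted
  -- by `Fm.qe` contain unguarded divisions.
  refine Fm.QuantFreeOver.subst (r := (.zero, .zero, 0)) trivial trivial ?_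
  have h := (scoped_ofBounded (A := φ.freeVarFinset) (φ := φ) subset_rfl).quantFreeOver_qe
  rw [Fm.quantFreeOver_iff] at h ⊢
  exact ⟨h.1, fun x hx => .inr (h.2 x hx)⟩

/-- The reading `d` occurs only on the left, so this one equivalence gives both the correctness of
the elimination and the independence from division by zero. -/
theorem satWith_guardedQE (d : ℤ[X] → ℤ → ℤ) (k : ℤ) (φ : L.Formula ℕ) (v : ℕ → ℤ) :
    SatWith d k (toFormula (ofBounded φ).guardedQE) v ↔ Sat k φ v := by
  have h := scoped_ofBounded (A := φ.freeVarFinset) (φ := φ) subset_rfl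
  rw [satWith_toFormula (ρ := Sum.elim v 0) (v := v) (fun _ => rfl) (quantFreeOver_guardedQE φ),
    Fm.guardedQE, Fm.holds_subst _ (Fm.quantFreeOver_iff.1 h.quantFreeOver_qe).1, h.holds_qe]
  exact holds_ofBounded (fun i => by simp) (fun i => i.elim0) φ

theorem effective_guardedQE : Effective fun φ => toFormula (ofBounded φ).guardedQE := by
  have hF : Primrec Fm.guardedQE := Fm.primrec_subst.comp (Primrec.const _)
    (Fm.primrec_qe.comp (Primrec.const 0) Primrec.id)
  -- Numbers that are not Gödel numbers of syntax trees are sent to the default value `0`.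
  refine ⟨fun n => ((Encodable.decode n : Option Fm).map fun ψ =>
    Encodable.encode ψ.guardedQE).getD 0, ?_, fun φ => ?_⟩
  · exact (Primrec.option_getD.comp (Primrec.option_map Primrec.decode
      (Primrec.encode.comp (hF.comp Primrec.snd)).to₂) (Primrec.const 0)).to_comp
  · rw [code_toFormula (quantFreeOver_guardedQE φ), code, ← code_ofBounded, ← encode_fm]
    dsimp only
    rw [Encodable.encodek, Option.map_some, Option.getD_some, encode_fm]

end ParametricPresburger

theorem theorem1 :
    ∃ F : ParametricPresburger.L.Formula ℕ → ParametricPresburger.L.Formula ℕ,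
      ParametricPresburger.Effective F ∧
      ∀ φ : ParametricPresburger.L.Formula ℕ,
        (F φ).IsQF ∧
        (F φ).freeVarFinset ⊆ φ.freeVarFinset ∧
        ParametricPresburger.DivGuarded (F φ) ∧
        ∀ (k : ℤ) (v : ℕ → ℤ),
          ParametricPresburger.Sat k φ v ↔ ParametricPresburger.Sat k (F φ) v := by
  open ParametricPresburger in
  exact ⟨_, effective_guardedQE, fun φ => ⟨isQF_toFormula _,
    freeVarFinset_toFormula (quantFreeOver_guardedQE φ),
    fun d k v => (satWith_guardedQE d k φ v).trans (satWith_guardedQE _ k φ v).symm,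
    fun k v => (satWith_guardedQE _ k φ v).symm⟩⟩
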